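/- **Proposition 5.8.** Let $(M,g,\mathcal F)$ be a connected smooth Riemannian manifold with a foliation $\mathcal F$ and a bundle-like metric $g$, let $(M',g',\mathcal F')$ be another smooth Riemannian manifold with a foliation and a bundle-like metric, and let $Q=TM/T\mathcal F\cong T\mathcal F^{\perp}$, $Q'=TM'/T\mathcal F'\cong T\mathcal F'^{\perp}$ be the normal bundles with the induced holonomy invariant metrics $g_Q$, $g_{Q'}$ and their transverse Levi-Civita connections. Let $\phi:M\to M'$ be a smooth foliated map (i.e. $d\phi(T\mathcal F)\subset T\mathcal F'$). Its transversal differential $d_T\phi:Q\to Q'$, the map induced by $d\phi$ on the normal bundles, is a section of $Q^*\otimes\phi^{-1}Q'$; let $\nabla$ also denote the induced connections on $Q^*\otimes\phi^{-1}Q'$ and $Q^*\otimes Q^*$. Let $f:M\to\mathbb R$ be a non-constant basic function, i.e. $f$ is smooth and $X(f)=0$ for all $X$ tangent to $\mathcal F$. Assume that 1. $\phi$ is transversally $f$-harmonic, i.e. $\tau_{b,f}(\phi)=\sum_a\big(\nabla_{E_a}(e^{-f}d_T\phi)\big)(E_a)=0$ on $M$, where $\{E_a\}$ is a local orthonormal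 frame of $Q$; and 2. $\phi$ satisfies the transverse $f$-conservation law $\mathrm{div}_\nabla\big(e^{-f}S_T(\phi)\big)=0$ on $M$, where $S_T(\phi)=\tfrac12|d_T\phi|^2g_Q-\phi^*g_{Q'}$ with $|d_T\phi|^2=\sum_a g_{Q'}(d_T\phi(E_a),d_T\phi(E_a))$ and $(\phi^*g_{Q'})(X,Y)=g_{Q'}(d_T\phi(X),d_T\phi(Y))$, and $(\mathrm{div}_\nabla S)(X)=\sum_a(\nabla_{E_a}S)(E_a,X)$ for $X\in\Gamma Q$. Then $\phi$ is transversally constant, i.e. $d_T\phi=0$ on all of $M$. -/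

import Mathlib

open Bundle
open scoped Manifold ContDiff Topology

noncomputable section

/-- The model `ℝᵖ × ℝ^q` of a foliated chart: leaf coordinates and transversal coordinates. -/
abbrev FoliatedModel (p q : ℕ) : Type :=
  EuclideanSpace ℝ (Fin p) × EuclideanSpace ℝ (Fin q)

/-- A smooth foliation of dimension `p` and codimension `q` on the smooth `n`-manifold `M`, given by
a foliated atlas: smooth charts `(x, y)` with values in `ℝᵖ × ℝ^q`, covering `M`, such that the
changes of charts are locally of the form `(x, y) ↦ (α(x, y), β(y))`. -/
structure Foliation (p q n : ℕ) (M : Type*) [TopologicalSpace M]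
    [ChartedSpace (EuclideanSpace ℝ (Fin n)) M] where
  atlas : Set (OpenPartialHomeomorph M (FoliatedModel p q))
  smooth : ∀ e ∈ atlas, ContMDiffOn (𝓡 n) 𝓘(ℝ, FoliatedModel p q) ∞ e e.source
  smooth_symm : ∀ e ∈ atlas, ContMDiffOn 𝓘(ℝ, FoliatedModel p q) (𝓡 n) ∞ e.symm e.target
  cover : ∀ x : M, ∃ e ∈ atlas, x ∈ e.source
  compat : ∀ e ∈ atlas, ∀ e' ∈ atlas, ∀ x ∈ e.source ∩ e'.source,
    ∃ β : EuclideanSpace ℝ (Fin q) → EuclideanSpace ℝ (Fin q),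
      ∀ᶠ z in 𝓝 x, (e' z).2 = β (e z).2

namespace Foliation

section Single

variable {p q n : ℕ} {M : Type*} [TopologicalSpace M]
  [ChartedSpace (EuclideanSpace ℝ (Fin n)) M]

/-- The transversal coordinate components `dy^a(v)` of a tangent vector `v` at `x`, for the chart
`e = (x, y)`. -/
def dy (e : OpenPartialHomeomorph M (FoliatedModel p q)) (a : Fin q) (x : M)
    (v : TangentSpace (𝓡 n) x) : ℝ :=
  mvfderiv (𝓡 n) (fun z : M => (e z).2 a) x v

variable (F : Foliation p q n M)

/-- The tangent space `T_x𝓕` of the leaf through `x`: the vectors on which all the differentials of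
transversal coordinates vanish. -/
def tangent (x : M) : Submodule ℝ (TangentSpace (𝓡 n) x) :=
  ⨅ e ∈ {e | e ∈ F.atlas ∧ x ∈ e.source},
    LinearMap.ker (mvfderiv (𝓡 n) (fun z : M => (e z).2) x).toLinearMap

/-- A basic function: smooth, with `X f = 0` for all `X` tangent to the leaves. -/
def IsBasic (f : M → ℝ) : Prop :=
  ContMDiff (𝓡 n) 𝓘(ℝ, ℝ) ∞ f ∧ ∀ x : M, ∀ v ∈ F.tangent x, mvfderiv (𝓡 n) f x v = 0

/-- The coordinate vector field `∂/∂y^a` of the chart `e = (x, y)`. -/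
def coordVec (e : OpenPartialHomeomorph M (FoliatedModel p q)) (a : Fin q) (x : M) :
    TangentSpace (𝓡 n) x :=
  (mfderiv 𝓘(ℝ, FoliatedModel p q) (𝓡 n) (fun z => e.symm z) (e x)
    ((0, EuclideanSpace.single a (1 : ℝ)) : FoliatedModel p q) : EuclideanSpace ℝ (Fin n))

instance finiteDimensionalTangentSpace (x : M) : FiniteDimensional ℝ (TangentSpace (𝓡 n) x) :=
  inferInstanceAs (FiniteDimensional ℝ (EuclideanSpace ℝ (Fin n)))

instance finiteDimensionalSubmodule (x : M) (S : Submodule ℝ (TangentSpace (𝓡 n) x)) :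
    FiniteDimensional ℝ S :=
  FiniteDimensional.finiteDimensional_submodule S

variable [IsManifold (𝓡 n) ∞ M] [RiemannianBundle (fun x : M => TangentSpace (𝓡 n) x)]

/-- The orthogonal projection `σ ∘ π : T_xM → Q_x ≅ T_x𝓕^⊥ ⊆ T_xM`. The normal bundle
`Q = TM / T𝓕` is identified with `T𝓕^⊥` through `σ`. -/
def normalProj (x : M) : TangentSpace (𝓡 n) x →L[ℝ] TangentSpace (𝓡 n) x :=
  (F.tangent x)ᗮ.starProjection

/-- The transversal metric `g_Q`, as a bilinear form on `T_xM` that factors through `Q_x`. -/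
def gQ (x : M) (v w : TangentSpace (𝓡 n) x) : ℝ :=
  inner ℝ (F.normalProj x v) (F.normalProj x w)

/-- The local frame of the normal bundle given by the classes of `∂/∂y^a`, as vectors in
`T𝓕^⊥`. -/
def frame (e : OpenPartialHomeomorph M (FoliatedModel p q)) (a : Fin q) (x : M) :
    TangentSpace (𝓡 n) x :=
  F.normalProj x (coordVec e a x)

/-- The matrix `g_ab = g_Q(∂/∂y^a, ∂/∂y^b)`. -/
def metricMatrix (e : OpenPartialHomeomorph M (FoliatedModel p q)) (x : M) :
    Matrix (Fin q) (Fin q) ℝ :=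
  Matrix.of fun a b => F.gQ x (F.frame e a x) (F.frame e b x)

/-- The Riemannian metric of `M` is bundle-like for the foliation: the induced metric `g_Q` is
holonomy invariant, that is `L_X g_Q = 0` for `X` tangent to the leaves. As
`[X, ∂/∂y^a]` is then tangent to the leaves, `(L_X g_Q)(∂/∂y^a, ∂/∂y^b) = X(g_ab)`. -/
def IsBundleLike : Prop :=
  ∀ e ∈ F.atlas, ∀ x ∈ e.source, ∀ v ∈ F.tangent x, ∀ a b : Fin q,
    mvfderiv (𝓡 n) (fun z : M => F.metricMatrix e z a b) x v = 0

/-- The Christoffel symbols `Γ^c_{ab}` of the transverse Levi-Civita connection of `Q`: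
`∇_{∂_a} ∂_b = Γ^c_{ab} ∂_c`, and `∇_X ∂_b = 0` for `X` tangent to the leaves. -/
def christoffel (e : OpenPartialHomeomorph M (FoliatedModel p q)) (x : M) (a b c : Fin q) : ℝ :=
  (1 / 2 : ℝ) * ∑ d, (F.metricMatrix e x)⁻¹ c d *
    (mvfderiv (𝓡 n) (fun z : M => F.metricMatrix e z b d) x (F.frame e a x)
      + mvfderiv (𝓡 n) (fun z : M => F.metricMatrix e z a d) x (F.frame e b x)
      - mvfderiv (𝓡 n) (fun z : M => F.metricMatrix e z a b) x (F.frame e d x))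

/-- The trace `tr_Q B = ∑_a B(E_a, E_a)` over an orthonormal basis `E_a` of `Q_x ≅ T_x𝓕^⊥`. -/
def trQ {W : Type*} [AddCommMonoid W] (x : M)
    (B : TangentSpace (𝓡 n) x → TangentSpace (𝓡 n) x → W) : W :=
  ∑ i, B (stdOrthonormalBasis ℝ (F.tangent x)ᗮ i : TangentSpace (𝓡 n) x)
    (stdOrthonormalBasis ℝ (F.tangent x)ᗮ i : TangentSpace (𝓡 n) x)

/-- The covariant derivative `(∇_Z S)(X, Y)` at `x` of a section `S` of `Q* ⊗ Q*`, computed in the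
foliated chart `e`. -/
def covDerivForm (e : OpenPartialHomeomorph M (FoliatedModel p q))
    (S : (x : M) → TangentSpace (𝓡 n) x → TangentSpace (𝓡 n) x → ℝ)
    (x : M) (Z X Y : TangentSpace (𝓡 n) x) : ℝ :=
  ∑ a, ∑ b, dy e a x X * dy e b x Y *
    (mvfderiv (𝓡 n) (fun z : M => S z (F.frame e a z) (F.frame e b z)) x Z
      - ∑ c, ∑ d, dy e c x Z * F.christoffel e x c a d * S x (F.frame e d x) (F.frame e b x)
      - ∑ c, ∑ d, dy e c x Z * F.christoffel e x c b d * S x (F.frame e a x) (F.frame e d x))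

/-- The divergence `(div_∇ S)(X) = ∑_a (∇_{E_a} S)(E_a, X)` at `x` of a section of `Q* ⊗ Q*`,
computed in the foliated chart `e`. -/
def divForm (e : OpenPartialHomeomorph M (FoliatedModel p q))
    (S : (x : M) → TangentSpace (𝓡 n) x → TangentSpace (𝓡 n) x → ℝ)
    (x : M) (X : TangentSpace (𝓡 n) x) : ℝ :=
  F.trQ x fun Z Y => F.covDerivForm e S x Z Y X

end Single

section Maps

variable {p q n p' q' n' : ℕ}
  {M : Type*} [TopologicalSpace M] [ChartedSpace (EuclideanSpace ℝ (Fin n)) M]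
  {M' : Type*} [TopologicalSpace M'] [ChartedSpace (EuclideanSpace ℝ (Fin n')) M']
  (F : Foliation p q n M) (F' : Foliation p' q' n' M')

/-- A smooth foliated map: a smooth map with `dφ(T𝓕) ⊆ T𝓕'`. -/
def IsFoliatedMap (φ : M → M') : Prop :=
  ContMDiff (𝓡 n) (𝓡 n') ∞ φ ∧
    ∀ x : M, ∀ v ∈ F.tangent x, mfderiv (𝓡 n) (𝓡 n') φ x v ∈ F'.tangent (φ x)

variable [IsManifold (𝓡 n) ∞ M] [RiemannianBundle (fun x : M => TangentSpace (𝓡 n) x)]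
  [IsManifold (𝓡 n') ∞ M'] [RiemannianBundle (fun x : M' => TangentSpace (𝓡 n') x)]

/-- The transversal differential `d_Tφ = π' ∘ dφ ∘ σ : Q → Q'`, with `Q ≅ T𝓕^⊥` and
`Q' ≅ T𝓕'^⊥`; it is extended by `0` to the vectors tangent to the leaves. -/
def dT (φ : M → M') (x : M) : TangentSpace (𝓡 n) x →L[ℝ] TangentSpace (𝓡 n') (φ x) :=
  (F'.normalProj (φ x)).comp ((mfderiv (𝓡 n) (𝓡 n') φ x).comp (F.normalProj x))

/-- `φ` is transversally constant: `d_Tφ = 0` everywhere. -/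
def IsTransversallyConstant (φ : M → M') : Prop :=
  ∀ x : M, F.dT F' φ x = 0

/-- The squared norm `|d_Tφ|² = ∑_a g_{Q'}(d_Tφ(E_a), d_Tφ(E_a))`. -/
def normSqDT (φ : M → M') (x : M) : ℝ :=
  F.trQ x fun X Y => F'.gQ (φ x) (F.dT F' φ x X) (F.dT F' φ x Y)

/-- The covariant derivative `(∇_Z A)(X)` at `x` of a section `A` of `Q* ⊗ φ⁻¹Q'`, with respect to
the connection induced by the transverse Levi-Civita connections of `Q` and `Q'`, computed in the
foliated charts `e` around `x` and `e'` around `φ x`. The value is a vector in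
`Q'_{φ x} ≅ T_{φ x}𝓕'^⊥`. -/
def covDerivHom (e : OpenPartialHomeomorph M (FoliatedModel p q))
    (e' : OpenPartialHomeomorph M' (FoliatedModel p' q')) (φ : M → M')
    (A : (x : M) → TangentSpace (𝓡 n) x →L[ℝ] TangentSpace (𝓡 n') (φ x))
    (x : M) (Z X : TangentSpace (𝓡 n) x) : TangentSpace (𝓡 n') (φ x) :=
  ∑ α, (∑ a, dy e a x X *
    (mvfderiv (𝓡 n) (fun z : M => dy e' α (φ z) (A z (F.frame e a z))) x Z
      - ∑ b, ∑ c, dy e b x Z * F.christoffel e x b a c * dy e' α (φ x) (A x (F.frame e c x))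
      + ∑ β, ∑ γ, dy e' β (φ x) (mfderiv (𝓡 n) (𝓡 n') φ x Z) *
          F'.christoffel e' (φ x) β γ α * dy e' γ (φ x) (A x (F.frame e a x)))) •
    F'.frame e' α (φ x)

/-- The transversal `f`-tension field `τ_{b,f}(φ) = tr_Q (∇_tr (e^{-f} d_Tφ))` at `x`, computed in
the foliated charts `e` around `x` and `e'` around `φ x`. -/
def tensionField (e : OpenPartialHomeomorph M (FoliatedModel p q))
    (e' : OpenPartialHomeomorph M' (FoliatedModel p' q')) (f : M → ℝ) (φ : M → M') (x : M) :
    TangentSpace (𝓡 n') (φ x) :=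
  F.trQ x fun Z X =>
    F.covDerivHom F' e e' φ (fun z => Real.exp (-f z) • F.dT F' φ z) x Z X

/-- `φ` is transversally `f`-harmonic: a smooth foliated map with `τ_{b,f}(φ) = 0`. -/
def IsTransversallyHarmonic (f : M → ℝ) (φ : M → M') : Prop :=
  F.IsFoliatedMap F' φ ∧ ∀ e ∈ F.atlas, ∀ e' ∈ F'.atlas, ∀ x ∈ e.source, φ x ∈ e'.source →
    F.tensionField F' e e' f φ x = 0

/-- The transversal stress-energy tensor `S_T(φ) = (1/2) |d_Tφ|² g_Q - φ^* g_{Q'}`. -/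
def stressEnergy (φ : M → M') (x : M) (X Y : TangentSpace (𝓡 n) x) : ℝ :=
  (1 / 2 : ℝ) * F.normSqDT F' φ x * F.gQ x X Y
    - F'.gQ (φ x) (F.dT F' φ x X) (F.dT F' φ x Y)

/-- The transverse `f`-conservation law `div_∇ (e^{-f} S_T(φ)) = 0`. -/
def SatisfiesConservationLaw (f : M → ℝ) (φ : M → M') : Prop :=
  ∀ e ∈ F.atlas, ∀ x ∈ e.source, ∀ X ∈ (F.tangent x)ᗮ,
    F.divForm e (fun z V W => Real.exp (-f z) * F.stressEnergy F' φ z V W) x X = 0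

end Maps

end Foliation

end

/-! Put U = e^{-f}. Expand div(U S_T)(X) and insert the weighted harmonicity equation paired with
d_Tφ(X). The second fundamental form ∇d_Tφ is symmetric and d|d_Tφ|² = 2⟨∇d_Tφ, d_Tφ⟩, so every term
cancels except ½|d_Tφ|² dU(X). Hence |d_Tφ|² dU = 0 (`stressEnergy_identity_aux`,
`energy_mul_pd_eq_zero`). Since f is not constant on the connected manifold M, dU is nonzero
somewhere, hence on a nonempty open set, and d_Tφ vanishes there (`nonempty_interior_dT_eq_zero`).

The vanishing then spreads by unique continuation. In a box of a foliated chart the transversal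
metric, its Christoffel symbols, f and the transversal components Φ of φ depend only on the
transversal coordinates, because the metrics are bundle-like, f is basic and φ is foliated. Both
equations therefore live on a ball of ℝ^q. The harmonicity equation has the scalar principal part
g^{ab}∂_a∂_bΦ; its other terms are linear or quadratic in dΦ, with no term in Φ alone. On a compact
set this gives |g^{ab}∂_a∂_bΦ| ≤ B|dΦ| (`exists_bound_principal`).

For such inequalities, a smooth solution whose differential vanishes near the centre of a ball has
zero differential on the whole ball (`unique_continuation`). The proof is a Carleman estimate with
weight e^{sψ}, ψ an exponential of -λ‖y-p‖² up to a constant: the part of the solution inside a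
chosen radius dominates the cutoff error as s → ∞. Hence the interior of {d_Tφ = 0} is closed
(`isClosed_interior_dT_eq_zero`), and being open and nonempty it is all of M. -/

open Bundle
open scoped Manifold ContDiff Topology

/-! ### Carleman estimate for second order elliptic operators in divergence form -/

namespace Elliptic

open MeasureTheory

variable {q : ℕ}

/-- The partial derivative of `u` in the `i`-th coordinate direction. -/
noncomputable def pd (i : Fin q) (u : EuclideanSpace ℝ (Fin q) → ℝ)
    (x : EuclideanSpace ℝ (Fin q)) : ℝ :=
  fderiv ℝ u x (EuclideanSpace.single i 1)

theorem contDiff_pd (i : Fin q) {u : EuclideanSpace ℝ (Fin q) → ℝ} (hu : ContDiff ℝ ∞ u) :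
    ContDiff ℝ ∞ (pd i u) :=
  (hu.fderiv_right (m := ∞) (by simp)).clm_apply contDiff_const

theorem pd_congr {i : Fin q} {u v : EuclideanSpace ℝ (Fin q) → ℝ} {x : EuclideanSpace ℝ (Fin q)}
    (h : u =ᶠ[𝓝 x] v) : pd i u x = pd i v x := by
  simp only [pd, h.fderiv_eq]

theorem pd_eventuallyEq {i : Fin q} {u v : EuclideanSpace ℝ (Fin q) → ℝ}
    {x : EuclideanSpace ℝ (Fin q)} (h : u =ᶠ[𝓝 x] v) : pd i u =ᶠ[𝓝 x] pd i v := by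
  filter_upwards [h.eventuallyEq_nhds] with y hy using pd_congr hy

theorem pd_add {i : Fin q} {u v : EuclideanSpace ℝ (Fin q) → ℝ} {x : EuclideanSpace ℝ (Fin q)}
    (hu : DifferentiableAt ℝ u x) (hv : DifferentiableAt ℝ v x) :
    pd i (fun y => u y + v y) x = pd i u x + pd i v x := by
  simp [pd, fderiv_fun_add hu hv]

theorem pd_sub {i : Fin q} {u v : EuclideanSpace ℝ (Fin q) → ℝ} {x : EuclideanSpace ℝ (Fin q)}
    (hu : DifferentiableAt ℝ u x) (hv : DifferentiableAt ℝ v x) :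
    pd i (fun y => u y - v y) x = pd i u x - pd i v x := by
  simp [pd, fderiv_fun_sub hu hv]

theorem pd_mul {i : Fin q} {u v : EuclideanSpace ℝ (Fin q) → ℝ} {x : EuclideanSpace ℝ (Fin q)}
    (hu : DifferentiableAt ℝ u x) (hv : DifferentiableAt ℝ v x) :
    pd i (fun y => u y * v y) x = u x * pd i v x + v x * pd i u x := by
  simp [pd, fderiv_fun_mul hu hv]

theorem pd_sum {ι : Type*} {i : Fin q} (s : Finset ι) {u : ι → EuclideanSpace ℝ (Fin q) → ℝ}
    {x : EuclideanSpace ℝ (Fin q)} (hu : ∀ k ∈ s, DifferentiableAt ℝ (u k) x) :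
    pd i (fun y => ∑ k ∈ s, u k y) x = ∑ k ∈ s, pd i (u k) x := by
  simp [pd, fderiv_fun_sum hu]

theorem pd_const {i : Fin q} (c : ℝ) (x : EuclideanSpace ℝ (Fin q)) :
    pd i (fun _ => c) x = 0 := by
  simp [pd]

theorem pd_comp {i : Fin q} {h : ℝ → ℝ} {h' : ℝ} {u : EuclideanSpace ℝ (Fin q) → ℝ}
    {x : EuclideanSpace ℝ (Fin q)} (hh : HasDerivAt h h' (u x)) (hu : DifferentiableAt ℝ u x) :
    pd i (fun y => h (u y)) x = h' * pd i u x := by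
  have := (hh.comp_hasFDerivAt x hu.hasFDerivAt).fderiv
  simp only [pd]
  rw [show (fun y => h (u y)) = h ∘ u from rfl, this]
  simp

theorem pd_eq_zero_of_notMem_tsupport {i : Fin q} {u : EuclideanSpace ℝ (Fin q) → ℝ}
    {x : EuclideanSpace ℝ (Fin q)} (hx : x ∉ tsupport u) : pd i u x = 0 := by
  have h : u =ᶠ[𝓝 x] fun _ => 0 := notMem_tsupport_iff_eventuallyEq.mp hx
  rw [pd_congr h, pd_const]

theorem pd_comm {i j : Fin q} {u : EuclideanSpace ℝ (Fin q) → ℝ} {x : EuclideanSpace ℝ (Fin q)}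
    (hu : ContDiffAt ℝ ∞ u x) : pd i (pd j u) x = pd j (pd i u) x := by
  have hd : DifferentiableAt ℝ (fderiv ℝ u) x :=
    (hu.fderiv_right (m := ∞) (by simp)).differentiableAt (by simp)
  have key : ∀ k l : Fin q, pd k (pd l u) x =
      fderiv ℝ (fderiv ℝ u) x (EuclideanSpace.single k 1) (EuclideanSpace.single l 1) := by
    intro k l
    have := fderiv_clm_apply hd (differentiableAt_const (EuclideanSpace.single l (1 : ℝ)))
    change fderiv ℝ (fun y => fderiv ℝ u y (EuclideanSpace.single l 1)) x _ = _
    rw [this]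
    simp
  rw [key, key]
  have hs : IsSymmSndFDerivAt ℝ u x := hu.isSymmSndFDerivAt (by simpa using ENat.LEInfty.out)
  exact hs _ _

theorem fderiv_apply_eq_sum_pd (u : EuclideanSpace ℝ (Fin q) → ℝ)
    (x v : EuclideanSpace ℝ (Fin q)) : fderiv ℝ u x v = ∑ i, v i * pd i u x := by
  conv_lhs => rw [← (EuclideanSpace.basisFun (Fin q) ℝ).sum_repr v]
  simp [pd]

theorem fderiv_eq_zero_of_pd_eq_zero {u : EuclideanSpace ℝ (Fin q) → ℝ}
    {x : EuclideanSpace ℝ (Fin q)} (h : ∀ i, pd i u x = 0) : fderiv ℝ u x = 0 := by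
  ext v
  simp [fderiv_apply_eq_sum_pd, h]

/-- Integration by parts against the constant function 1. -/
theorem integral_pd_eq_zero (i : Fin q) {u : EuclideanSpace ℝ (Fin q) → ℝ}
    (hu : ContDiff ℝ ∞ u) (hc : HasCompactSupport u) : ∫ x, pd i u x = 0 := by
  have hd : ContDiff ℝ ∞ (pd i u) := contDiff_pd i hu
  have hcd : HasCompactSupport (pd i u) :=
    HasCompactSupport.intro hc fun x hx => pd_eq_zero_of_notMem_tsupport hx
  have := integral_mul_fderiv_eq_neg_fderiv_mul_of_integrable (μ := volume) (f := fun _ => (1 : ℝ))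
    (g := u) (v := EuclideanSpace.single i 1) (by simp)
    (by simpa using! hd.continuous.integrable_of_hasCompactSupport hcd)
    (by simpa using hu.continuous.integrable_of_hasCompactSupport hc)
    (fun x _ => differentiableAt_const _) (fun x _ => hu.differentiable (by simp) x)
  simpa [pd] using this

/-- The carré du champ `Γ(u, v) = ∑ aᵢⱼ ∂ᵢu ∂ⱼv`. -/
noncomputable def gam (a : Fin q → Fin q → EuclideanSpace ℝ (Fin q) → ℝ)
    (u v : EuclideanSpace ℝ (Fin q) → ℝ) (x : EuclideanSpace ℝ (Fin q)) : ℝ :=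
  ∑ i, ∑ j, a i j x * (pd i u x * pd j v x)

/-- The operator in divergence form `∑ ∂ᵢ(aᵢⱼ ∂ⱼu)`. -/
noncomputable def divOp (a : Fin q → Fin q → EuclideanSpace ℝ (Fin q) → ℝ)
    (u : EuclideanSpace ℝ (Fin q) → ℝ) (x : EuclideanSpace ℝ (Fin q)) : ℝ :=
  ∑ i, pd i (fun y => ∑ j, a i j y * pd j u y) x

section Calculus

variable {a : Fin q → Fin q → EuclideanSpace ℝ (Fin q) → ℝ}

theorem gam_comm (ha : ∀ i j, a i j = a j i) (u v : EuclideanSpace ℝ (Fin q) → ℝ) :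
    gam a u v = gam a v u := by
  funext x
  unfold gam
  rw [Finset.sum_comm]
  refine Finset.sum_congr rfl fun i _ => Finset.sum_congr rfl fun j _ => ?_
  rw [ha j i]; ring

theorem contDiff_gam (hc : ∀ i j, ContDiff ℝ ∞ (a i j)) {u v : EuclideanSpace ℝ (Fin q) → ℝ}
    (hu : ContDiff ℝ ∞ u) (hv : ContDiff ℝ ∞ v) : ContDiff ℝ ∞ (gam a u v) :=
  ContDiff.sum fun i _ => ContDiff.sum fun j _ =>
    (hc i j).mul ((contDiff_pd i hu).mul (contDiff_pd j hv))

theorem contDiff_flux (hc : ∀ i j, ContDiff ℝ ∞ (a i j)) {u : EuclideanSpace ℝ (Fin q) → ℝ}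
    (hu : ContDiff ℝ ∞ u) (i : Fin q) : ContDiff ℝ ∞ (fun y => ∑ j, a i j y * pd j u y) :=
  ContDiff.sum fun j _ => (hc i j).mul (contDiff_pd j hu)

theorem contDiff_divOp (hc : ∀ i j, ContDiff ℝ ∞ (a i j)) {u : EuclideanSpace ℝ (Fin q) → ℝ}
    (hu : ContDiff ℝ ∞ u) : ContDiff ℝ ∞ (divOp a u) :=
  ContDiff.sum fun i _ => contDiff_pd i (contDiff_flux hc hu i)

theorem gam_mul_right {u v w : EuclideanSpace ℝ (Fin q) → ℝ} (hv : ContDiff ℝ ∞ v)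
    (hw : ContDiff ℝ ∞ w) (x : EuclideanSpace ℝ (Fin q)) :
    gam a u (fun y => v y * w y) x = v x * gam a u w x + w x * gam a u v x := by
  simp only [gam, Finset.mul_sum, ← Finset.sum_add_distrib,
    pd_mul (hv.differentiable (by simp) x) (hw.differentiable (by simp) x)]
  exact Finset.sum_congr rfl fun i _ => Finset.sum_congr rfl fun j _ => by ring

theorem gam_comp_right {h : ℝ → ℝ} {h' : ℝ} {u v : EuclideanSpace ℝ (Fin q) → ℝ}
    {x : EuclideanSpace ℝ (Fin q)} (hh : HasDerivAt h h' (v x)) (hv : ContDiff ℝ ∞ v) :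
    gam a u (fun y => h (v y)) x = h' * gam a u v x := by
  simp only [gam, Finset.mul_sum, pd_comp hh (hv.differentiable (by simp) x)]
  exact Finset.sum_congr rfl fun i _ => Finset.sum_congr rfl fun j _ => by ring

theorem gam_const_mul_right (c : ℝ) {u v : EuclideanSpace ℝ (Fin q) → ℝ}
    (hv : ContDiff ℝ ∞ v) (x : EuclideanSpace ℝ (Fin q)) :
    gam a u (fun y => c * v y) x = c * gam a u v x :=
  gam_comp_right (h := fun t => c * t) (by simpa using (hasDerivAt_id (v x)).const_mul c) hv

theorem gam_eq_zero_of_notMem_tsupport_right {u v : EuclideanSpace ℝ (Fin q) → ℝ}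
    {x : EuclideanSpace ℝ (Fin q)} (hx : x ∉ tsupport v) : gam a u v x = 0 := by
  simp [gam, pd_eq_zero_of_notMem_tsupport hx]

theorem gam_eq_zero_of_notMem_tsupport_left {u v : EuclideanSpace ℝ (Fin q) → ℝ}
    {x : EuclideanSpace ℝ (Fin q)} (hx : x ∉ tsupport u) : gam a u v x = 0 := by
  simp [gam, pd_eq_zero_of_notMem_tsupport hx]

theorem divOp_congr {u v : EuclideanSpace ℝ (Fin q) → ℝ} {x : EuclideanSpace ℝ (Fin q)}
    (h : u =ᶠ[𝓝 x] v) : divOp a u x = divOp a v x := by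
  refine Finset.sum_congr rfl fun i _ => pd_congr ?_
  have : ∀ᶠ y in 𝓝 x, ∀ j, pd j u y = pd j v y :=
    Filter.eventually_all.2 fun j => pd_eventuallyEq h
  filter_upwards [this] with y hy
  simp [hy]

theorem divOp_eq_zero_of_notMem_tsupport {u : EuclideanSpace ℝ (Fin q) → ℝ}
    {x : EuclideanSpace ℝ (Fin q)} (hx : x ∉ tsupport u) : divOp a u x = 0 := by
  have h : u =ᶠ[𝓝 x] fun _ => 0 := notMem_tsupport_iff_eventuallyEq.mp hx
  rw [divOp_congr h]
  simp [divOp, pd_const]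

theorem divOp_eq_sum (hc : ∀ i j, ContDiff ℝ ∞ (a i j)) {u : EuclideanSpace ℝ (Fin q) → ℝ}
    (hu : ContDiff ℝ ∞ u) (x : EuclideanSpace ℝ (Fin q)) :
    divOp a u x = ∑ i, ∑ j, (a i j x * pd i (pd j u) x + pd j u x * pd i (a i j) x) := by
  refine Finset.sum_congr rfl fun i _ => ?_
  rw [pd_sum]
  · exact Finset.sum_congr rfl fun j _ => pd_mul ((hc i j).differentiable (by simp) x)
      ((contDiff_pd j hu).differentiable (by simp) x)
  · exact fun j _ => ((hc i j).mul (contDiff_pd j hu)).differentiable (by simp) x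

/-- `∑ ∂ᵢ(v aᵢⱼ ∂ⱼu) = v div(a∇u) + Γ(u, v)` -/
theorem sum_pd_mul_flux (hs : ∀ i j, a i j = a j i) (hc : ∀ i j, ContDiff ℝ ∞ (a i j))
    {u v : EuclideanSpace ℝ (Fin q) → ℝ} (hu : ContDiff ℝ ∞ u) (hv : ContDiff ℝ ∞ v)
    (x : EuclideanSpace ℝ (Fin q)) :
    ∑ i, pd i (fun y => v y * ∑ j, a i j y * pd j u y) x = v x * divOp a u x + gam a u v x := by
  rw [gam_comm hs u v, divOp, gam, Finset.mul_sum, ← Finset.sum_add_distrib]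
  refine Finset.sum_congr rfl fun i _ => ?_
  rw [pd_mul (hv.differentiable (by simp) x) ((contDiff_flux hc hu i).differentiable (by simp) x),
    Finset.sum_mul]
  congr 1
  exact Finset.sum_congr rfl fun j _ => by ring

/-- The flux of a product is u a∇v + v a∇u; the divergence of each summand leaves one copy of Γ(u,
v). With `divOp_exp` this computes the operator conjugated by an exponential weight. -/
theorem divOp_mul (hs : ∀ i j, a i j = a j i) (hc : ∀ i j, ContDiff ℝ ∞ (a i j))
    {u v : EuclideanSpace ℝ (Fin q) → ℝ} (hu : ContDiff ℝ ∞ u) (hv : ContDiff ℝ ∞ v)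
    (x : EuclideanSpace ℝ (Fin q)) :
    divOp a (fun y => u y * v y) x = u x * divOp a v x + v x * divOp a u x + 2 * gam a u v x := by
  have h1 := sum_pd_mul_flux hs hc hv hu x
  have h2 := sum_pd_mul_flux hs hc hu hv x
  rw [gam_comm hs v u] at h1
  have h3 : divOp a (fun y => u y * v y) x =
      ∑ i, pd i (fun y => u y * ∑ j, a i j y * pd j v y) x
        + ∑ i, pd i (fun y => v y * ∑ j, a i j y * pd j u y) x := by
    rw [← Finset.sum_add_distrib]
    refine Finset.sum_congr rfl fun i _ => ?_
    rw [← pd_add ((hu.mul (contDiff_flux hc hv i)).differentiable (by simp) x)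
      ((hv.mul (contDiff_flux hc hu i)).differentiable (by simp) x)]
    congr 1
    funext y
    rw [Finset.mul_sum, Finset.mul_sum, ← Finset.sum_add_distrib]
    refine Finset.sum_congr rfl fun j _ => ?_
    rw [pd_mul (hu.differentiable (by simp) y) (hv.differentiable (by simp) y)]
    ring
  rw [h3, h1, h2]; ring

theorem divOp_exp (hs : ∀ i j, a i j = a j i) (hc : ∀ i j, ContDiff ℝ ∞ (a i j)) (c : ℝ)
    {u : EuclideanSpace ℝ (Fin q) → ℝ} (hu : ContDiff ℝ ∞ u) (x : EuclideanSpace ℝ (Fin q)) :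
    divOp a (fun y => Real.exp (c * u y)) x =
      Real.exp (c * u x) * (c * divOp a u x + c ^ 2 * gam a u u x) := by
  have hd : ∀ y, HasDerivAt (fun t => Real.exp (c * t)) (c * Real.exp (c * u y)) (u y) := by
    intro y
    simpa [mul_comm] using ((hasDerivAt_id (u y)).const_mul c).exp
  have he : ContDiff ℝ ∞ (fun y => c * Real.exp (c * u y)) :=
    contDiff_const.mul (contDiff_const.mul hu).exp
  have h1 := sum_pd_mul_flux hs hc hu he x
  rw [gam_const_mul_right c (contDiff_const.mul hu).exp x, gam_comp_right (hd x) hu] at h1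
  have h2 : divOp a (fun y => Real.exp (c * u y)) x =
      ∑ i, pd i (fun y => (c * Real.exp (c * u y)) * ∑ j, a i j y * pd j u y) x := by
    refine Finset.sum_congr rfl fun i _ => ?_
    congr 1
    funext y
    rw [Finset.mul_sum]
    refine Finset.sum_congr rfl fun j _ => ?_
    rw [pd_comp (hd y) (hu.differentiable (by simp) y)]
    ring
  rw [h2, h1]; ring

/-- The integrand is the divergence of v a∇u, whose support is compact as soon as one of the two
factors has compact support. Keeping it as one null integral allows several such integrands to be
added inside a pointwise inequality. -/
theorem integral_mul_divOp_add_gam (hs : ∀ i j, a i j = a j i)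
    (hc : ∀ i j, ContDiff ℝ ∞ (a i j))
    {u v : EuclideanSpace ℝ (Fin q) → ℝ} (hu : ContDiff ℝ ∞ u) (hv : ContDiff ℝ ∞ v)
    (h : HasCompactSupport u ∨ HasCompactSupport v) :
    Integrable (fun x => v x * divOp a u x + gam a u v x) ∧
      ∫ x, (v x * divOp a u x + gam a u v x) = 0 := by
  have hsm : ∀ i, ContDiff ℝ ∞ (fun y => v y * ∑ j, a i j y * pd j u y) :=
    fun i => hv.mul (contDiff_flux hc hu i)
  have hcs : ∀ i, HasCompactSupport (fun y => v y * ∑ j, a i j y * pd j u y) := by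
    intro i
    rcases h with h | h
    · refine HasCompactSupport.intro h fun x hx => ?_
      simp [pd_eq_zero_of_notMem_tsupport hx]
    · exact h.mul_right
  have hcd : ∀ i, HasCompactSupport (pd i (fun y => v y * ∑ j, a i j y * pd j u y)) :=
    fun i => HasCompactSupport.intro (hcs i) fun x hx => pd_eq_zero_of_notMem_tsupport hx
  have hint : ∀ i, Integrable (pd i (fun y => v y * ∑ j, a i j y * pd j u y)) :=
    fun i => (contDiff_pd i (hsm i)).continuous.integrable_of_hasCompactSupport (hcd i)
  have heq : (fun x => v x * divOp a u x + gam a u v x) =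
      fun x => ∑ i, pd i (fun y => v y * ∑ j, a i j y * pd j u y) x := by
    funext x; exact (sum_pd_mul_flux hs hc hu hv x).symm
  rw [heq]
  refine ⟨integrable_finsetSum _ fun i _ => hint i, ?_⟩
  rw [integral_finsetSum _ fun i _ => hint i]
  exact Finset.sum_eq_zero fun i _ => integral_pd_eq_zero i (hsm i) (hcs i)

end Calculus

end Elliptic

/-! ### The Carleman estimate: conjugation and commutator -/

namespace Elliptic

open MeasureTheory

variable {q : ℕ} {a : Fin q → Fin q → EuclideanSpace ℝ (Fin q) → ℝ}

/-- The squared expression X is e^{sψ} L e^{-sψ} applied to z, with L = div(a∇·). Write X = S + T +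
sκz with S = Lz + s²Γ(ψ,ψ)z and T = -2sΓ(ψ,z) - s(Lψ + κ)z. Then 2ST ≤ (S + T)² ≤ 2X² + 2s²κ²z², and
integrating 2ST by parts produces the commutator: a quadratic form in ∇z, bounded below by `h1`, and
a multiple of s³z², bounded below by `h2`. The function κ is a free parameter moving positivity
between these two. -/
theorem carleman_conjugated (hs : ∀ i j, a i j = a j i) (hc : ∀ i j, ContDiff ℝ ∞ (a i j))
    {ψ κ z : EuclideanSpace ℝ (Fin q) → ℝ} (hψ : ContDiff ℝ ∞ ψ) (hκ : ContDiff ℝ ∞ κ)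
    (hz : ContDiff ℝ ∞ z) (hzc : HasCompactSupport z) {K : Set (EuclideanSpace ℝ (Fin q))}
    (hK : tsupport z ⊆ K) {c C s : ℝ} (hs0 : 0 < s)
    (h1 : ∀ x ∈ K, c * gam a z z x ≤
      2 * gam a z (gam a ψ z) x - gam a ψ (gam a z z) x + κ x * gam a z z x)
    (h2 : ∀ x ∈ K, c ≤ gam a ψ (gam a ψ ψ) x - κ x * gam a ψ ψ x)
    (h3 : ∀ x ∈ K, divOp a (fun y => divOp a ψ y + κ y) x ≤ C)
    (h4 : ∀ x ∈ K, κ x ^ 2 ≤ C) :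
    2 * s * c * (∫ x, gam a z z x)
        + (2 * s ^ 3 * c - s * C - 2 * s ^ 2 * C) * (∫ x, z x ^ 2) ≤
      2 * ∫ x, (divOp a z x + s ^ 2 * gam a ψ ψ x * z x - 2 * s * gam a ψ z x
        - s * divOp a ψ x * z x) ^ 2 := by
  set θ : EuclideanSpace ℝ (Fin q) → ℝ := fun y => divOp a ψ y + κ y with hθdef
  have hLψ := contDiff_divOp hc hψ
  have hLz := contDiff_divOp hc hz
  have hθ : ContDiff ℝ ∞ θ := hLψ.add hκ
  have hψz := contDiff_gam hc hψ hz
  have hψψ := contDiff_gam hc hψ hψ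
  have hzz := contDiff_gam hc hz hz
  have hczz : HasCompactSupport (gam a z z) :=
    HasCompactSupport.intro hzc fun x hx => gam_eq_zero_of_notMem_tsupport_right hx
  have hz2 : ContDiff ℝ ∞ (fun y => z y * z y) := hz.mul hz
  have hcz2 : HasCompactSupport (fun y => z y * z y) := hzc.mul_right
  have hψzz : ContDiff ℝ ∞ (fun y => gam a ψ ψ y * (z y * z y)) := hψψ.mul hz2
  have hcψzz : HasCompactSupport (fun y => gam a ψ ψ y * (z y * z y)) := hcz2.mul_left
  obtain ⟨i1, e1⟩ := integral_mul_divOp_add_gam hs hc hz hψz (Or.inl hzc)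
  obtain ⟨i2, e2⟩ := integral_mul_divOp_add_gam hs hc hψ hzz (Or.inr hczz)
  obtain ⟨i3, e3⟩ := integral_mul_divOp_add_gam hs hc hz (hθ.mul hz) (Or.inl hzc)
  obtain ⟨i4, e4⟩ := integral_mul_divOp_add_gam hs hc hθ hz2 (Or.inr hcz2)
  obtain ⟨i5, e5⟩ := integral_mul_divOp_add_gam hs hc hψ hψzz (Or.inr hcψzz)
  have hX : ContDiff ℝ ∞ (fun x => (divOp a z x + s ^ 2 * gam a ψ ψ x * z x
      - 2 * s * gam a ψ z x - s * divOp a ψ x * z x) ^ 2) := by fun_prop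
  have hcX : HasCompactSupport (fun x => (divOp a z x + s ^ 2 * gam a ψ ψ x * z x
      - 2 * s * gam a ψ z x - s * divOp a ψ x * z x) ^ 2) := by
    refine HasCompactSupport.intro hzc fun x hx => ?_
    simp [divOp_eq_zero_of_notMem_tsupport hx, gam_eq_zero_of_notMem_tsupport_right hx,
      image_eq_zero_of_notMem_tsupport hx]
  have iX := hX.continuous.integrable_of_hasCompactSupport hcX (μ := volume)
  have izz := hzz.continuous.integrable_of_hasCompactSupport hczz (μ := volume)
  have iz2 : Integrable (fun x => z x ^ 2) := by
    simpa [sq] using hz2.continuous.integrable_of_hasCompactSupport hcz2 (μ := volume)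
  -- The five brackets added on the left are the null integrands from `integral_mul_divOp_add_gam`.
  -- Their coefficients are those which turn the commutator bound into a pointwise inequality.
  have hpt : ∀ x, 2 * s * c * gam a z z x + (2 * s ^ 3 * c - s * C - 2 * s ^ 2 * C) * z x ^ 2
      + (((-(4 * s) * (gam a ψ z x * divOp a z x + gam a z (gam a ψ z) x)
        + 2 * s * (gam a z z x * divOp a ψ x + gam a ψ (gam a z z) x))
        + (-(2 * s) * (θ x * z x * divOp a z x + gam a z (fun y => θ y * z y) x)
        + s * (z x * z x * divOp a θ x + gam a θ (fun y => z y * z y) x)))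
        + -(2 * s ^ 3) * (gam a ψ ψ x * (z x * z x) * divOp a ψ x
          + gam a ψ (fun y => gam a ψ ψ y * (z y * z y)) x)) ≤
      2 * (divOp a z x + s ^ 2 * gam a ψ ψ x * z x - 2 * s * gam a ψ z x
        - s * divOp a ψ x * z x) ^ 2 := by
    intro x
    rw [gam_mul_right hθ hz x, gam_mul_right hz hz x, gam_mul_right hψψ hz2 x,
      gam_mul_right hz hz x, gam_comm hs z θ]
    by_cases hx : x ∈ tsupport z
    · have k1 := mul_le_mul_of_nonneg_left (h1 x (hK hx)) (by positivity : 0 ≤ 2 * s)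
      have k2 := mul_le_mul_of_nonneg_left (h2 x (hK hx))
        (by positivity : 0 ≤ 2 * s ^ 3 * z x ^ 2)
      have k3 := mul_le_mul_of_nonneg_left (h3 x (hK hx)) (by positivity : 0 ≤ s * z x ^ 2)
      have k4 := mul_le_mul_of_nonneg_left (h4 x (hK hx)) (by positivity : 0 ≤ 2 * s ^ 2 * z x ^ 2)
      have hθx : θ x = divOp a ψ x + κ x := rfl
      rw [hθx] at *
      set A := divOp a z x
      set B := gam a ψ ψ x
      set P := gam a ψ z x
      set Q := divOp a ψ x
      -- `k5` and `k7` together give S² + T² ≥ 0, that is 2ST ≤ (S + T)²; `k6` gives (X - sκz)² ≤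
      -- 2X² + 2s²κ²z².
      have k5 := sq_nonneg ((A + s ^ 2 * B * z x) - (-(2 * s) * P - s * (Q + κ x) * z x))
      have k6 := sq_nonneg ((A + s ^ 2 * B * z x - 2 * s * P - s * Q * z x) + s * κ x * z x)
      have k7 := sq_nonneg ((A + s ^ 2 * B * z x + (-(2 * s) * P - s * (Q + κ x) * z x)))
      nlinarith [k1, k2, k3, k4, k5, k6, k7]
    · simp [divOp_eq_zero_of_notMem_tsupport hx, gam_eq_zero_of_notMem_tsupport_right hx,
        gam_eq_zero_of_notMem_tsupport_left hx, image_eq_zero_of_notMem_tsupport hx]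
      have : gam a z z =ᶠ[𝓝 x] fun _ => 0 := by
        filter_upwards [(isClosed_tsupport z).isOpen_compl.mem_nhds hx] with y hy
          using gam_eq_zero_of_notMem_tsupport_right hy
      have h0 : gam a ψ (gam a z z) x = 0 := by
        simp [gam, pd_congr this, pd_const]
      simp [h0]
  have hi : Integrable (fun x => ((-(4 * s) * (gam a ψ z x * divOp a z x + gam a z (gam a ψ z) x)
        + 2 * s * (gam a z z x * divOp a ψ x + gam a ψ (gam a z z) x))
        + (-(2 * s) * (θ x * z x * divOp a z x + gam a z (fun y => θ y * z y) x)
        + s * (z x * z x * divOp a θ x + gam a θ (fun y => z y * z y) x)))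
        + -(2 * s ^ 3) * (gam a ψ ψ x * (z x * z x) * divOp a ψ x
          + gam a ψ (fun y => gam a ψ ψ y * (z y * z y)) x)) :=
    (((i1.const_mul _).add (i2.const_mul _)).add ((i3.const_mul _).add (i4.const_mul _))).add
      (i5.const_mul _)
  have key := integral_mono (((izz.const_mul (2 * s * c)).add
    (iz2.const_mul (2 * s ^ 3 * c - s * C - 2 * s ^ 2 * C))).add hi) (iX.const_mul 2) hpt
  have e0 : ∀ {F G : EuclideanSpace ℝ (Fin q) → ℝ}, Integrable F → Integrable G →
      (Integrable fun x => F x + G x) ∧ ∫ x, (F x + G x) = (∫ x, F x) + ∫ x, G x :=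
    fun hF hG => ⟨hF.add hG, integral_add hF hG⟩
  have j1 := e0 (i1.const_mul (-(4 * s))) (i2.const_mul (2 * s))
  have j2 := e0 (i3.const_mul (-(2 * s))) (i4.const_mul s)
  have j3 := e0 j1.1 j2.1
  have j4 := e0 j3.1 (i5.const_mul (-(2 * s ^ 3)))
  have j5 := e0 (izz.const_mul (2 * s * c)) (iz2.const_mul (2 * s ^ 3 * c - s * C - 2 * s ^ 2 * C))
  have j6 := e0 j5.1 j4.1
  simp only [Pi.add_apply] at key
  rw [j6.2, j5.2, j4.2, j3.2, j1.2, j2.2] at key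
  simp only [integral_const_mul, e1, e2, e3, e4, e5] at key
  linarith

/-- **Carleman estimate** with weight `exp (s ψ)`, under the convexity conditions `h1`, `h2`. -/
theorem carleman (hs : ∀ i j, a i j = a j i) (hc : ∀ i j, ContDiff ℝ ∞ (a i j))
    {ψ κ : EuclideanSpace ℝ (Fin q) → ℝ} (hψ : ContDiff ℝ ∞ ψ) (hκ : ContDiff ℝ ∞ κ)
    {K : Set (EuclideanSpace ℝ (Fin q))} {c C : ℝ} (hc0 : 0 < c) (hC : 0 ≤ C)
    (hpos : ∀ x ∈ K, ∀ ξ : Fin q → ℝ, 0 ≤ ∑ i, ∑ j, a i j x * (ξ i * ξ j))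
    (h1 : ∀ x ∈ K, ∀ z : EuclideanSpace ℝ (Fin q) → ℝ, ContDiff ℝ ∞ z → c * gam a z z x ≤
      2 * gam a z (gam a ψ z) x - gam a ψ (gam a z z) x + κ x * gam a z z x)
    (h2 : ∀ x ∈ K, c ≤ gam a ψ (gam a ψ ψ) x - κ x * gam a ψ ψ x)
    (h3 : ∀ x ∈ K, divOp a (fun y => divOp a ψ y + κ y) x ≤ C)
    (h4 : ∀ x ∈ K, κ x ^ 2 ≤ C) (h5 : ∀ x ∈ K, gam a ψ ψ x ≤ C)
    {v : EuclideanSpace ℝ (Fin q) → ℝ} (hv : ContDiff ℝ ∞ v) (hvc : HasCompactSupport v)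
    (hK : tsupport v ⊆ K) {s : ℝ} (hs1 : 1 ≤ s) (hsC : 3 * C ≤ s * c) :
    s * c * (∫ x, Real.exp (s * ψ x) ^ 2 * gam a v v x) ≤
      4 * (C + 1) * ∫ x, Real.exp (s * ψ x) ^ 2 * divOp a v x ^ 2 := by
  have hs0 : 0 < s := by linarith
  have hw : ContDiff ℝ ∞ (fun x => Real.exp (s * ψ x)) := (contDiff_const.mul hψ).exp
  set z : EuclideanSpace ℝ (Fin q) → ℝ := fun x => Real.exp (s * ψ x) * v x with hzdef
  have hz : ContDiff ℝ ∞ z := hw.mul hv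
  have hzc : HasCompactSupport z := hvc.mul_left
  have hzK : tsupport z ⊆ K := (tsupport_mul_subset_right).trans hK
  have hd : ∀ x, HasDerivAt (fun t => Real.exp (s * t)) (s * Real.exp (s * ψ x)) (ψ x) := by
    intro y
    simpa [mul_comm] using ((hasDerivAt_id (ψ y)).const_mul s).exp
  have hgw : ∀ (u : EuclideanSpace ℝ (Fin q) → ℝ) x,
      gam a u (fun y => Real.exp (s * ψ y)) x = s * Real.exp (s * ψ x) * gam a u ψ x :=
    fun u x => gam_comp_right (hd x) hψ
  have hgz : ∀ (u : EuclideanSpace ℝ (Fin q) → ℝ) x,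
      gam a u z x = Real.exp (s * ψ x) * gam a u v x
        + v x * (s * Real.exp (s * ψ x) * gam a u ψ x) := by
    intro u x
    rw [hzdef, gam_mul_right hw hv, hgw]
  have key := carleman_conjugated hs hc hψ hκ hz hzc hzK hs0 (fun x hx => h1 x hx z hz) h2 h3 h4
  -- The conjugated operator applied to z = e^{sψ}v returns e^{sψ}Lv.
  have hR : ∀ x, divOp a z x + s ^ 2 * gam a ψ ψ x * z x - 2 * s * gam a ψ z x
        - s * divOp a ψ x * z x = Real.exp (s * ψ x) * divOp a v x := by
    intro x
    rw [hgz, hzdef, divOp_mul hs hc hw hv, divOp_exp hs hc s hψ,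
      gam_comm hs (fun y => Real.exp (s * ψ y)) v, hgw, gam_comm hs v ψ]
    ring
  simp only [hR, mul_pow] at key
  have hzz := contDiff_gam hc hz hz
  have hvv := contDiff_gam hc hv hv
  have izz : Integrable (gam a z z) := hzz.continuous.integrable_of_hasCompactSupport
    (HasCompactSupport.intro hzc fun x hx => gam_eq_zero_of_notMem_tsupport_right hx)
  have iz2 : Integrable (fun x => z x ^ 2) :=
    (hz.pow 2).continuous.integrable_of_hasCompactSupport
      (HasCompactSupport.intro hzc fun x hx => by simp [image_eq_zero_of_notMem_tsupport hx])
  have ivv : Integrable (fun x => Real.exp (s * ψ x) ^ 2 * gam a v v x) :=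
    ((hw.pow 2).mul hvv).continuous.integrable_of_hasCompactSupport
      (HasCompactSupport.intro hvc fun x hx => by
        simp [gam_eq_zero_of_notMem_tsupport_right hx])
  -- Since e^{sψ}∇v = ∇z - sz∇ψ, this is |ξ - η|² ≤ 2|ξ|² + 2|η|² for the form a, obtained from |ξ +
  -- η|² ≥ 0.
  have hpt : ∀ x, Real.exp (s * ψ x) ^ 2 * gam a v v x ≤
      2 * gam a z z x + 2 * s ^ 2 * C * z x ^ 2 := by
    intro x
    by_cases hx : x ∈ tsupport v
    · have hq := hpos x (hK hx) fun i => pd i z x + s * z x * pd i ψ x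
      have hq' : ∑ i, ∑ j, a i j x * ((pd i z x + s * z x * pd i ψ x) *
          (pd j z x + s * z x * pd j ψ x)) =
          gam a z z x + 2 * (s * z x) * gam a ψ z x + (s * z x) ^ 2 * gam a ψ ψ x := by
        have : 2 * (s * z x) * gam a ψ z x =
            (s * z x) * gam a ψ z x + (s * z x) * gam a z ψ x := by
          rw [gam_comm hs z ψ]; ring
        rw [this]
        simp only [gam, Finset.mul_sum, ← Finset.sum_add_distrib]
        exact Finset.sum_congr rfl fun i _ => Finset.sum_congr rfl fun j _ => by ring
      rw [hq'] at hq
      have e1 : gam a z z x = Real.exp (s * ψ x) ^ 2 * gam a v v x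
          + 2 * s * Real.exp (s * ψ x) * z x * gam a ψ v x
          + s ^ 2 * z x ^ 2 * gam a ψ ψ x := by
        rw [hgz, gam_comm hs z v, hgz, gam_comm hs z ψ, hgz, gam_comm hs v ψ, hzdef]
        ring
      have e2 : gam a ψ z x = Real.exp (s * ψ x) * gam a ψ v x + s * z x * gam a ψ ψ x := by
        rw [hgz, hzdef]; ring
      have e3 := mul_le_mul_of_nonneg_left (h5 x (hK hx)) (by positivity : 0 ≤ s ^ 2 * z x ^ 2)
      rw [e2] at hq
      nlinarith [hq, e1, e3]
    · simp [gam_eq_zero_of_notMem_tsupport_right hx, image_eq_zero_of_notMem_tsupport hx, hzdef,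
        gam_eq_zero_of_notMem_tsupport_right (fun h => hx (tsupport_mul_subset_right h) :
          x ∉ tsupport fun x => Real.exp (s * ψ x) * v x)]
  have hI := integral_mono ivv ((izz.const_mul 2).add (iz2.const_mul (2 * s ^ 2 * C))) hpt
  simp only [Pi.add_apply] at hI
  rw [integral_add (izz.const_mul 2) (iz2.const_mul _), integral_const_mul,
    integral_const_mul] at hI
  have hzz0 : 0 ≤ ∫ x, gam a z z x := by
    refine integral_nonneg fun x => ?_
    by_cases hx : x ∈ tsupport z
    · exact hpos x (hzK hx) fun i => pd i z x
    · simp [gam_eq_zero_of_notMem_tsupport_right hx]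
  have hz20 : 0 ≤ ∫ x, z x ^ 2 := integral_nonneg fun x => by positivity
  set I1 := ∫ x, gam a z z x
  set I2 := ∫ x, z x ^ 2
  set I3 := ∫ x, Real.exp (s * ψ x) ^ 2 * gam a v v x
  set I4 := ∫ x, Real.exp (s * ψ x) ^ 2 * divOp a v x ^ 2
  -- For s ≥ 1 the error sC + 2s²C is at most 3s²C, which `hsC` bounds by s³c: half of the main
  -- coefficient survives.
  have hcoef : s ^ 3 * c ≤ 2 * s ^ 3 * c - s * C - 2 * s ^ 2 * C := by
    have := mul_le_mul_of_nonneg_left hsC (by positivity : 0 ≤ s ^ 2)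
    have := mul_nonneg (mul_nonneg hs0.le hC) (by linarith : 0 ≤ s - 1)
    nlinarith
  have h6 : 2 * s * c * I1 + s ^ 3 * c * I2 ≤ 2 * I4 := by
    have := mul_le_mul_of_nonneg_right hcoef hz20
    linarith
  have h7 := mul_le_mul_of_nonneg_left hI (by positivity : 0 ≤ s * c)
  have h8 : 0 ≤ s * c * I1 * C := by positivity
  have h9 : 0 ≤ s ^ 3 * c * I2 := by positivity
  have h10 := mul_le_mul_of_nonneg_left h6 (by positivity : 0 ≤ 2 * (C + 1))
  nlinarith [h7, h8, h9, h10]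

end Elliptic

/-! ### Ellipticity, Hessian bounds and convex weights -/

namespace Elliptic

open MeasureTheory

variable {q : ℕ} {a : Fin q → Fin q → EuclideanSpace ℝ (Fin q) → ℝ}

/-- The form attains a positive minimum on the compact set K × unit sphere; homogeneity of degree
two does the rest. -/
theorem exists_ellipticity_const {K : Set (EuclideanSpace ℝ (Fin q))} (hK : IsCompact K)
    (hc : ∀ i j, ContDiff ℝ ∞ (a i j))
    (hpos : ∀ x ∈ K, ∀ ξ : Fin q → ℝ, ξ ≠ 0 → 0 < ∑ i, ∑ j, a i j x * (ξ i * ξ j)) :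
    ∃ m : ℝ, 0 < m ∧ ∀ x ∈ K, ∀ ξ : Fin q → ℝ,
      m * ∑ i, ξ i ^ 2 ≤ ∑ i, ∑ j, a i j x * (ξ i * ξ j) := by
  have hcomp : IsCompact (K ×ˢ Metric.sphere (0 : EuclideanSpace ℝ (Fin q)) 1) :=
    hK.prod (isCompact_sphere _ _)
  have hcont : Continuous fun y : EuclideanSpace ℝ (Fin q) × EuclideanSpace ℝ (Fin q) =>
      ∑ i, ∑ j, a i j y.1 * (y.2 i * y.2 j) := by
    have := fun i j => (hc i j).continuous
    fun_prop
  obtain ⟨m, hm, h⟩ := hcomp.exists_forall_le' hcont.continuousOn (a := 0) (by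
    rintro ⟨x, ξ⟩ ⟨hx, hξ⟩
    refine hpos x hx ξ fun h0 => ?_
    have : ξ = 0 := by ext i; exact congrFun h0 i
    simp [this] at hξ)
  refine ⟨m, hm, fun x hx ξ => ?_⟩
  by_cases h0 : ξ = 0
  · simp [h0]
  set v : EuclideanSpace ℝ (Fin q) := WithLp.toLp 2 ξ with hv
  have hv0 : v ≠ 0 := fun h => h0 (by
    funext i; have := congrArg (fun w : EuclideanSpace ℝ (Fin q) => w i) h; simpa [hv] using this)
  have hn : 0 < ‖v‖ := norm_pos_iff.2 hv0
  have h1 := h (x, ‖v‖⁻¹ • v) ⟨hx, by simp [norm_smul, hn.ne']⟩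
  have h2 : ‖v‖ ^ 2 = ∑ i, ξ i ^ 2 := by rw [EuclideanSpace.norm_sq_eq]; simp [hv]
  have h3 : ∑ i, ∑ j, a i j x * ((‖v‖⁻¹ • v) i * (‖v‖⁻¹ • v) j) =
      (‖v‖⁻¹) ^ 2 * ∑ i, ∑ j, a i j x * (ξ i * ξ j) := by
    simp only [Finset.mul_sum]
    refine Finset.sum_congr rfl fun i _ => Finset.sum_congr rfl fun j _ => ?_
    simp [hv]; ring
  simp only at h1
  rw [h3] at h1
  rw [← h2]
  have h4 := mul_le_mul_of_nonneg_right h1 (sq_nonneg ‖v‖)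
  have h5 : (‖v‖⁻¹) ^ 2 * ‖v‖ ^ 2 = 1 := by rw [← mul_pow, inv_mul_cancel₀ hn.ne', one_pow]
  calc m * ‖v‖ ^ 2 ≤ _ := h4
    _ = ((‖v‖⁻¹) ^ 2 * ‖v‖ ^ 2) * ∑ i, ∑ j, a i j x * (ξ i * ξ j) := by ring
    _ = _ := by rw [h5, one_mul]

/-- The Hessian `2 Γ(u, Γ(ϕ, u)) - Γ(ϕ, Γ(u, u))` is a quadratic form in `∇u`. -/
theorem hessian_eq_sum (hs : ∀ i j, a i j = a j i) (hc : ∀ i j, ContDiff ℝ ∞ (a i j))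
    {ϕ u : EuclideanSpace ℝ (Fin q) → ℝ} (hϕ : ContDiff ℝ ∞ ϕ) (hu : ContDiff ℝ ∞ u)
    (x : EuclideanSpace ℝ (Fin q)) :
    2 * gam a u (gam a ϕ u) x - gam a ϕ (gam a u u) x =
      ∑ i, ∑ l, (∑ j, (2 * a i j x * pd j (fun y => ∑ k, a l k y * pd k ϕ y) x
        - (∑ k, a j k x * pd k ϕ x) * pd j (a i l) x)) * (pd i u x * pd l u x) := by
  set b : Fin q → EuclideanSpace ℝ (Fin q) → ℝ := fun l y => ∑ k, a l k y * pd k ϕ y with hb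
  have hbc : ∀ l, ContDiff ℝ ∞ (b l) := fun l => contDiff_flux hc hϕ l
  have hg : ∀ w, gam a ϕ w = fun y => ∑ l, b l y * pd l w y := by
    intro w
    funext y
    simp only [gam, hb, Finset.sum_mul]
    rw [Finset.sum_comm]
    refine Finset.sum_congr rfl fun l _ => Finset.sum_congr rfl fun k _ => ?_
    rw [hs k l]; ring
  have hdiff : ∀ {w : EuclideanSpace ℝ (Fin q) → ℝ}, ContDiff ℝ ∞ w → DifferentiableAt ℝ w x :=
    fun hw => hw.differentiable (by simp) x
  have e1 : gam a u (gam a ϕ u) x = ∑ i, ∑ j, a i j x *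
      (pd i u x * ∑ l, (b l x * pd j (pd l u) x + pd l u x * pd j (b l) x)) := by
    rw [hg]
    unfold gam
    refine Finset.sum_congr rfl fun i _ => Finset.sum_congr rfl fun j _ => ?_
    rw [pd_sum _ fun l _ => hdiff ((hbc l).mul (contDiff_pd l hu))]
    congr 2
    exact Finset.sum_congr rfl fun l _ => pd_mul (hdiff (hbc l)) (hdiff (contDiff_pd l hu))
  have e2 : gam a ϕ (gam a u u) x = ∑ j, b j x * ∑ i, ∑ l, (a i l x *
      (pd i u x * pd j (pd l u) x + pd l u x * pd j (pd i u) x)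
        + (pd i u x * pd l u x) * pd j (a i l) x) := by
    rw [hg]
    refine Finset.sum_congr rfl fun j _ => ?_
    congr 1
    unfold gam
    have hterm : ∀ i l, ContDiff ℝ ∞ (fun y => a i l y * (pd i u y * pd l u y)) :=
      fun i l => (hc i l).mul ((contDiff_pd i hu).mul (contDiff_pd l hu))
    rw [pd_sum _ fun i _ => hdiff (ContDiff.sum fun l _ => hterm i l)]
    refine Finset.sum_congr rfl fun i _ => ?_
    rw [pd_sum _ fun l _ => hdiff (hterm i l)]
    refine Finset.sum_congr rfl fun l _ => ?_
    rw [pd_mul (hdiff (hc i l)) (hdiff ((contDiff_pd i hu).mul (contDiff_pd l hu))),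
      pd_mul (hdiff (contDiff_pd i hu)) (hdiff (contDiff_pd l hu))]
  -- By the symmetry of a and of the second derivatives of u, the two groups containing second
  -- derivatives coincide, and their double cancels against 2Γ(u, Γ(ϕ, u)).
  have e3 : gam a ϕ (gam a u u) x = ∑ i, ∑ j, ∑ l, (2 * (a i j x * (pd i u x *
      (b l x * pd j (pd l u) x))) + b j x * ((pd i u x * pd l u x) * pd j (a i l) x)) := by
    have s1 : ∑ j, ∑ i, ∑ l, b j x * (a i l x * (pd i u x * pd j (pd l u) x)) =
        ∑ i, ∑ j, ∑ l, a i j x * (pd i u x * (b l x * pd j (pd l u) x)) := by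
      rw [Finset.sum_comm]
      refine Finset.sum_congr rfl fun i _ => ?_
      rw [Finset.sum_comm]
      refine Finset.sum_congr rfl fun j _ => Finset.sum_congr rfl fun l _ => ?_
      rw [pd_comm hu.contDiffAt]; ring
    have s2 : ∑ j, ∑ i, ∑ l, b j x * (a i l x * (pd l u x * pd j (pd i u) x)) =
        ∑ j, ∑ i, ∑ l, b j x * (a i l x * (pd i u x * pd j (pd l u) x)) := by
      refine Finset.sum_congr rfl fun j _ => ?_
      rw [Finset.sum_comm]
      refine Finset.sum_congr rfl fun i _ => Finset.sum_congr rfl fun l _ => ?_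
      rw [hs]
    have s3 : ∑ j, ∑ i, ∑ l, b j x * ((pd i u x * pd l u x) * pd j (a i l) x) =
        ∑ i, ∑ j, ∑ l, b j x * ((pd i u x * pd l u x) * pd j (a i l) x) := Finset.sum_comm
    rw [e2]
    simp only [Finset.mul_sum, mul_add, Finset.sum_add_distrib] at *
    rw [s2, s1, s3]
    simp only [← Finset.mul_sum]
    ring
  change _ = ∑ i, ∑ l, (∑ j, (2 * a i j x * pd j (b l) x - b j x * pd j (a i l) x))
    * (pd i u x * pd l u x)
  rw [e1, e3]
  simp only [Finset.mul_sum, ← Finset.sum_sub_distrib, Finset.sum_mul]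
  refine Finset.sum_congr rfl fun i _ => ?_
  rw [Finset.sum_comm]
  refine Finset.sum_congr rfl fun l _ => Finset.sum_congr rfl fun j _ => ?_
  ring

/-- The coefficients of the quadratic form in `hessian_eq_sum` are continuous, hence bounded on K,
and ellipticity turns |∇u|² into Γ(u, u). -/
theorem exists_hessian_bound (hs : ∀ i j, a i j = a j i) (hc : ∀ i j, ContDiff ℝ ∞ (a i j))
    {K : Set (EuclideanSpace ℝ (Fin q))} (hK : IsCompact K) {m : ℝ} (hm : 0 < m)
    (hell : ∀ x ∈ K, ∀ ξ : Fin q → ℝ, m * ∑ i, ξ i ^ 2 ≤ ∑ i, ∑ j, a i j x * (ξ i * ξ j))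
    {ϕ : EuclideanSpace ℝ (Fin q) → ℝ} (hϕ : ContDiff ℝ ∞ ϕ) :
    ∃ C, ∀ x ∈ K, ∀ u : EuclideanSpace ℝ (Fin q) → ℝ, ContDiff ℝ ∞ u →
      -(C * gam a u u x) ≤ 2 * gam a u (gam a ϕ u) x - gam a ϕ (gam a u u) x := by
  set h : Fin q → Fin q → EuclideanSpace ℝ (Fin q) → ℝ := fun i l x =>
    ∑ j, (2 * a i j x * pd j (fun y => ∑ k, a l k y * pd k ϕ y) x
        - (∑ k, a j k x * pd k ϕ x) * pd j (a i l) x) with hh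
  have hcont : Continuous fun x => ∑ i, ∑ l, |h i l x| := by
    have h1 := fun l j => (contDiff_pd j (contDiff_flux hc hϕ l)).continuous
    have h2 := fun l => (contDiff_flux hc hϕ l).continuous
    have h3 := fun i l j => (contDiff_pd j (hc i l)).continuous
    have h4 := fun i l => (hc i l).continuous
    simp only [hh]
    refine continuous_finsetSum _ fun i _ => continuous_finsetSum _ fun l _ =>
      Continuous.abs (continuous_finsetSum _ fun j _ => ?_)
    exact ((continuous_const.mul (h4 i j)).mul (h1 l j)).sub ((h2 j).mul (h3 i l j))
  obtain ⟨C, hC⟩ := hK.exists_bound_of_continuousOn hcont.continuousOn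
  refine ⟨C / m, fun x hx u hu => ?_⟩
  rw [hessian_eq_sum hs hc hϕ hu]
  have hb := hC x hx
  have h0 : 0 ≤ ∑ i, ∑ l, |h i l x| :=
    Finset.sum_nonneg fun i _ => Finset.sum_nonneg fun l _ => abs_nonneg _
  rw [Real.norm_of_nonneg h0] at hb
  have h1 : -(∑ i, ∑ l, |h i l x|) * ∑ k, pd k u x ^ 2 ≤
      ∑ i, ∑ l, h i l x * (pd i u x * pd l u x) := by
    rw [← Finset.sum_neg_distrib, Finset.sum_mul]
    refine Finset.sum_le_sum fun i _ => ?_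
    rw [← Finset.sum_neg_distrib, Finset.sum_mul]
    refine Finset.sum_le_sum fun l _ => ?_
    have hk : ∀ k : Fin q, pd k u x ^ 2 ≤ ∑ k, pd k u x ^ 2 := fun k =>
      Finset.single_le_sum (f := fun k => pd k u x ^ 2) (fun _ _ => sq_nonneg _)
        (Finset.mem_univ k)
    have h2 : |pd i u x * pd l u x| ≤ ∑ k, pd k u x ^ 2 := by
      rw [abs_le]
      constructor <;> nlinarith [hk i, hk l, sq_nonneg (pd i u x + pd l u x),
        sq_nonneg (pd i u x - pd l u x)]
    have h3 := mul_le_mul_of_nonneg_left h2 (abs_nonneg (h i l x))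
    rw [← abs_mul] at h3
    linarith [neg_abs_le (h i l x * (pd i u x * pd l u x))]
  have h2 : m * ∑ k, pd k u x ^ 2 ≤ gam a u u x := hell x hx fun i => pd i u x
  have h3 : 0 ≤ ∑ k, pd k u x ^ 2 := Finset.sum_nonneg fun k _ => sq_nonneg _
  have h4 := mul_le_mul_of_nonneg_right hb h3
  have h5 : C * ∑ k, pd k u x ^ 2 ≤ C / m * gam a u u x := by
    have := mul_le_mul_of_nonneg_left h2 (div_nonneg (h0.trans hb) hm.le)
    rwa [← mul_assoc, div_mul_cancel₀ _ hm.ne'] at this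
  linarith

theorem exists_upper_bound {K : Set (EuclideanSpace ℝ (Fin q))} (hK : IsCompact K)
    {u : EuclideanSpace ℝ (Fin q) → ℝ} (hu : Continuous u) : ∃ C, ∀ x ∈ K, |u x| ≤ C :=
  hK.exists_bound_of_continuousOn hu.continuousOn

set_option maxHeartbeats 1000000 in
/-- The weight `exp (lam ϕ)` satisfies the convexity conditions of the Carleman estimate when `lam`
is large. -/
theorem exists_carleman_weight (hs : ∀ i j, a i j = a j i) (hc : ∀ i j, ContDiff ℝ ∞ (a i j))
    {K : Set (EuclideanSpace ℝ (Fin q))} (hK : IsCompact K) {m : ℝ} (hm : 0 < m)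
    (hell : ∀ x ∈ K, ∀ ξ : Fin q → ℝ, m * ∑ i, ξ i ^ 2 ≤ ∑ i, ∑ j, a i j x * (ξ i * ξ j))
    {ϕ : EuclideanSpace ℝ (Fin q) → ℝ} (hϕ : ContDiff ℝ ∞ ϕ)
    (hϕK : ∀ x ∈ K, 0 < gam a ϕ ϕ x) (β : ℝ) :
    ∃ lam c C : ℝ, ∃ ψ κ : EuclideanSpace ℝ (Fin q) → ℝ, 0 < lam ∧ 0 < c ∧ 0 ≤ C ∧
      ContDiff ℝ ∞ ψ ∧ ContDiff ℝ ∞ κ ∧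
      (∀ x, ψ x = Real.exp (lam * ϕ x) - Real.exp (lam * β)) ∧
      (∀ x ∈ K, ∀ z : EuclideanSpace ℝ (Fin q) → ℝ, ContDiff ℝ ∞ z → c * gam a z z x ≤
        2 * gam a z (gam a ψ z) x - gam a ψ (gam a z z) x + κ x * gam a z z x) ∧
      (∀ x ∈ K, c ≤ gam a ψ (gam a ψ ψ) x - κ x * gam a ψ ψ x) ∧
      (∀ x ∈ K, divOp a (fun y => divOp a ψ y + κ y) x ≤ C) ∧
      (∀ x ∈ K, κ x ^ 2 ≤ C) ∧ (∀ x ∈ K, gam a ψ ψ x ≤ C) := by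
  have hG := contDiff_gam hc hϕ hϕ
  obtain ⟨g, hg, hgK⟩ := hK.exists_forall_le' hG.continuous.continuousOn hϕK
  obtain ⟨C1, hC1⟩ := exists_hessian_bound hs hc hK hm hell hϕ
  obtain ⟨C2, hC2⟩ := exists_upper_bound hK (contDiff_gam hc hϕ hG).continuous
  -- The two lower bounds on `lam` absorb the Hessian of ϕ and the term Γ(ϕ, Γ(ϕ, ϕ)); g is a
  -- positive lower bound of Γ(ϕ, ϕ) on K.
  obtain ⟨lam, hlam1, hlam2, hlam3⟩ : ∃ lam : ℝ, 1 ≤ lam ∧ C1 + 1 ≤ lam * g ∧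
      C2 + 1 ≤ lam * g ^ 2 := by
    refine ⟨max 1 (max ((C1 + 1) / g) ((C2 + 1) / g ^ 2)), le_max_left _ _, ?_, ?_⟩
    · rw [← div_le_iff₀ hg]; exact (le_max_left _ _).trans (le_max_right _ _)
    · rw [← div_le_iff₀ (by positivity)]; exact (le_max_right _ _).trans (le_max_right _ _)
  have hlam0 : 0 < lam := by linarith
  set E : EuclideanSpace ℝ (Fin q) → ℝ := fun x => Real.exp (lam * ϕ x) with hE
  have hEc : ContDiff ℝ ∞ E := (contDiff_const.mul hϕ).exp
  have hE0 : ∀ x, 0 < E x := fun x => Real.exp_pos _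
  obtain ⟨e, he, heK⟩ := hK.exists_forall_le' hEc.continuous.continuousOn fun x _ => hE0 x
  set ψ : EuclideanSpace ℝ (Fin q) → ℝ := fun x => E x - Real.exp (lam * β) with hψ
  have hψc : ContDiff ℝ ∞ ψ := hEc.sub contDiff_const
  -- In `h2` the leading part of Γ(ψ, Γ(ψ, ψ)) is 2 lam⁴E³Γ(ϕ,ϕ)². This κ spends half of it, and
  -- gains lam²EΓ(ϕ,ϕ)Γ(z,z) in `h1`, one order of `lam` above the Hessian of ϕ.
  set κ : EuclideanSpace ℝ (Fin q) → ℝ := fun x => lam ^ 2 * (E x * gam a ϕ ϕ x) with hκ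
  have hκc : ContDiff ℝ ∞ κ := contDiff_const.mul (hEc.mul hG)
  have hd : ∀ x, HasDerivAt (fun t => Real.exp (lam * t) - Real.exp (lam * β))
      (lam * E x) (ϕ x) := by
    intro y
    simpa [hE, mul_comm] using (((hasDerivAt_id (ϕ y)).const_mul lam).exp).sub_const (Real.exp (lam * β))
  have hdE : ∀ x, HasDerivAt (fun t => Real.exp (lam * t)) (lam * E x) (ϕ x) := by
    intro y
    simpa [hE, mul_comm] using (((hasDerivAt_id (ϕ y)).const_mul lam).exp)
  have hψr : ∀ u x, gam a u ψ x = lam * E x * gam a u ϕ x := fun u x =>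
    gam_comp_right (hd x) hϕ
  have hEr : ∀ u x, gam a u E x = lam * E x * gam a u ϕ x := fun u x =>
    gam_comp_right (hdE x) hϕ
  have hψl : ∀ u, gam a ψ u = fun x => lam * (E x * gam a ϕ u x) := fun u => by
    funext x; rw [gam_comm hs, hψr, gam_comm hs]; ring
  have hψψ : gam a ψ ψ = fun x => lam ^ 2 * ((E x * E x) * gam a ϕ ϕ x) := by
    funext x; rw [hψr, hψl]; ring
  obtain ⟨D1, hD1⟩ := exists_upper_bound hK
    (contDiff_divOp hc ((contDiff_divOp hc hψc).add hκc)).continuous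
  obtain ⟨D2, hD2⟩ := exists_upper_bound hK (hκc.pow 2).continuous
  obtain ⟨D3, hD3⟩ := exists_upper_bound hK (contDiff_gam hc hψc hψc).continuous
  -- With e a lower bound of E = exp(lam ϕ) on K, the gradient condition gains a factor E and the
  -- zeroth-order condition a factor E³.
  refine ⟨lam, min e (e ^ 3), max 0 (max D1 (max D2 D3)), ψ, κ, hlam0, lt_min he (by positivity),
    le_max_left _ _, hψc, hκc, fun x => rfl, ?_, ?_, ?_, ?_, ?_⟩
  · intro x hx z hz
    have hϕz := contDiff_gam hc hϕ hz
    have hzz : 0 ≤ gam a z z x := le_trans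
      (mul_nonneg hm.le (Finset.sum_nonneg fun i _ => sq_nonneg _)) (hell x hx fun i => pd i z x)
    have e1 : gam a z (gam a ψ z) x =
        lam * (E x * gam a z (gam a ϕ z) x + lam * E x * gam a ϕ z x ^ 2) := by
      rw [hψl, gam_const_mul_right lam (hEc.mul hϕz), gam_mul_right hEc hϕz, hEr, gam_comm hs z ϕ]
      ring
    have e2 : gam a ψ (gam a z z) x = lam * (E x * gam a ϕ (gam a z z) x) := by rw [hψl]
    rw [e1, e2]
    have k1 := mul_le_mul_of_nonneg_left (hC1 x hx z hz) (mul_pos hlam0 (hE0 x)).le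
    have k2 : 0 ≤ lam ^ 2 * E x * gam a ϕ z x ^ 2 :=
      mul_nonneg (mul_nonneg (sq_nonneg _) (hE0 x).le) (sq_nonneg _)
    have k3 : C1 + 1 ≤ lam * gam a ϕ ϕ x :=
      hlam2.trans (mul_le_mul_of_nonneg_left (hgK x hx) hlam0.le)
    have k4 := mul_le_mul_of_nonneg_left k3 (mul_nonneg (mul_pos hlam0 (hE0 x)).le hzz)
    have k5 : min e (e ^ 3) ≤ lam * E x := (min_le_left _ _).trans
      ((heK x hx).trans (le_mul_of_one_le_left (hE0 x).le hlam1))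
    have k6 := mul_le_mul_of_nonneg_right k5 hzz
    have hκx : κ x = lam ^ 2 * (E x * gam a ϕ ϕ x) := rfl
    rw [hκx]
    nlinarith [k1, k2, k4, k6]
  · intro x hx
    have e1 : gam a ψ (gam a ψ ψ) x = lam ^ 3 * E x ^ 3 *
        (2 * lam * gam a ϕ ϕ x ^ 2 + gam a ϕ (gam a ϕ ϕ) x) := by
      rw [hψl]
      simp only
      rw [hψψ, gam_const_mul_right _ ((hEc.mul hEc).mul hG), gam_mul_right (hEc.mul hEc) hG,
        gam_mul_right hEc hEc, hEr]
      ring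
    have hκx : κ x = lam ^ 2 * (E x * gam a ϕ ϕ x) := rfl
    have e2 : gam a ψ ψ x = lam ^ 2 * ((E x * E x) * gam a ϕ ϕ x) := by rw [hψψ]
    rw [e1, e2, hκx]
    have k1 : C2 + 1 ≤ lam * gam a ϕ ϕ x ^ 2 := hlam3.trans
      (mul_le_mul_of_nonneg_left (pow_le_pow_left₀ hg.le (hgK x hx) 2) hlam0.le)
    have k2 := (abs_le.1 (hC2 x hx)).1
    have k3 : 1 ≤ lam * gam a ϕ ϕ x ^ 2 + gam a ϕ (gam a ϕ ϕ) x := by linarith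
    have k4 : min e (e ^ 3) ≤ lam ^ 3 * E x ^ 3 := (min_le_right _ _).trans
      ((pow_le_pow_left₀ he.le (heK x hx) 3).trans
        (le_mul_of_one_le_left (pow_pos (hE0 x) 3).le (one_le_pow₀ hlam1)))
    have k5 := mul_le_mul_of_nonneg_left k3 (by have := hE0 x; positivity : 0 ≤ lam ^ 3 * E x ^ 3)
    nlinarith [k4, k5]
  · exact fun x hx => ((le_abs_self _).trans (hD1 x hx)).trans
      ((le_max_left _ _).trans (le_max_right _ _))
  · exact fun x hx => ((le_abs_self _).trans (hD2 x hx)).trans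
      ((le_max_left _ _).trans ((le_max_right _ _).trans (le_max_right _ _)))
  · exact fun x hx => ((le_abs_self _).trans (hD3 x hx)).trans
      ((le_max_right _ _).trans ((le_max_right _ _).trans (le_max_right _ _)))

end Elliptic

/-! ### Unique continuation from a ball -/

namespace Elliptic

open MeasureTheory

variable {q : ℕ} {a : Fin q → Fin q → EuclideanSpace ℝ (Fin q) → ℝ}

theorem pd_neg_normSq (p : EuclideanSpace ℝ (Fin q)) (i : Fin q) (x : EuclideanSpace ℝ (Fin q)) :
    pd i (fun y => -‖y - p‖ ^ 2) x = -2 * (x i - p i) := by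
  have h : (fun y : EuclideanSpace ℝ (Fin q) => -‖y - p‖ ^ 2) =
      fun y => ∑ k, -((y k - p k) * (y k - p k)) := by
    funext y
    rw [EuclideanSpace.norm_sq_eq, ← Finset.sum_neg_distrib]
    refine Finset.sum_congr rfl fun k _ => ?_
    simp [sq]
  have hd : ∀ k, DifferentiableAt ℝ (fun y : EuclideanSpace ℝ (Fin q) => y k - p k) x :=
    fun k => by fun_prop
  have hp : ∀ k, pd i (fun y : EuclideanSpace ℝ (Fin q) => y k - p k) x = if i = k then 1 else 0 := by
    intro k
    have : fderiv ℝ (fun y : EuclideanSpace ℝ (Fin q) => y k - p k) x =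
        EuclideanSpace.proj k := by
      rw [fderiv_sub_const]
      exact (EuclideanSpace.proj (𝕜 := ℝ) k).fderiv
    simp [pd, this, eq_comm]
  rw [h, pd_sum _ fun k _ => by fun_prop]
  have : ∀ k, pd i (fun y : EuclideanSpace ℝ (Fin q) => -((y k - p k) * (y k - p k))) x =
      if i = k then -2 * (x k - p k) else 0 := by
    intro k
    have hq : HasDerivAt (fun t : ℝ => -(t * t)) (-2 * (x k - p k)) (x k - p k) := by
      exact (((hasDerivAt_id (x k - p k)).mul (hasDerivAt_id (x k - p k))).neg).congr_deriv
        (by simp only [id_eq]; ring)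
    rw [pd_comp (u := fun y : EuclideanSpace ℝ (Fin q) => y k - p k) hq (hd k), hp]
    split_ifs <;> simp
  simp [this]

theorem eq_of_pd_eq_zero {s : Set (EuclideanSpace ℝ (Fin q))} (hs : IsOpen s)
    (hs' : IsPreconnected s) {u : EuclideanSpace ℝ (Fin q) → ℝ} (hu : DifferentiableOn ℝ u s)
    (h : ∀ x ∈ s, ∀ i, pd i u x = 0) {x y : EuclideanSpace ℝ (Fin q)} (hx : x ∈ s) (hy : y ∈ s) :
    u x = u y :=
  hs.is_const_of_fderiv_eq_zero hs' hu (fun z hz => fderiv_eq_zero_of_pd_eq_zero (h z hz)) hx hy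

/-- The solution, normalised by a constant and cut off, is inserted in the Carleman estimate with a
weight decreasing in the distance to p. Where the cutoff is 1 the differential inequality lets the
left side absorb the right; the cutoff error sits where the weight is at most 1. A nonzero
derivative inside then contradicts s → ∞. Since the inequality involves only derivatives of w, no
term in w itself has to be absorbed. -/
theorem unique_continuation_of_contDiff {ι : Type*} [Fintype ι]
    (hs : ∀ i j, a i j = a j i) (hc : ∀ i j, ContDiff ℝ ∞ (a i j))
    {p : EuclideanSpace ℝ (Fin q)} {r R B : ℝ} (hr : 0 < r)
    (hpos : ∀ x ∈ Metric.ball p R, ∀ ξ : Fin q → ℝ, ξ ≠ 0 →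
      0 < ∑ i, ∑ j, a i j x * (ξ i * ξ j))
    {w : ι → EuclideanSpace ℝ (Fin q) → ℝ} (hw : ∀ α, ContDiff ℝ ∞ (w α))
    (hP : ∀ x ∈ Metric.ball p R, ∀ α, |∑ i, ∑ j, a i j x * pd i (pd j (w α)) x| ≤
      B * ∑ β, ∑ i, |pd i (w β) x|)
    (h0 : ∀ x ∈ Metric.ball p r, ∀ α i, pd i (w α) x = 0) :
    ∀ x ∈ Metric.ball p R, ∀ α i, pd i (w α) x = 0 := by
  intro y hy α₀ i₀
  obtain ⟨R1, hyR1, hR1R⟩ := exists_between (Metric.mem_ball.1 hy)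
  obtain ⟨R2, hR12, hR2R⟩ := exists_between hR1R
  have hR10 : 0 < R1 := dist_nonneg.trans_lt hyR1
  set χ : ContDiffBump p := ⟨R1, R2, hR10, hR12⟩ with hχ
  set χ₂ : ContDiffBump p := ⟨R2, R, hR10.trans hR12, hR2R⟩ with hχ₂
  have hχc : ContDiff ℝ ∞ χ := χ.contDiff
  set v : ι → EuclideanSpace ℝ (Fin q) → ℝ := fun α x => χ x * (w α x - w α p) with hv
  have hvc : ∀ α, ContDiff ℝ ∞ (v α) := fun α => hχc.mul ((hw α).sub contDiff_const)
  -- Removing the small ball costs nothing, since w - w(p) is zero there, and it removes p, the only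
  -- critical point of -‖y - p‖².
  set K : Set (EuclideanSpace ℝ (Fin q)) := Metric.closedBall p R2 \ Metric.ball p r with hKdef
  have hKc : IsCompact K := (isCompact_closedBall p R2).diff Metric.isOpen_ball
  have hKR : K ⊆ Metric.ball p R := fun x hx => Metric.closedBall_subset_ball hR2R hx.1
  have hv0 : ∀ α, ∀ x ∈ Metric.ball p r, v α x = 0 := by
    intro α x hx
    have := eq_of_pd_eq_zero Metric.isOpen_ball (convex_ball p r).isPreconnected
      ((hw α).differentiable (by simp)).differentiableOn (fun z hz i => h0 z hz α i) hx
      (Metric.mem_ball_self hr)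
    simp [hv, this]
  have hvK : ∀ α, tsupport (v α) ⊆ K := by
    intro α x hx
    refine ⟨?_, fun hxr => ?_⟩
    · have := tsupport_mul_subset_left hx
      rwa [χ.tsupport_eq] at this
    · have : v α =ᶠ[𝓝 x] fun _ => 0 := by
        filter_upwards [Metric.isOpen_ball.mem_nhds hxr] with z hz using hv0 α z hz
      exact (notMem_tsupport_iff_eventuallyEq.2 this) hx
  have hvcs : ∀ α, HasCompactSupport (v α) := fun α => χ.hasCompactSupport.mul_right
  obtain ⟨m, hm, hell⟩ := exists_ellipticity_const hKc hc fun x hx => hpos x (hKR hx)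
  set ϕ : EuclideanSpace ℝ (Fin q) → ℝ := fun y => -‖y - p‖ ^ 2 with hϕdef
  have hϕc : ContDiff ℝ ∞ ϕ := ((contDiff_norm_sq ℝ).comp (contDiff_id.sub contDiff_const)).neg
  have hϕK : ∀ x ∈ K, 0 < gam a ϕ ϕ x := by
    intro x hx
    refine hpos x (hKR hx) (fun i => pd i ϕ x) fun h => hx.2 ?_
    have : x = p := by
      ext i
      have := congrFun h i
      simp only [hϕdef, pd_neg_normSq, Pi.zero_apply] at this
      linarith
    rw [this]; exact Metric.mem_ball_self hr
  -- The value -R1² makes ψ vanish exactly on the sphere of radius R1: nonnegative inside,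
  -- nonpositive outside.
  obtain ⟨lam, c, C, ψ, κ, hlam, hc0, hC, hψc, hκc, hψ, k1, k2, k3, k4, k5⟩ :=
    exists_carleman_weight hs hc hKc hm hell hϕc hϕK (-R1 ^ 2)
  have hψin : ∀ x ∈ Metric.ball p R1, 0 ≤ ψ x := by
    intro x hx
    rw [hψ, sub_nonneg, Real.exp_le_exp]
    refine mul_le_mul_of_nonneg_left (neg_le_neg ?_) hlam.le
    exact pow_le_pow_left₀ (norm_nonneg _) (by rw [← dist_eq_norm]; exact (Metric.mem_ball.1 hx).le) 2
  have hψout : ∀ x, R1 ≤ dist x p → ψ x ≤ 0 := by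
    intro x hx
    rw [hψ, sub_nonpos, Real.exp_le_exp]
    refine mul_le_mul_of_nonneg_left (neg_le_neg ?_) hlam.le
    exact pow_le_pow_left₀ hR10.le (by rwa [← dist_eq_norm]) 2
  have hgv : ∀ α x, m * ∑ i, pd i (v α) x ^ 2 ≤ gam a (v α) (v α) x := by
    intro α x
    by_cases hx : x ∈ tsupport (v α)
    · exact hell x (hvK α hx) fun i => pd i (v α) x
    · simp [gam_eq_zero_of_notMem_tsupport_right hx, pd_eq_zero_of_notMem_tsupport hx]
  have hgv0 : ∀ α x, 0 ≤ gam a (v α) (v α) x := fun α x =>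
    (mul_nonneg hm.le (Finset.sum_nonneg fun i _ => sq_nonneg _)).trans (hgv α x)
  have hvin : ∀ α, ∀ x ∈ Metric.ball p R1, ∀ j, pd j (v α) =ᶠ[𝓝 x] pd j (w α) := by
    intro α x hx j
    have h1 : v α =ᶠ[𝓝 x] fun y => w α y - w α p := by
      filter_upwards [Metric.isOpen_ball.mem_nhds hx] with z hz
      have : χ z = 1 := χ.one_of_mem_closedBall (Metric.ball_subset_closedBall hz)
      simp [hv, this]
    refine (pd_eventuallyEq h1).trans (Filter.Eventually.of_forall fun z => ?_)
    rw [pd_sub ((hw α).differentiable (by simp) z) (differentiableAt_const _), pd_const, sub_zero]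
  -- The inequality concerns the nondivergence form a_ij∂_i∂_j; the divergence form differs by
  -- first-order terms with coefficients ∂_i a_ij.
  obtain ⟨D, hD⟩ := exists_upper_bound hKc
    (u := fun x => ∑ i, ∑ j, |pd i (a i j) x|) (continuous_finsetSum _ fun i _ =>
      continuous_finsetSum _ fun j _ => (contDiff_pd i (hc i j)).continuous.abs)
  have hD' : ∀ x ∈ K, ∀ i j, |pd i (a i j) x| ≤ D := by
    intro x hx i j
    refine le_trans ?_ ((le_abs_self _).trans (hD x hx))
    refine le_trans ?_ (Finset.single_le_sum (f := fun i => ∑ j, |pd i (a i j) x|)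
      (fun i _ => Finset.sum_nonneg fun j _ => abs_nonneg _) (Finset.mem_univ i))
    exact Finset.single_le_sum (f := fun j => |pd i (a i j) x|)
      (fun j _ => abs_nonneg _) (Finset.mem_univ j)
  set D1 : ℝ := max D 0 with hD1
  have hD10 : 0 ≤ D1 := le_max_right _ _
  set N : ℝ := (Fintype.card (ι × Fin q) : ℝ) with hN
  have hN0 : 0 ≤ N := Nat.cast_nonneg _
  have hreg1 : ∀ α, ∀ x ∈ K, x ∈ Metric.ball p R1 →
      divOp a (v α) x ^ 2 ≤ (B + q * D1) ^ 2 * N / m * ∑ β, gam a (v β) (v β) x := by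
    intro α x hxK hx
    have e1 : divOp a (v α) x = (∑ i, ∑ j, a i j x * pd i (pd j (w α)) x)
        + ∑ i, ∑ j, pd j (w α) x * pd i (a i j) x := by
      rw [divOp_eq_sum hc (hvc α), ← Finset.sum_add_distrib]
      refine Finset.sum_congr rfl fun i _ => ?_
      rw [← Finset.sum_add_distrib]
      refine Finset.sum_congr rfl fun j _ => ?_
      rw [pd_congr (hvin α x hx j), (hvin α x hx j).eq_of_nhds]
    set S := ∑ β, ∑ i, |pd i (w β) x| with hS
    have hSα : ∑ j, |pd j (w α) x| ≤ S :=
      Finset.single_le_sum (f := fun β => ∑ i, |pd i (w β) x|)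
        (fun β _ => Finset.sum_nonneg fun j _ => abs_nonneg _) (Finset.mem_univ α)
    have hS0 : 0 ≤ S := Finset.sum_nonneg fun β _ => Finset.sum_nonneg fun j _ => abs_nonneg _
    have e2 : |∑ i, ∑ j, pd j (w α) x * pd i (a i j) x| ≤ q * D1 * S := by
      refine (Finset.abs_sum_le_sum_abs _ _).trans ?_
      have : ∀ i : Fin q, |∑ j, pd j (w α) x * pd i (a i j) x| ≤ D1 * S := by
        intro i
        refine (Finset.abs_sum_le_sum_abs _ _).trans ?_
        refine le_trans ?_ (mul_le_mul_of_nonneg_left hSα hD10)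
        rw [Finset.mul_sum]
        refine Finset.sum_le_sum fun j _ => ?_
        rw [abs_mul, mul_comm]
        exact mul_le_mul_of_nonneg_right ((hD' x hxK i j).trans (le_max_left _ _)) (abs_nonneg _)
      refine (Finset.sum_le_sum fun i _ => this i).trans ?_
      simp [mul_assoc]
    have e3 : |divOp a (v α) x| ≤ (B + q * D1) * S := by
      rw [e1]
      refine (abs_add_le _ _).trans ?_
      rw [add_mul]
      exact add_le_add (hP x (hKR hxK) α) e2
    have e4 : S ^ 2 ≤ N * ∑ β, ∑ i, pd i (v β) x ^ 2 := by
      have := sq_sum_le_card_mul_sum_sq (s := (Finset.univ : Finset (ι × Fin q)))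
        (f := fun k => |pd k.2 (w k.1) x|)
      simp only [Fintype.sum_prod_type, sq_abs, Finset.card_univ] at this
      refine this.trans_eq ?_
      congr 1
      refine Finset.sum_congr rfl fun β _ => Finset.sum_congr rfl fun i _ => ?_
      rw [(hvin β x hx i).eq_of_nhds]
    have e5 : ∑ β, ∑ i, pd i (v β) x ^ 2 ≤ 1 / m * ∑ β, gam a (v β) (v β) x := by
      rw [Finset.mul_sum]
      refine Finset.sum_le_sum fun β _ => ?_
      rw [one_div, ← div_eq_inv_mul, le_div_iff₀ hm, mul_comm]
      exact hgv β x
    calc divOp a (v α) x ^ 2 = |divOp a (v α) x| ^ 2 := (sq_abs _).symm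
      _ ≤ ((B + q * D1) * S) ^ 2 := pow_le_pow_left₀ (abs_nonneg _) e3 2
      _ = (B + q * D1) ^ 2 * S ^ 2 := by ring
      _ ≤ (B + q * D1) ^ 2 * (N * (1 / m * ∑ β, gam a (v β) (v β) x)) :=
          mul_le_mul_of_nonneg_left (e4.trans (mul_le_mul_of_nonneg_left e5 hN0)) (sq_nonneg _)
      _ = _ := by ring
  set A : ℝ := (B + q * D1) ^ 2 * N / m with hA
  have hA0 : 0 ≤ A := by positivity
  obtain ⟨A', hA'⟩ := exists_upper_bound hKc (u := fun x => ∑ α, divOp a (v α) x ^ 2)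
    (continuous_finsetSum _ fun α _ => (contDiff_divOp hc (hvc α)).continuous.pow 2)
  -- Inside radius R1 the first term on the right suffices; between R1 and R2 the weight is at most
  -- 1 and `A'` bounds the cutoff error. The bump χ₂ is an integrable majorant of the indicator of
  -- the closed R2-ball.
  have hpt : ∀ s : ℝ, 0 < s → ∀ x, ∑ α, Real.exp (s * ψ x) ^ 2 * divOp a (v α) x ^ 2 ≤
      Fintype.card ι * A * (∑ β, Real.exp (s * ψ x) ^ 2 * gam a (v β) (v β) x)
        + |A'| * χ₂ x := by
    intro s hs0 x
    rw [← Finset.mul_sum, ← Finset.mul_sum]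
    have hg0 : 0 ≤ ∑ β, gam a (v β) (v β) x := Finset.sum_nonneg fun β _ => hgv0 β x
    by_cases hxK : x ∈ K
    · by_cases hx : x ∈ Metric.ball p R1
      · have h1 : ∑ α, divOp a (v α) x ^ 2 ≤
            Fintype.card ι * (A * ∑ β, gam a (v β) (v β) x) := by
          refine (Finset.sum_le_sum fun α _ => hreg1 α x hxK hx).trans ?_
          simp
        have h2 := mul_le_mul_of_nonneg_left h1 (sq_nonneg (Real.exp (s * ψ x)))
        have h3 : 0 ≤ |A'| * χ₂ x := mul_nonneg (abs_nonneg _) χ₂.nonneg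
        nlinarith [h2, h3]
      · have h1 : χ₂ x = 1 := χ₂.one_of_mem_closedBall hxK.1
        have h2 : Real.exp (s * ψ x) ^ 2 ≤ 1 := by
          refine pow_le_one₀ (Real.exp_pos _).le (Real.exp_le_one_iff.2 ?_)
          exact mul_nonpos_of_nonneg_of_nonpos hs0.le
            (hψout x (not_lt.1 fun h => hx (Metric.mem_ball.2 h)))
        have h3 : ∑ α, divOp a (v α) x ^ 2 ≤ |A'| :=
          (le_abs_self _).trans ((hA' x hxK).trans (le_abs_self _))
        have h4 : 0 ≤ ∑ α, divOp a (v α) x ^ 2 := Finset.sum_nonneg fun α _ => sq_nonneg _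
        have h5 := mul_le_mul h2 h3 h4 zero_le_one
        have h6 : 0 ≤ Fintype.card ι * A *
            (Real.exp (s * ψ x) ^ 2 * ∑ β, gam a (v β) (v β) x) := by positivity
        rw [h1]; linarith
    · have h1 : ∀ α, divOp a (v α) x = 0 := fun α =>
        divOp_eq_zero_of_notMem_tsupport fun h => hxK (hvK α h)
      have h3 : 0 ≤ |A'| * χ₂ x := mul_nonneg (abs_nonneg _) χ₂.nonneg
      have h6 : 0 ≤ Fintype.card ι * A *
            (Real.exp (s * ψ x) ^ 2 * ∑ β, gam a (v β) (v β) x) := by positivity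
      simp only [h1]
      simp only [ne_eq, OfNat.ofNat_ne_zero, not_false_eq_true, zero_pow, Finset.sum_const_zero,
        mul_zero]
      linarith
  have hwc : ∀ s : ℝ, Continuous fun x => Real.exp (s * ψ x) ^ 2 := fun s =>
    (Real.continuous_exp.comp (continuous_const.mul hψc.continuous)).pow 2
  have iG : ∀ s : ℝ, ∀ β, Integrable fun x => Real.exp (s * ψ x) ^ 2 * gam a (v β) (v β) x :=
    fun s β => ((hwc s).mul (contDiff_gam hc (hvc β) (hvc β)).continuous).integrable_of_hasCompactSupport
      (HasCompactSupport.intro (hvcs β) fun x hx => by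
        simp [gam_eq_zero_of_notMem_tsupport_right hx])
  have iL : ∀ s : ℝ, ∀ β, Integrable fun x => Real.exp (s * ψ x) ^ 2 * divOp a (v β) x ^ 2 :=
    fun s β => ((hwc s).mul ((contDiff_divOp hc (hvc β)).continuous.pow 2)).integrable_of_hasCompactSupport
      (HasCompactSupport.intro (hvcs β) fun x hx => by
        simp [divOp_eq_zero_of_notMem_tsupport hx])
  have iχ : Integrable (fun x => χ₂ x) :=
    χ₂.continuous.integrable_of_hasCompactSupport χ₂.hasCompactSupport
  set T : ℝ → ℝ := fun s => ∑ β, ∫ x, Real.exp (s * ψ x) ^ 2 * gam a (v β) (v β) x with hT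
  have hT0 : ∀ s, 0 ≤ T s := fun s => Finset.sum_nonneg fun β _ =>
    integral_nonneg fun x => mul_nonneg (sq_nonneg _) (hgv0 β x)
  set V : ℝ := ∫ x, χ₂ x with hV
  have hV0 : 0 ≤ V := integral_nonneg fun x => χ₂.nonneg
  have hkey : ∀ s : ℝ, 1 ≤ s → 3 * C ≤ s * c →
      s * c * T s ≤ 4 * (C + 1) * (Fintype.card ι * A * T s + |A'| * V) := by
    intro s hs1 hsC
    have h1 : s * c * T s ≤
        4 * (C + 1) * ∑ α, ∫ x, Real.exp (s * ψ x) ^ 2 * divOp a (v α) x ^ 2 := by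
      rw [hT, Finset.mul_sum, Finset.mul_sum]
      exact Finset.sum_le_sum fun α _ => carleman hs hc hψc hκc hc0 hC
        (fun x hx ξ => (mul_nonneg hm.le (Finset.sum_nonneg fun i _ => sq_nonneg _)).trans
          (hell x hx ξ)) k1 k2 k3 k4 k5 (hvc α) (hvcs α) (hvK α) hs1 hsC
    have h2 := integral_mono (integrable_finsetSum _ fun α _ => iL s α)
      (((integrable_finsetSum _ fun β _ => iG s β).const_mul (Fintype.card ι * A)).add
        (iχ.const_mul |A'|)) (hpt s (by linarith))
    simp only [Pi.add_apply] at h2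
    rw [integral_finsetSum _ fun α _ => iL s α,
      integral_add ((integrable_finsetSum _ fun β _ => iG s β).const_mul _) (iχ.const_mul _),
      integral_const_mul, integral_const_mul, integral_finsetSum _ fun β _ => iG s β] at h2
    exact h1.trans (mul_le_mul_of_nonneg_left h2 (by positivity))
  by_contra hne
  have hne' : pd i₀ (v α₀) y ≠ 0 := by
    rwa [(hvin α₀ y (Metric.mem_ball.2 hyR1) i₀).eq_of_nhds]
  have hgy : 0 < gam a (v α₀) (v α₀) y := by
    refine lt_of_lt_of_le (mul_pos hm ?_) (hgv α₀ y)
    exact Finset.sum_pos' (fun i _ => sq_nonneg _) ⟨i₀, Finset.mem_univ _, by positivity⟩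
  -- η ≤ 1 is supported where ψ ≥ 0, so η ≤ e^{2sψ} for every s > 0: this makes the lower bound δ of
  -- T(s) independent of s.
  obtain ⟨η, hη1, hη2, hη3, hη4, hη5⟩ := exists_contDiff_tsupport_subset (n := ⊤)
    (Metric.isOpen_ball.mem_nhds (Metric.mem_ball.2 hyR1) : Metric.ball p R1 ∈ 𝓝 y)
  have hη01 : ∀ x, 0 ≤ η x ∧ η x ≤ 1 := fun x => hη4 ⟨x, rfl⟩
  have hδ : 0 < ∫ x, η x * gam a (v α₀) (v α₀) x := by
    refine Continuous.integral_pos_of_hasCompactSupport_nonneg_nonzero (x := y)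
      (hη3.continuous.mul (contDiff_gam hc (hvc α₀) (hvc α₀)).continuous) hη2.mul_right
      (fun x => mul_nonneg (hη01 x).1 (hgv0 α₀ x)) ?_
    rw [hη5, one_mul]; exact hgy.ne'
  set δ := ∫ x, η x * gam a (v α₀) (v α₀) x
  have hδT : ∀ s : ℝ, 0 < s → δ ≤ T s := by
    intro s hs0
    refine le_trans ?_ (Finset.single_le_sum (f := fun β => ∫ x, Real.exp (s * ψ x) ^ 2 *
      gam a (v β) (v β) x) (fun β _ => integral_nonneg fun x =>
        mul_nonneg (sq_nonneg _) (hgv0 β x)) (Finset.mem_univ α₀))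
    refine integral_mono ?_ (iG s α₀) fun x => ?_
    · exact (hη3.continuous.mul
        (contDiff_gam hc (hvc α₀) (hvc α₀)).continuous).integrable_of_hasCompactSupport
          hη2.mul_right
    · refine mul_le_mul_of_nonneg_right ?_ (hgv0 α₀ x)
      by_cases hx : x ∈ Metric.ball p R1
      · exact (hη01 x).2.trans (one_le_pow₀ (Real.one_le_exp (mul_nonneg hs0.le (hψin x hx))))
      · rw [image_eq_zero_of_notMem_tsupport fun h => hx (hη1 h)]
        positivity
  set Q : ℝ := 4 * (C + 1) * (Fintype.card ι * A) with hQ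
  set W : ℝ := 4 * (C + 1) * (|A'| * V) with hW
  have hW0 : 0 ≤ W := by positivity
  -- Then (sc - Q)T(s) ≥ (W/δ + 1)δ = W + δ, against the upper bound W.
  obtain ⟨s, hs1, hs2⟩ : ∃ s : ℝ, 1 ≤ s ∧ 3 * C + Q + W / δ + 1 ≤ s * c := by
    refine ⟨max 1 ((3 * C + Q + W / δ + 1) / c), le_max_left _ _, ?_⟩
    rw [← div_le_iff₀ hc0]; exact le_max_right _ _
  have hQ0 : 0 ≤ Q := by positivity
  have hWδ : 0 ≤ W / δ := by positivity
  have h1 := hkey s hs1 (by linarith)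
  have h2 := hδT s (by linarith)
  have h3 : (s * c - Q) * T s ≤ W := by rw [hQ, hW]; linarith
  have h4 : (W / δ + 1) * δ ≤ (s * c - Q) * T s :=
    mul_le_mul (by linarith) h2 hδ.le (by linarith)
  rw [add_mul, div_mul_cancel₀ _ hδ.ne'] at h4
  linarith

/-- **Weak unique continuation** for second order elliptic differential inequalities: a smooth
solution whose differential vanishes near the centre of a ball has vanishing differential on the
ball. -/
theorem unique_continuation {ι : Type*} [Fintype ι]
    {p : EuclideanSpace ℝ (Fin q)} {r R B : ℝ} (hr : 0 < r)
    (hs : ∀ i j, ∀ x ∈ Metric.ball p R, a i j x = a j i x)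
    (hc : ∀ i j, ContDiffOn ℝ ∞ (a i j) (Metric.ball p R))
    (hpos : ∀ x ∈ Metric.ball p R, ∀ ξ : Fin q → ℝ, ξ ≠ 0 →
      0 < ∑ i, ∑ j, a i j x * (ξ i * ξ j))
    {w : ι → EuclideanSpace ℝ (Fin q) → ℝ} (hw : ∀ α, ContDiffOn ℝ ∞ (w α) (Metric.ball p R))
    (hP : ∀ x ∈ Metric.ball p R, ∀ α, |∑ i, ∑ j, a i j x * pd i (pd j (w α)) x| ≤
      B * ∑ β, ∑ i, |pd i (w β) x|)
    (h0 : ∀ x ∈ Metric.ball p r, ∀ α i, pd i (w α) x = 0) :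
    ∀ x ∈ Metric.ball p R, ∀ α i, pd i (w α) x = 0 := by
  intro y hy α i
  obtain ⟨R1, hyR1, hR1R⟩ := exists_between (Metric.mem_ball.1 hy)
  obtain ⟨R2, hR12, hR2R⟩ := exists_between hR1R
  have hR10 : 0 < R1 := dist_nonneg.trans_lt hyR1
  set χ : ContDiffBump p := ⟨R1, R2, hR10, hR12⟩ with hχ
  have hglob : ∀ u : EuclideanSpace ℝ (Fin q) → ℝ, ContDiffOn ℝ ∞ u (Metric.ball p R) →
      ContDiff ℝ ∞ fun x => χ x * u x := by
    intro u hu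
    rw [contDiff_iff_contDiffAt]
    intro x
    by_cases hx : x ∈ Metric.ball p R
    · exact χ.contDiff.contDiffAt.mul (hu.contDiffAt (Metric.isOpen_ball.mem_nhds hx))
    · have h1 : x ∉ tsupport χ := by
        rw [χ.tsupport_eq]
        exact fun h => hx (Metric.closedBall_subset_ball hR2R h)
      have h2 : (fun x => χ x * u x) =ᶠ[𝓝 x] fun _ => 0 := by
        filter_upwards [notMem_tsupport_iff_eventuallyEq.mp h1] with z hz
        simp [hz]
      exact contDiffAt_const.congr_of_eventuallyEq h2
  have heq : ∀ u : EuclideanSpace ℝ (Fin q) → ℝ, ∀ x ∈ Metric.ball p R1,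
      (fun x => χ x * u x) =ᶠ[𝓝 x] u := by
    intro u x hx
    filter_upwards [Metric.isOpen_ball.mem_nhds hx] with z hz
    rw [χ.one_of_mem_closedBall (Metric.ball_subset_closedBall hz), one_mul]
  have hsub : Metric.ball p R1 ⊆ Metric.ball p R := Metric.ball_subset_ball hR1R.le
  -- Multiplying coefficients and unknowns by χ makes them globally smooth without changing them on
  -- the ball of radius R1, the only place where ellipticity and the inequality are then needed.
  have key := unique_continuation_of_contDiff (a := fun i j x => χ x * a i j x)
    (w := fun α x => χ x * w α x) (r := min r R1) (R := R1) (B := |B|) (p := p)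
    (fun i j => funext fun x => by
      by_cases hx : x ∈ Metric.ball p R
      · rw [hs i j x hx]
      · rw [image_eq_zero_of_notMem_tsupport (f := χ) (x := x) (by
          rw [χ.tsupport_eq]
          exact fun h => hx (Metric.closedBall_subset_ball hR2R h)), zero_mul, zero_mul])
    (fun i j => hglob _ (hc i j)) (lt_min hr hR10)
    (fun x hx ξ hξ => by
      simp only [fun i j => (heq (a i j) x hx).eq_of_nhds]
      exact hpos x (hsub hx) ξ hξ)
    (fun α => hglob _ (hw α))
    (fun x hx α => by
      simp only [fun i j => (heq (a i j) x hx).eq_of_nhds,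
        fun i α => pd_congr (i := i) (heq (w α) x hx),
        fun i j α => pd_congr (i := i) (pd_eventuallyEq (i := j) (heq (w α) x hx))]
      exact (hP x (hsub hx) α).trans (mul_le_mul_of_nonneg_right (le_abs_self B)
        (Finset.sum_nonneg fun _ _ => Finset.sum_nonneg fun _ _ => abs_nonneg _)))
    (fun x hx α i => by
      rw [pd_congr (heq (w α) x (Metric.ball_subset_ball (min_le_right _ _) hx))]
      exact h0 x (Metric.ball_subset_ball (min_le_left _ _) hx) α i)
    y (Metric.mem_ball.2 hyR1) α i
  rwa [pd_congr (heq (w α) y (Metric.mem_ball.2 hyR1))] at key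

end Elliptic

/-! ### The stress-energy identity in coordinates -/

namespace Elliptic

section Algebra

variable {κ : Type*} [Fintype κ] [DecidableEq κ]

/-- Here A is the differential, N the second fundamental form, u the weight and En the energy, all
at one point. In the conservation law, `htens` paired with A d removes the traces of N and of du ⊗
A, while `hdEn` and the symmetry of N give tr⟨A, N(·, d)⟩ = ½ dEn d. What remains is ½ En du d. -/
theorem stressEnergy_identity_aux {V : Type*} [AddCommGroup V] [Module ℝ V]
    (B : V →ₗ[ℝ] V →ₗ[ℝ] ℝ) (hB : ∀ v w, B v w = B w v) (g gi : κ → κ → ℝ)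
    (hinv : ∀ c d, ∑ a, gi c a * g a d = if c = d then 1 else 0)
    (u En : ℝ) (du dEn : κ → ℝ) (A : κ → V) (N : κ → κ → V) (hN : ∀ c a, N c a = N a c)
    (hdEn : ∀ c, dEn c = 2 * ∑ a, ∑ b, gi a b * B (N c a) (A b))
    (htens : ∑ c, ∑ a, gi c a • (u • N c a + du c • A a) = 0)
    (hcons : ∀ d, ∑ c, ∑ a, gi c a * (du c * (1 / 2 * En * g a d - B (A a) (A d))
      + u * (1 / 2 * dEn c * g a d - B (N c a) (A d) - B (A a) (N c d))) = 0) (d : κ) :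
    En * du d = 0 := by
  have h1 : ∀ X : κ → ℝ, ∑ c, ∑ a, gi c a * (X c * g a d) = X d := by
    intro X
    have : ∀ c, ∑ a, gi c a * (X c * g a d) = X c * if c = d then 1 else 0 := by
      intro c
      rw [← hinv, Finset.mul_sum]
      exact Finset.sum_congr rfl fun a _ => by ring
    simp [this]
  have h2 := congrArg (fun v => B v (A d)) htens
  simp only [map_sum, LinearMap.sum_apply, map_smul, map_add, LinearMap.smul_apply,
    LinearMap.add_apply, smul_eq_mul, map_zero, LinearMap.zero_apply] at h2
  have h3 : ∑ c, ∑ a, gi c a * B (A a) (N c d) = 1 / 2 * dEn d := by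
    rw [hdEn, ← mul_assoc]
    norm_num
    refine Finset.sum_congr rfl fun c _ => Finset.sum_congr rfl fun a _ => ?_
    rw [hB, hN]
  have h4 : ∑ c, ∑ a, gi c a * (du c * (1 / 2 * En * g a d - B (A a) (A d))
      + u * (1 / 2 * dEn c * g a d - B (N c a) (A d) - B (A a) (N c d))) =
      ∑ c, ∑ a, gi c a * ((1 / 2 * En * du c + u * (1 / 2 * dEn c)) * g a d)
      - ∑ c, ∑ a, gi c a * (u * B (N c a) (A d) + du c * B (A a) (A d))
      - u * ∑ c, ∑ a, gi c a * B (A a) (N c d) := by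
    simp only [Finset.mul_sum, ← Finset.sum_sub_distrib]
    exact Finset.sum_congr rfl fun c _ => Finset.sum_congr rfl fun a _ => by ring
  have h5 := hcons d
  rw [h4, h1 (fun c => 1 / 2 * En * du c + u * (1 / 2 * dEn c)), h2, h3] at h5
  linarith


theorem deriv_inverse_compat (X g gi D Di : Matrix κ κ ℝ) (h1 : gi * g = 1) (h2 : g * gi = 1)
    (hD : D = X * g + g * X.transpose) (hDi : D * gi + g * Di = 0) :
    Di = -(gi * X) - X.transpose * gi := by
  have h3 : Di = -(gi * D * gi) := by
    have : gi * (D * gi + g * Di) = 0 := by rw [hDi, mul_zero]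
    rw [mul_add, ← mul_assoc, ← mul_assoc, h1, one_mul] at this
    exact eq_neg_of_add_eq_zero_right this
  rw [h3, hD, mul_add, add_mul, ← mul_assoc, ← mul_assoc, mul_assoc (gi * X), h2, mul_one,
    h1, one_mul]
  abel

/-- Metric contraction commutes with covariant differentiation: X is the Christoffel matrix in a
fixed direction, `hD` says that g is parallel, and `hDi` is the derivative of g g⁻¹ = 1. Thus the
Christoffel terms disappear from the derivative of a trace. -/
theorem trace_compat (X g gi D Di : Matrix κ κ ℝ) (h1 : gi * g = 1) (h2 : g * gi = 1)
    (hD : D = X * g + g * X.transpose) (hDi : D * gi + g * Di = 0) (h : κ → κ → ℝ) :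
    ∑ a, ∑ b, (Di a b * h a b + gi a b * (∑ k, X a k * h k b + ∑ k, X b k * h a k)) = 0 := by
  rw [deriv_inverse_compat X g gi D Di h1 h2 hD hDi]
  have e1 : ∑ a, ∑ b, (∑ k, gi a k * X k b) * h a b = ∑ a, ∑ b, gi a b * ∑ k, X b k * h a k := by
    refine Finset.sum_congr rfl fun a _ => ?_
    simp only [Finset.sum_mul, Finset.mul_sum]
    rw [Finset.sum_comm]
    exact Finset.sum_congr rfl fun b _ => Finset.sum_congr rfl fun k _ => by ring
  have e2 : ∑ a, ∑ b, (∑ k, X k a * gi k b) * h a b = ∑ a, ∑ b, gi a b * ∑ k, X a k * h k b := by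
    rw [Finset.sum_comm, Finset.sum_comm (f := fun a b => gi a b * ∑ k, X a k * h k b)]
    refine Finset.sum_congr rfl fun b _ => ?_
    simp only [Finset.sum_mul, Finset.mul_sum]
    rw [Finset.sum_comm]
    exact Finset.sum_congr rfl fun a _ => Finset.sum_congr rfl fun k _ => by ring
  have e3 : ∀ a b, (-(gi * X) - X.transpose * gi) a b =
      -(∑ k, gi a k * X k b) - ∑ k, X k a * gi k b := by
    intro a b
    simp [Matrix.mul_apply, Matrix.transpose_apply]
  simp only [e3, sub_mul, neg_mul, mul_add, Finset.sum_add_distrib, Finset.sum_sub_distrib,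
    Finset.sum_neg_distrib, e1, e2]
  ring

/-- The target metric is parallel for its connection; differentiated along a map in direction z, it
yields Christoffel terms acting on each argument. It is reindexing only. -/
theorem pullback_compat {ι : Type*} [Fintype ι] (C dg : ι → ι → ι → ℝ) (g : ι → ι → ℝ)
    (hdg : ∀ γ α β, dg γ α β = ∑ k, C γ α k * g k β + ∑ k, C γ β k * g α k) (x y z : ι → ℝ) :
    ∑ α, ∑ β, x α * y β * ∑ γ, z γ * dg γ α β =
      ∑ α, ∑ β, (∑ μ, ∑ ν, z μ * C μ ν α * x ν) * g α β * y β
        + ∑ α, ∑ β, x α * g α β * (∑ μ, ∑ ν, z μ * C μ ν β * y ν) := by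
  have e1 : ∑ α, ∑ β, (∑ μ, ∑ ν, z μ * C μ ν α * x ν) * g α β * y β =
      ∑ α, ∑ β, x α * y β * ∑ γ, z γ * ∑ k, C γ α k * g k β := by
    rw [Finset.sum_comm, Finset.sum_comm (f := fun α β => x α * y β * ∑ γ, z γ * ∑ k, C γ α k * g k β)]
    refine Finset.sum_congr rfl fun β _ => ?_
    simp only [Finset.sum_mul, Finset.mul_sum]
    calc _ = ∑ μ, ∑ α, ∑ ν, z μ * C μ ν α * x ν * g α β * y β := Finset.sum_comm
      _ = ∑ μ, ∑ ν, ∑ α, z μ * C μ ν α * x ν * g α β * y β :=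
        Finset.sum_congr rfl fun μ _ => Finset.sum_comm
      _ = ∑ ν, ∑ μ, ∑ α, z μ * C μ ν α * x ν * g α β * y β := Finset.sum_comm
      _ = _ := Finset.sum_congr rfl fun ν _ => Finset.sum_congr rfl fun μ _ =>
        Finset.sum_congr rfl fun α _ => by ring
  have e2 : ∑ α, ∑ β, x α * g α β * (∑ μ, ∑ ν, z μ * C μ ν β * y ν) =
      ∑ α, ∑ β, x α * y β * ∑ γ, z γ * ∑ k, C γ β k * g α k := by
    refine Finset.sum_congr rfl fun α _ => ?_
    simp only [Finset.mul_sum]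
    calc _ = ∑ μ, ∑ β, ∑ ν, x α * g α β * (z μ * C μ ν β * y ν) := Finset.sum_comm
      _ = ∑ μ, ∑ ν, ∑ β, x α * g α β * (z μ * C μ ν β * y ν) :=
        Finset.sum_congr rfl fun μ _ => Finset.sum_comm
      _ = ∑ ν, ∑ μ, ∑ β, x α * g α β * (z μ * C μ ν β * y ν) := Finset.sum_comm
      _ = _ := Finset.sum_congr rfl fun ν _ => Finset.sum_congr rfl fun μ _ =>
        Finset.sum_congr rfl fun β _ => by ring
  rw [e1, e2]
  simp only [hdg, mul_add, Finset.sum_add_distrib]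

end Algebra

variable {q q' : ℕ}

/-- The Christoffel symbols `Γ^c_{ab}` of a metric `G` with inverse `Gi`. -/
noncomputable def chr (G Gi : Fin q → Fin q → EuclideanSpace ℝ (Fin q) → ℝ) (a b c : Fin q)
    (x : EuclideanSpace ℝ (Fin q)) : ℝ :=
  (1 / 2 : ℝ) * ∑ d, Gi c d x * (pd a (G b d) x + pd b (G a d) x - pd d (G a b) x)

theorem chr_comm {G Gi : Fin q → Fin q → EuclideanSpace ℝ (Fin q) → ℝ}
    {x : EuclideanSpace ℝ (Fin q)} (hG : ∀ a b, G a b =ᶠ[𝓝 x] G b a) (a b c : Fin q) :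
    chr G Gi a b c x = chr G Gi b a c x := by
  unfold chr
  congr 1
  refine Finset.sum_congr rfl fun d _ => ?_
  rw [pd_congr (hG a b)]; ring

/-- Lowering the upper index gives the Christoffel symbols of the first kind; the sum of two of them
telescopes to one derivative of the metric. -/
theorem chr_compat {G Gi : Fin q → Fin q → EuclideanSpace ℝ (Fin q) → ℝ}
    {x : EuclideanSpace ℝ (Fin q)} (hG : ∀ a b, G a b =ᶠ[𝓝 x] G b a)
    (hinv : ∀ a b, ∑ k, Gi k a x * G k b x = if a = b then 1 else 0) (c a b : Fin q) :
    pd c (G a b) x = ∑ k, chr G Gi c a k x * G k b x + ∑ k, chr G Gi c b k x * G a k x := by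
  have key : ∀ c a b : Fin q, ∑ k, chr G Gi c a k x * G k b x =
      (1 / 2 : ℝ) * (pd c (G a b) x + pd a (G c b) x - pd b (G c a) x) := by
    intro c a b
    simp only [chr, mul_assoc, ← Finset.mul_sum, Finset.sum_mul]
    rw [Finset.sum_comm]
    congr 1
    have : ∀ d, ∑ k, Gi k d x * ((pd c (G a d) x + pd a (G c d) x - pd d (G c a) x) * G k b x) =
        (pd c (G a d) x + pd a (G c d) x - pd d (G c a) x) * if d = b then 1 else 0 := by
      intro d
      rw [← hinv, Finset.mul_sum]
      exact Finset.sum_congr rfl fun k _ => by ring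
    simp [this]
  have h2 : ∑ k, chr G Gi c b k x * G a k x = ∑ k, chr G Gi c b k x * G k a x :=
    Finset.sum_congr rfl fun k _ => by rw [(hG a k).eq_of_nhds]
  rw [h2, key, key, pd_congr (hG b a), pd_congr (hG c b), pd_congr (hG c a)]
  ring

end Elliptic

/-! ### Energy, second fundamental form and stress-energy in coordinates -/

namespace Elliptic

variable {q q' : ℕ}

theorem pd_comp_map {q q' : ℕ} {i : Fin q} {h : EuclideanSpace ℝ (Fin q') → ℝ}
    {Φ : EuclideanSpace ℝ (Fin q) → EuclideanSpace ℝ (Fin q')} {x : EuclideanSpace ℝ (Fin q)}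
    (hh : DifferentiableAt ℝ h (Φ x)) (hΦ : DifferentiableAt ℝ Φ x) :
    pd i (fun y => h (Φ y)) x = ∑ γ, pd i (fun y => Φ y γ) x * pd γ h (Φ x) := by
  have h1 : fderiv ℝ (fun y => h (Φ y)) x = (fderiv ℝ h (Φ x)).comp (fderiv ℝ Φ x) :=
    fderiv_comp x hh hΦ
  have h2 : ∀ γ, pd i (fun y => Φ y γ) x = (fderiv ℝ Φ x (EuclideanSpace.single i 1)) γ := by
    intro γ
    have : HasFDerivAt (fun y => Φ y γ)
        ((EuclideanSpace.proj (𝕜 := ℝ) γ).comp (fderiv ℝ Φ x)) x :=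
      (EuclideanSpace.proj (𝕜 := ℝ) γ).hasFDerivAt.comp x hΦ.hasFDerivAt
    simp [pd, this.fderiv]
  simp only [h2, ← fderiv_apply_eq_sum_pd]
  simp [pd, h1]

/-- The pullback `Φ^* G'` of a metric, in coordinates. -/
noncomputable def pullbackForm (Φ : EuclideanSpace ℝ (Fin q) → EuclideanSpace ℝ (Fin q'))
    (G' : Fin q' → Fin q' → EuclideanSpace ℝ (Fin q') → ℝ) (a b : Fin q)
    (z : EuclideanSpace ℝ (Fin q)) : ℝ :=
  ∑ α, ∑ β, pd a (fun y => Φ y α) z * pd b (fun y => Φ y β) z * G' α β (Φ z)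

/-- The squared norm of the differential of `Φ`, in coordinates. -/
noncomputable def energy (Gi : Fin q → Fin q → EuclideanSpace ℝ (Fin q) → ℝ)
    (Φ : EuclideanSpace ℝ (Fin q) → EuclideanSpace ℝ (Fin q'))
    (G' : Fin q' → Fin q' → EuclideanSpace ℝ (Fin q') → ℝ)
    (z : EuclideanSpace ℝ (Fin q)) : ℝ :=
  ∑ a, ∑ b, Gi a b z * pullbackForm Φ G' a b z

/-- The second fundamental form of `Φ`, in coordinates. -/
noncomputable def secondForm (G Gi : Fin q → Fin q → EuclideanSpace ℝ (Fin q) → ℝ)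
    (G' Gi' : Fin q' → Fin q' → EuclideanSpace ℝ (Fin q') → ℝ)
    (Φ : EuclideanSpace ℝ (Fin q) → EuclideanSpace ℝ (Fin q')) (c a : Fin q) (α : Fin q')
    (z : EuclideanSpace ℝ (Fin q)) : ℝ :=
  pd c (pd a (fun y => Φ y α)) z - ∑ k, chr G Gi c a k z * pd k (fun y => Φ y α) z
    + ∑ β, ∑ γ, pd c (fun y => Φ y β) z * chr G' Gi' β γ α (Φ z) * pd a (fun y => Φ y γ) z

section

variable {G Gi : Fin q → Fin q → EuclideanSpace ℝ (Fin q) → ℝ}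
  {G' Gi' : Fin q' → Fin q' → EuclideanSpace ℝ (Fin q') → ℝ}
  {Φ : EuclideanSpace ℝ (Fin q) → EuclideanSpace ℝ (Fin q')} {y : EuclideanSpace ℝ (Fin q)}

theorem contDiffAt_component (hΦ : ContDiffAt ℝ ∞ Φ y) (α : Fin q') :
    ContDiffAt ℝ ∞ (fun z => Φ z α) y :=
  (EuclideanSpace.proj (𝕜 := ℝ) α).contDiff.contDiffAt.comp y hΦ

theorem contDiffAt_pd {u : EuclideanSpace ℝ (Fin q) → ℝ} (hu : ContDiffAt ℝ ∞ u y) (i : Fin q) :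
    ContDiffAt ℝ ∞ (pd i u) y :=
  (hu.fderiv_right (m := ∞) (by simp)).clm_apply contDiffAt_const

theorem differentiableAt_pullbackForm (hΦ : ContDiffAt ℝ ∞ Φ y)
    (hG' : ∀ α β, DifferentiableAt ℝ (G' α β) (Φ y)) (a b : Fin q) :
    DifferentiableAt ℝ (pullbackForm Φ G' a b) y := by
  have h1 := fun (a : Fin q) α =>
    (contDiffAt_pd (contDiffAt_component hΦ α) a).differentiableAt (by simp)
  have h2 : ∀ α β, DifferentiableAt ℝ (fun z => G' α β (Φ z)) y := fun α β =>
    (hG' α β).comp y (hΦ.differentiableAt (by simp))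
  exact DifferentiableAt.fun_sum fun α _ => DifferentiableAt.fun_sum fun β _ =>
    ((h1 a α).fun_mul (h1 b β)).fun_mul (h2 α β)

/-- Both Levi-Civita connections are torsion-free and partial derivatives commute. -/
theorem secondForm_comm (hG : ∀ a b, G a b =ᶠ[𝓝 y] G b a)
    (hG' : ∀ a b, G' a b =ᶠ[𝓝 (Φ y)] G' b a) (hΦ : ContDiffAt ℝ ∞ Φ y) (c a : Fin q)
    (α : Fin q') : secondForm G Gi G' Gi' Φ c a α y = secondForm G Gi G' Gi' Φ a c α y := by
  unfold secondForm
  rw [pd_comm (contDiffAt_component hΦ α)]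
  congr 1
  · congr 1
    exact Finset.sum_congr rfl fun k _ => by rw [chr_comm hG]
  · rw [Finset.sum_comm]
    refine Finset.sum_congr rfl fun β _ => Finset.sum_congr rfl fun γ _ => ?_
    rw [chr_comm hG']; ring

/-- Leibniz rule for ⟨dΦ, dΦ⟩: compatibility of the target connection supplies its Christoffel
terms. The source terms hidden in the second fundamental forms are compensated by the last two sums,
so the inverse relation for the source metric is not needed here. -/
theorem pd_pullbackForm (hΦ : ContDiffAt ℝ ∞ Φ y)
    (hG' : ∀ α β, DifferentiableAt ℝ (G' α β) (Φ y))
    (hGs' : ∀ a b, G' a b =ᶠ[𝓝 (Φ y)] G' b a)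
    (hinv' : ∀ a b, ∑ k, Gi' k a (Φ y) * G' k b (Φ y) = if a = b then 1 else 0) (c a b : Fin q) :
    pd c (pullbackForm Φ G' a b) y =
      (∑ α, ∑ β, secondForm G Gi G' Gi' Φ c a α y * G' α β (Φ y) * pd b (fun z => Φ z β) y
        + ∑ α, ∑ β, pd a (fun z => Φ z α) y * G' α β (Φ y) * secondForm G Gi G' Gi' Φ c b β y)
      + (∑ k, chr G Gi c a k y * pullbackForm Φ G' k b y
        + ∑ k, chr G Gi c b k y * pullbackForm Φ G' a k y) := by
  have h1 := fun (a : Fin q) α =>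
    (contDiffAt_pd (contDiffAt_component hΦ α) a).differentiableAt (by simp)
  have h2 : ∀ α β, DifferentiableAt ℝ (fun z => G' α β (Φ z)) y := fun α β =>
    (hG' α β).comp y (hΦ.differentiableAt (by simp))
  have e1 : pd c (pullbackForm Φ G' a b) y = ∑ α, ∑ β,
      (pd c (pd a (fun z => Φ z α)) y * G' α β (Φ y) * pd b (fun z => Φ z β) y
        + pd a (fun z => Φ z α) y * G' α β (Φ y) * pd c (pd b (fun z => Φ z β)) y)
      + ∑ α, ∑ β, pd a (fun z => Φ z α) y * pd b (fun z => Φ z β) y *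
        ∑ γ, pd c (fun z => Φ z γ) y * pd γ (G' α β) (Φ y) := by
    unfold pullbackForm
    rw [pd_sum _ fun α _ => DifferentiableAt.fun_sum fun β _ => ((h1 a α).fun_mul (h1 b β)).fun_mul (h2 α β),
      ← Finset.sum_add_distrib]
    refine Finset.sum_congr rfl fun α _ => ?_
    rw [pd_sum _ fun β _ => ((h1 a α).fun_mul (h1 b β)).fun_mul (h2 α β), ← Finset.sum_add_distrib]
    refine Finset.sum_congr rfl fun β _ => ?_
    rw [pd_mul ((h1 a α).fun_mul (h1 b β)) (h2 α β), pd_mul (h1 a α) (h1 b β),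
      pd_comp_map (hG' α β) (hΦ.differentiableAt (by simp))]
    ring
  have e2 := pullback_compat (fun γ α k => chr G' Gi' γ α k (Φ y)) (fun γ α β => pd γ (G' α β) (Φ y))
    (fun α β => G' α β (Φ y)) (fun γ α β => chr_compat hGs' hinv' γ α β)
    (fun α => pd a (fun z => Φ z α) y) (fun α => pd b (fun z => Φ z α) y)
    (fun α => pd c (fun z => Φ z α) y)
  have e3 : ∀ a b : Fin q, ∑ k, chr G Gi c a k y * pullbackForm Φ G' k b y = ∑ α, ∑ β,
      (∑ k, chr G Gi c a k y * pd k (fun z => Φ z α) y) * G' α β (Φ y)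
        * pd b (fun z => Φ z β) y := by
    intro a b
    simp only [pullbackForm, Finset.mul_sum, Finset.sum_mul]
    rw [Finset.sum_comm]
    refine Finset.sum_congr rfl fun α _ => ?_
    rw [Finset.sum_comm]
    exact Finset.sum_congr rfl fun β _ => Finset.sum_congr rfl fun k _ => by ring
  have e4 : ∑ k, chr G Gi c b k y * pullbackForm Φ G' a k y = ∑ α, ∑ β,
      pd a (fun z => Φ z α) y * G' α β (Φ y) *
      (∑ k, chr G Gi c b k y * pd k (fun z => Φ z β) y) := by
    simp only [pullbackForm, Finset.mul_sum]
    rw [Finset.sum_comm]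
    refine Finset.sum_congr rfl fun α _ => ?_
    rw [Finset.sum_comm]
    exact Finset.sum_congr rfl fun β _ => Finset.sum_congr rfl fun k _ => by ring
  rw [e1, e2, e3, e4]
  simp only [← Finset.sum_add_distrib, secondForm]
  exact Finset.sum_congr rfl fun α _ => Finset.sum_congr rfl fun β _ => by ring

/-- For a map that satisfies the weighted harmonicity equation and the weighted conservation law,
`|dΦ|² dU = 0`. -/
theorem energy_mul_pd_eq_zero {U : EuclideanSpace ℝ (Fin q) → ℝ}
    (hΦ : ContDiffAt ℝ ∞ Φ y) (hU : DifferentiableAt ℝ U y)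
    (hG : ∀ a b, DifferentiableAt ℝ (G a b) y) (hGi : ∀ a b, DifferentiableAt ℝ (Gi a b) y)
    (hGs : ∀ a b, G a b =ᶠ[𝓝 y] G b a) (hGis : ∀ a b, Gi a b y = Gi b a y)
    (hinv : ∀ a b, (fun z => ∑ k, G a k z * Gi k b z) =ᶠ[𝓝 y] fun _ => if a = b then 1 else 0)
    (hG' : ∀ α β, DifferentiableAt ℝ (G' α β) (Φ y))
    (hGs' : ∀ a b, G' a b =ᶠ[𝓝 (Φ y)] G' b a)
    (hinv' : ∀ a b, ∑ k, Gi' k a (Φ y) * G' k b (Φ y) = if a = b then 1 else 0)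
    (htens : ∀ α, ∑ c, ∑ a, Gi c a y * (pd c (fun z => U z * pd a (fun x => Φ x α) z) y
      - ∑ k, chr G Gi c a k y * (U y * pd k (fun x => Φ x α) y)
      + ∑ β, ∑ γ, pd c (fun x => Φ x β) y * chr G' Gi' β γ α (Φ y)
          * (U y * pd a (fun x => Φ x γ) y)) = 0)
    (hcons : ∀ d, ∑ c, ∑ a, Gi c a y *
      (pd c (fun z => U z * (1 / 2 * energy Gi Φ G' z * G a d z - pullbackForm Φ G' a d z)) y
      - ∑ k, chr G Gi c a k y *
          (U y * (1 / 2 * energy Gi Φ G' y * G k d y - pullbackForm Φ G' k d y))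
      - ∑ k, chr G Gi c d k y *
          (U y * (1 / 2 * energy Gi Φ G' y * G a k y - pullbackForm Φ G' a k y))) = 0)
    (d : Fin q) : energy Gi Φ G' y * pd d U y = 0 := by
  have hmat : (Matrix.of fun a b => G a b y) * (Matrix.of fun a b => Gi a b y) = 1 := by
    ext a b
    simp only [Matrix.mul_apply, Matrix.of_apply, Matrix.one_apply]
    exact (hinv a b).eq_of_nhds
  have hmat' := mul_eq_one_comm.1 hmat
  have hGsy : ∀ a b, G a b y = G b a y := fun a b => (hGs a b).eq_of_nhds
  have hinv2 : ∀ c d, ∑ a, Gi c a y * G a d y = if c = d then 1 else 0 := by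
    intro c d
    have := congrFun (congrFun hmat' c) d
    simpa only [Matrix.mul_apply, Matrix.of_apply, Matrix.one_apply] using this
  have hinv3 : ∀ a b, ∑ k, Gi k a y * G k b y = if a = b then 1 else 0 := by
    intro a b
    rw [← hinv2]
    exact Finset.sum_congr rfl fun k _ => by rw [hGis]
  have hpf := fun a b => differentiableAt_pullbackForm hΦ hG' a b
  have hEn : DifferentiableAt ℝ (energy Gi Φ G') y :=
    DifferentiableAt.fun_sum fun a _ => DifferentiableAt.fun_sum fun b _ => (hGi a b).fun_mul (hpf a b)
  set B := Matrix.toBilin' (Matrix.of fun α β => G' α β (Φ y)) with hBdef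
  have hBapp : ∀ v w : Fin q' → ℝ, B v w = ∑ α, ∑ β, v α * G' α β (Φ y) * w β := by
    intro v w; rw [hBdef, Matrix.toBilin'_apply]; rfl
  have hBs : ∀ v w, B v w = B w v := by
    intro v w
    rw [hBapp, hBapp, Finset.sum_comm]
    refine Finset.sum_congr rfl fun α _ => Finset.sum_congr rfl fun β _ => ?_
    rw [(hGs' β α).eq_of_nhds]; ring
  set A : Fin q → Fin q' → ℝ := fun a α => pd a (fun x => Φ x α) y with hA
  set N : Fin q → Fin q → Fin q' → ℝ := fun c a α => secondForm G Gi G' Gi' Φ c a α y with hN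
  have hpB : ∀ a b, pullbackForm Φ G' a b y = B (A a) (A b) := by
    intro a b
    rw [hBapp]
    exact Finset.sum_congr rfl fun α _ => Finset.sum_congr rfl fun β _ => by ring
  have hdp : ∀ c a b, pd c (pullbackForm Φ G' a b) y = (B (N c a) (A b) + B (A a) (N c b))
      + (∑ k, chr G Gi c a k y * pullbackForm Φ G' k b y
        + ∑ k, chr G Gi c b k y * pullbackForm Φ G' a k y) := by
    intro c a b
    rw [pd_pullbackForm (G := G) (Gi := Gi) hΦ hG' hGs' hinv', hBapp, hBapp]
  have hdg : ∀ c a b, pd c (G a b) y =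
      ∑ k, chr G Gi c a k y * G k b y + ∑ k, chr G Gi c b k y * G a k y :=
    fun c a b => chr_compat hGs hinv3 c a b
  -- After `trace_compat` removes the connection terms, the two contributions ⟨N, A⟩ and ⟨A, N⟩
  -- agree by symmetry, whence the factor 2.
  have hdEn : ∀ c, pd c (energy Gi Φ G') y = 2 * ∑ a, ∑ b, Gi a b y * B (N c a) (A b) := by
    intro c
    have e1 : pd c (energy Gi Φ G') y = ∑ a, ∑ b, (pd c (Gi a b) y * pullbackForm Φ G' a b y
        + Gi a b y * pd c (pullbackForm Φ G' a b) y) := by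
      unfold energy
      rw [pd_sum _ fun a _ => DifferentiableAt.fun_sum fun b _ => (hGi a b).fun_mul (hpf a b)]
      refine Finset.sum_congr rfl fun a _ => ?_
      rw [pd_sum _ fun b _ => (hGi a b).fun_mul (hpf a b)]
      refine Finset.sum_congr rfl fun b _ => ?_
      rw [pd_mul (hGi a b) (hpf a b)]; ring
    have e2 := trace_compat (Matrix.of fun a k => chr G Gi c a k y) (Matrix.of fun a b => G a b y)
      (Matrix.of fun a b => Gi a b y) (Matrix.of fun a b => pd c (G a b) y)
      (Matrix.of fun a b => pd c (Gi a b) y) hmat' hmat (by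
        ext a b
        simp only [Matrix.add_apply, Matrix.mul_apply, Matrix.of_apply, Matrix.transpose_apply]
        rw [hdg]
        congr 1
        exact Finset.sum_congr rfl fun k _ => mul_comm _ _) (by
        ext a b
        simp only [Matrix.add_apply, Matrix.mul_apply, Matrix.of_apply, Matrix.zero_apply]
        have h1 := pd_congr (i := c) (hinv a b)
        rw [pd_const, pd_sum _ fun k _ => (hG a k).fun_mul (hGi k b)] at h1
        rw [← Finset.sum_add_distrib, ← h1]
        refine Finset.sum_congr rfl fun k _ => ?_
        rw [pd_mul (hG a k) (hGi k b)]; ring) fun a b => pullbackForm Φ G' a b y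
    simp only [Matrix.of_apply] at e2
    have e3 : ∑ a, ∑ b, Gi a b y * B (A a) (N c b) = ∑ a, ∑ b, Gi a b y * B (N c a) (A b) := by
      rw [Finset.sum_comm]
      refine Finset.sum_congr rfl fun a _ => Finset.sum_congr rfl fun b _ => ?_
      rw [hBs, hGis]
    rw [e1, two_mul]
    nth_rewrite 2 [← e3]
    rw [← add_zero (_ + _), ← e2]
    simp only [← Finset.sum_add_distrib]
    refine Finset.sum_congr rfl fun a _ => Finset.sum_congr rfl fun b _ => ?_
    rw [hdp, Finset.sum_add_distrib]; ring
  -- In both remaining goals U is separated from its derivative, and the Christoffel terms are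
  -- collected into covariant derivatives.
  refine stressEnergy_identity_aux B hBs (fun a b => G a b y) (fun a b => Gi a b y) hinv2 (U y)
    (energy Gi Φ G' y) (fun c => pd c U y) (fun c => pd c (energy Gi Φ G') y) A N
    (fun c a => funext fun α => secondForm_comm hGs hGs' hΦ c a α) hdEn ?_ ?_ d
  · funext α
    have h1 := htens α
    simp only [Finset.sum_apply, Pi.smul_apply, Pi.add_apply, smul_eq_mul, Pi.zero_apply]
    rw [← h1]
    refine Finset.sum_congr rfl fun c _ => Finset.sum_congr rfl fun a _ => ?_
    congr 1
    rw [pd_mul hU ((contDiffAt_pd (contDiffAt_component hΦ α) a).differentiableAt (by simp))]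
    have s1 : ∑ k, chr G Gi c a k y * (U y * pd k (fun x => Φ x α) y) =
        U y * ∑ k, chr G Gi c a k y * pd k (fun x => Φ x α) y := by
      rw [Finset.mul_sum]; exact Finset.sum_congr rfl fun k _ => by ring
    have s2 : ∑ β, ∑ γ, pd c (fun x => Φ x β) y * chr G' Gi' β γ α (Φ y)
          * (U y * pd a (fun x => Φ x γ) y) =
        U y * ∑ β, ∑ γ, pd c (fun x => Φ x β) y * chr G' Gi' β γ α (Φ y)
          * pd a (fun x => Φ x γ) y := by
      simp only [Finset.mul_sum]
      exact Finset.sum_congr rfl fun β _ => Finset.sum_congr rfl fun γ _ => by ring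
    rw [s1, s2]
    simp only [hN, hA, secondForm]
    ring
  · intro d
    rw [← hcons d]
    refine Finset.sum_congr rfl fun c _ => Finset.sum_congr rfl fun a _ => ?_
    congr 1
    have hS : DifferentiableAt ℝ
        (fun z => 1 / 2 * energy Gi Φ G' z * G a d z - pullbackForm Φ G' a d z) y :=
      ((hEn.const_mul _).fun_mul (hG a d)).fun_sub (hpf a d)
    rw [pd_mul hU hS, pd_sub ((hEn.const_mul _).fun_mul (hG a d)) (hpf a d),
      pd_mul (hEn.const_mul _) (hG a d),
      pd_mul (differentiableAt_const _) hEn, pd_const, hdp, hdg, ← hpB]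
    have s1 : ∑ k, chr G Gi c a k y *
          (U y * (1 / 2 * energy Gi Φ G' y * G k d y - pullbackForm Φ G' k d y)) =
        U y * (1 / 2 * energy Gi Φ G' y * (∑ k, chr G Gi c a k y * G k d y)
          - ∑ k, chr G Gi c a k y * pullbackForm Φ G' k d y) := by
      simp only [Finset.mul_sum, ← Finset.sum_sub_distrib]
      exact Finset.sum_congr rfl fun k _ => by ring
    have s2 : ∑ k, chr G Gi c d k y *
          (U y * (1 / 2 * energy Gi Φ G' y * G a k y - pullbackForm Φ G' a k y)) =
        U y * (1 / 2 * energy Gi Φ G' y * (∑ k, chr G Gi c d k y * G a k y)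
          - ∑ k, chr G Gi c d k y * pullbackForm Φ G' a k y) := by
      simp only [Finset.mul_sum, ← Finset.sum_sub_distrib]
      exact Finset.sum_congr rfl fun k _ => by ring
    rw [s1, s2]
    ring

end

end Elliptic

/-! ### Foliated charts -/

namespace Foliation

open Elliptic

section Charts

variable {p q n : ℕ} {M : Type*} [TopologicalSpace M]
  [ChartedSpace (EuclideanSpace ℝ (Fin n)) M] {F : Foliation p q n M}
  {e : OpenPartialHomeomorph M (FoliatedModel p q)} {x : M}

theorem mdifferentiableAt_chart (he : e ∈ F.atlas) (hx : x ∈ e.source) :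
    MDifferentiableAt (𝓡 n) 𝓘(ℝ, FoliatedModel p q) e x :=
  ((F.smooth e he).contMDiffAt (e.open_source.mem_nhds hx)).mdifferentiableAt (by simp)

theorem mdifferentiableAt_chart_symm (he : e ∈ F.atlas) {y : FoliatedModel p q}
    (hy : y ∈ e.target) : MDifferentiableAt 𝓘(ℝ, FoliatedModel p q) (𝓡 n) e.symm y :=
  ((F.smooth_symm e he).contMDiffAt (e.open_target.mem_nhds hy)).mdifferentiableAt (by simp)

/-- The differential of the inverse of a chart `e`, as a map to `T_xM`. -/
noncomputable def chartInvDeriv (e : OpenPartialHomeomorph M (FoliatedModel p q)) (x : M) :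
    FoliatedModel p q →L[ℝ] TangentSpace (𝓡 n) x :=
  (mfderiv 𝓘(ℝ, FoliatedModel p q) (𝓡 n) (fun z => e.symm z) (e x) :
    FoliatedModel p q →L[ℝ] EuclideanSpace ℝ (Fin n))

theorem coordVec_eq (e : OpenPartialHomeomorph M (FoliatedModel p q)) (a : Fin q) (x : M) :
    (coordVec e a x : TangentSpace (𝓡 n) x) =
      chartInvDeriv e x (0, EuclideanSpace.single a (1 : ℝ)) := rfl

/-- `chartInvDeriv` differentiates at e (e.symm y), which is y only propositionally; the fibres are
all the same model space, so the base point can be replaced. -/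
theorem hasMFDerivAt_chart_symm (he : e ∈ F.atlas) {y : FoliatedModel p q} (hy : y ∈ e.target) :
    HasMFDerivAt 𝓘(ℝ, FoliatedModel p q) (𝓡 n) e.symm y
      (chartInvDeriv (n := n) e (e.symm y)) := by
  have h := (mdifferentiableAt_chart_symm he hy).hasMFDerivAt
  have key : ∀ y' : FoliatedModel p q, y' = y →
      ((mfderiv 𝓘(ℝ, FoliatedModel p q) (𝓡 n) (fun z => e.symm z) y' :
        FoliatedModel p q →L[ℝ] EuclideanSpace ℝ (Fin n))) =
      (mfderiv 𝓘(ℝ, FoliatedModel p q) (𝓡 n) (fun z => e.symm z) y :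
        FoliatedModel p q →L[ℝ] EuclideanSpace ℝ (Fin n)) := by
    rintro y' rfl; rfl
  have h2 : chartInvDeriv (n := n) e (e.symm y) = (mfderiv 𝓘(ℝ, FoliatedModel p q) (𝓡 n)
      (fun z => e.symm z) y : FoliatedModel p q →L[ℝ] EuclideanSpace ℝ (Fin n)) :=
    key _ (e.right_inv hy)
  rw [h2]
  exact h

theorem mvfderiv_comp_chart_symm {V : Type*} [NormedAddCommGroup V] [NormedSpace ℝ V]
    (he : e ∈ F.atlas) {h : M → V} {y : FoliatedModel p q} (hy : y ∈ e.target)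
    (hh : MDifferentiableAt (𝓡 n) 𝓘(ℝ, V) h (e.symm y)) :
    HasFDerivAt (h ∘ e.symm) ((mvfderiv (𝓡 n) h (e.symm y)).comp (chartInvDeriv e (e.symm y))) y :=
  (HasMFDerivAt.comp y hh.hasMFDerivAt (hasMFDerivAt_chart_symm he hy)).hasFDerivAt

theorem mvfderiv_chart_chartInvDeriv (he : e ∈ F.atlas) (hx : x ∈ e.source)
    (w : FoliatedModel p q) : mvfderiv (𝓡 n) e x (chartInvDeriv e x w) = w := by
  obtain ⟨y, hy, rfl⟩ : ∃ y ∈ e.target, e.symm y = x := ⟨e x, e.map_source hx, e.left_inv hx⟩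
  have h1 := mvfderiv_comp_chart_symm he hy (mdifferentiableAt_chart he hx)
  have h2 : HasFDerivAt (e ∘ e.symm) (ContinuousLinearMap.id ℝ (FoliatedModel p q)) y := by
    refine (hasFDerivAt_id y).congr_of_eventuallyEq ?_
    filter_upwards [e.open_target.mem_nhds hy] with z hz using e.right_inv hz
  exact congrArg (fun L => L w) (h1.unique h2)

theorem chartInvDeriv_mvfderiv_chart (he : e ∈ F.atlas) (hx : x ∈ e.source)
    (v : TangentSpace (𝓡 n) x) : chartInvDeriv e x (mvfderiv (𝓡 n) e x v) = v := by
  have hy := e.map_source hx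
  have h0 : HasMFDerivAt 𝓘(ℝ, FoliatedModel p q) (𝓡 n) e.symm (e x)
      (mfderiv 𝓘(ℝ, FoliatedModel p q) (𝓡 n) e.symm (e x)) :=
    (mdifferentiableAt_chart_symm he hy).hasMFDerivAt
  have h1 := HasMFDerivAt.comp x h0 (mdifferentiableAt_chart he hx).hasMFDerivAt
  have h2 : HasMFDerivAt (𝓡 n) (𝓡 n) (e.symm ∘ e) x
      (ContinuousLinearMap.id ℝ (TangentSpace (𝓡 n) x)) := by
    refine (hasMFDerivAt_id x).congr_of_eventuallyEq ?_
    filter_upwards [e.open_source.mem_nhds hx] with z hz using e.left_inv hz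
  exact congrArg (fun L : EuclideanSpace ℝ (Fin n) →L[ℝ] EuclideanSpace ℝ (Fin n) => L v)
    (hasMFDerivAt_unique h1 h2)

/-- The differential of a function, computed in a chart. -/
theorem mvfderiv_eq_fderiv {V : Type*} [NormedAddCommGroup V] [NormedSpace ℝ V]
    (he : e ∈ F.atlas) (hx : x ∈ e.source) {h : M → V}
    (hh : MDifferentiableAt (𝓡 n) 𝓘(ℝ, V) h x) (v : TangentSpace (𝓡 n) x) :
    mvfderiv (𝓡 n) h x v = fderiv ℝ (h ∘ e.symm) (e x) (mvfderiv (𝓡 n) e x v) := by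
  obtain ⟨y, hy, rfl⟩ : ∃ y ∈ e.target, e.symm y = x := ⟨e x, e.map_source hx, e.left_inv hx⟩
  have h1 := mvfderiv_comp_chart_symm he hy hh
  have h2 : fderiv ℝ (h ∘ e.symm) (e (e.symm y)) = fderiv ℝ (h ∘ e.symm) y := by
    rw [e.right_inv hy]
  rw [h2, h1.fderiv]
  change _ = mvfderiv (𝓡 n) h (e.symm y) (chartInvDeriv e (e.symm y) _)
  rw [chartInvDeriv_mvfderiv_chart he hx]

theorem mvfderiv_clm_comp {V W : Type*} [NormedAddCommGroup V] [NormedSpace ℝ V]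
    [NormedAddCommGroup W] [NormedSpace ℝ W] (L : V →L[ℝ] W) {h : M → V}
    (hh : MDifferentiableAt (𝓡 n) 𝓘(ℝ, V) h x) (v : TangentSpace (𝓡 n) x) :
    mvfderiv (𝓡 n) (fun z => L (h z)) x v = L (mvfderiv (𝓡 n) h x v) := by
  have h1 : HasMFDerivAt 𝓘(ℝ, V) 𝓘(ℝ, W) L (h x) L := L.hasMFDerivAt
  have h2 := (HasMFDerivAt.comp x h1 hh.hasMFDerivAt).mfderiv
  exact congrArg (fun A : EuclideanSpace ℝ (Fin n) →L[ℝ] W => A v) h2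

theorem mdifferentiableAt_snd_chart (he : e ∈ F.atlas) (hx : x ∈ e.source) :
    MDifferentiableAt (𝓡 n) 𝓘(ℝ, EuclideanSpace ℝ (Fin q)) (fun z => (e z).2) x :=
  (ContinuousLinearMap.snd ℝ (EuclideanSpace ℝ (Fin p))
    (EuclideanSpace ℝ (Fin q))).mdifferentiableAt.comp x (mdifferentiableAt_chart he hx)

theorem mvfderiv_snd_chart (he : e ∈ F.atlas) (hx : x ∈ e.source) (v : TangentSpace (𝓡 n) x) :
    mvfderiv (𝓡 n) (fun z => (e z).2) x v = (mvfderiv (𝓡 n) e x v).2 :=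
  mvfderiv_clm_comp (n := n) (x := x) (ContinuousLinearMap.snd ℝ (EuclideanSpace ℝ (Fin p))
    (EuclideanSpace ℝ (Fin q))) (h := e) (mdifferentiableAt_chart he hx) v

theorem dy_eq (he : e ∈ F.atlas) (hx : x ∈ e.source) (a : Fin q) (v : TangentSpace (𝓡 n) x) :
    dy e a x v = (mvfderiv (𝓡 n) e x v).2 a := by
  rw [← mvfderiv_snd_chart he hx]
  exact mvfderiv_clm_comp (n := n) (x := x) (EuclideanSpace.proj (𝕜 := ℝ) a)
    (h := fun z => (e z).2) (mdifferentiableAt_snd_chart he hx) v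

theorem dy_coordVec (he : e ∈ F.atlas) (hx : x ∈ e.source) (a b : Fin q) :
    dy (n := n) e b x (coordVec e a x) = if a = b then 1 else 0 := by
  rw [dy_eq he hx, coordVec_eq, mvfderiv_chart_chartInvDeriv he hx]
  simp [eq_comm]

theorem dy_sum_smul {ι : Type*} (s : Finset ι) (c : ι → ℝ) (v : ι → TangentSpace (𝓡 n) x)
    (a : Fin q) : dy e a x (∑ i ∈ s, c i • v i) = ∑ i ∈ s, c i * dy e a x (v i) := by
  change mvfderiv (𝓡 n) (fun z : M => (e z).2 a) x _ = _
  rw [map_sum]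
  exact Finset.sum_congr rfl fun i _ => by rw [map_smul]; rfl

/-- The differential of a map that factors locally through the transversal coordinates vanishes
along the leaves. -/
theorem fderiv_leaf_eq_zero {V : Type*} [NormedAddCommGroup V] [NormedSpace ℝ V]
    {h : FoliatedModel p q → V} {β : EuclideanSpace ℝ (Fin q) → V} {y : FoliatedModel p q}
    (hβ : ∀ᶠ z in 𝓝 y, h z = β z.2) (w : EuclideanSpace ℝ (Fin p)) :
    fderiv ℝ h y (w, 0) = 0 := by
  by_cases hd : DifferentiableAt ℝ h y
  · have h1 := hd.hasFDerivAt.hasLineDerivAt (w, 0)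
    -- No regularity of β is assumed: along a leaf direction h is locally the constant β y.2, so its
    -- line derivative is zero.
    have h2 : HasLineDerivAt ℝ h 0 y (w, 0) := by
      have hc : Continuous fun t : ℝ => y + t • ((w, 0) : FoliatedModel p q) := by fun_prop
      have h3 : ∀ᶠ t in 𝓝 (0 : ℝ), h (y + t • ((w, 0) : FoliatedModel p q)) = β y.2 := by
        have hc0 : Filter.Tendsto (fun t : ℝ => y + t • ((w, 0) : FoliatedModel p q)) (𝓝 0)
            (𝓝 y) := by simpa using hc.tendsto 0
        have := hc0.eventually hβ
        filter_upwards [this] with t ht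
        simpa using ht
      exact (hasDerivAt_const (0 : ℝ) (β y.2)).congr_of_eventuallyEq h3
    exact HasDerivAt.unique h1 h2
  -- At a point of non-differentiability `fderiv` has the default value 0.
  · rw [fderiv_zero_of_not_differentiableAt hd]; rfl

/-- One chart suffices: by `compat` the transversal coordinates of another chart are locally
functions of those of e, so their differentials also vanish on v. -/
theorem mem_tangent_iff (he : e ∈ F.atlas) (hx : x ∈ e.source) (v : TangentSpace (𝓡 n) x) :
    v ∈ F.tangent x ↔ (mvfderiv (𝓡 n) e x v).2 = 0 := by
  constructor
  · intro hv
    have := (Submodule.mem_iInf _).1 ((Submodule.mem_iInf _).1 hv e) ⟨he, hx⟩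
    rw [← mvfderiv_snd_chart he hx]
    exact this
  · intro hv
    refine (Submodule.mem_iInf _).2 fun e' => (Submodule.mem_iInf _).2 fun he' => ?_
    change mvfderiv (𝓡 n) (fun z : M => (e' z).2) x v = 0
    rw [mvfderiv_eq_fderiv he hx (mdifferentiableAt_snd_chart he'.1 he'.2)]
    obtain ⟨β, hβ⟩ := F.compat e he e' he'.1 x ⟨hx, he'.2⟩
    have hw : mvfderiv (𝓡 n) e x v = ((mvfderiv (𝓡 n) e x v).1, 0) := Prod.ext rfl hv
    rw [hw]
    refine fderiv_leaf_eq_zero (β := β) ?_ _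
    have hc : Filter.Tendsto e.symm (𝓝 (e x)) (𝓝 x) := by
      have := e.symm.continuousAt (x := e x) (e.map_source hx)
      rwa [ContinuousAt, e.left_inv hx] at this
    filter_upwards [hc.eventually hβ, e.open_target.mem_nhds (e.map_source hx)] with z hz hzt
    rw [Function.comp_apply, hz, e.right_inv hzt]

theorem dy_eq_zero_of_mem_tangent (he : e ∈ F.atlas) (hx : x ∈ e.source) (a : Fin q)
    {v : TangentSpace (𝓡 n) x} (hv : v ∈ F.tangent x) : dy e a x v = 0 := by
  rw [dy_eq he hx, (mem_tangent_iff he hx v).1 hv]; rfl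

theorem mem_tangent_of_dy_eq_zero (he : e ∈ F.atlas) (hx : x ∈ e.source)
    {v : TangentSpace (𝓡 n) x} (hv : ∀ a, dy e a x v = 0) : v ∈ F.tangent x := by
  rw [mem_tangent_iff he hx]
  ext a
  rw [← dy_eq he hx, hv]; rfl

/-- The differential of a function of the transversal coordinates. -/
theorem mvfderiv_of_eventuallyEq (he : e ∈ F.atlas) (hx : x ∈ e.source) {h : M → ℝ}
    {H : EuclideanSpace ℝ (Fin q) → ℝ} (hH : DifferentiableAt ℝ H (e x).2)
    (hh : ∀ᶠ z in 𝓝 x, h z = H (e z).2) (v : TangentSpace (𝓡 n) x) :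
    mvfderiv (𝓡 n) h x v = ∑ a, dy e a x v * pd a H (e x).2 := by
  have h1 : HasMFDerivAt (𝓡 n) 𝓘(ℝ, ℝ) (fun z => H (e z).2) x
      ((fderiv ℝ H (e x).2).comp (mvfderiv (𝓡 n) (fun z => (e z).2) x)) := by
    exact HasMFDerivAt.comp x hH.hasFDerivAt.hasMFDerivAt
      (mdifferentiableAt_snd_chart he hx).hasMFDerivAt
  have h2 := (h1.congr_of_eventuallyEq hh).mfderiv
  have h3 : mvfderiv (𝓡 n) h x v =
      fderiv ℝ H (e x).2 (mvfderiv (𝓡 n) (fun z => (e z).2) x v) :=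
    congrArg (fun A : EuclideanSpace ℝ (Fin n) →L[ℝ] ℝ => A v) h2
  rw [h3, mvfderiv_snd_chart he hx, fderiv_apply_eq_sum_pd]
  simp only [dy_eq he hx]

/-- A function that is constant along the leaves of a box is a function of the transversal
coordinates. -/
theorem eq_comp_snd_of_tangent (he : e ∈ F.atlas) {c : FoliatedModel p q} {r : ℝ}
    (hr : Metric.ball c r ⊆ e.target) {h : M → ℝ}
    (hh : ∀ z ∈ e.source, e z ∈ Metric.ball c r → MDifferentiableAt (𝓡 n) 𝓘(ℝ, ℝ) h z)
    (h0 : ∀ z ∈ e.source, e z ∈ Metric.ball c r → ∀ v ∈ F.tangent z, mvfderiv (𝓡 n) h z v = 0)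
    {z : M} (hz : z ∈ e.source) (hzr : e z ∈ Metric.ball c r) :
    h z = h (e.symm (c.1, (e z).2)) := by
  set y := (e z).2 with hy
  have hsub : ∀ t ∈ Metric.ball c.1 r, ((t, y) : FoliatedModel p q) ∈ Metric.ball c r := by
    intro t ht
    rw [← ball_prod_same] at hzr ⊢
    exact ⟨ht, hzr.2⟩
  have hd : ∀ t ∈ Metric.ball c.1 r, HasFDerivAt (fun t => h (e.symm (t, y)))
      (0 : EuclideanSpace ℝ (Fin p) →L[ℝ] ℝ) t := by
    intro t ht
    have ht' := hr (hsub t ht)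
    have hs := e.map_target ht'
    have he' : e (e.symm (t, y)) = (t, y) := e.right_inv ht'
    have hm := hh _ hs (by rw [he']; exact hsub t ht)
    have h1 := mvfderiv_comp_chart_symm he ht' hm
    have h2 : HasFDerivAt (fun t : EuclideanSpace ℝ (Fin p) => ((t, y) : FoliatedModel p q))
        (ContinuousLinearMap.inl ℝ _ _) t := hasFDerivAt_prodMk_left t y
    have h3 := h1.comp t h2
    refine h3.congr_fderiv ?_
    ext w
    change mvfderiv (𝓡 n) h (e.symm (t, y)) (chartInvDeriv e (e.symm (t, y)) (w, 0)) = 0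
    refine h0 _ hs (by rw [he']; exact hsub t ht) _ ?_
    rw [mem_tangent_iff he hs, mvfderiv_chart_chartInvDeriv he hs]
  have h1 : (e z).1 ∈ Metric.ball c.1 r := by
    rw [← ball_prod_same] at hzr; exact hzr.1
  have h2 : c.1 ∈ Metric.ball c.1 r := Metric.mem_ball_self (dist_nonneg.trans_lt h1)
  -- Balls of the product are products of balls, so the plaque at transversal coordinate y is a
  -- ball, hence connected, and contains both the point and its projection to c.1.
  have h3 := Metric.isOpen_ball.is_const_of_fderiv_eq_zero
    (convex_ball c.1 r).isPreconnected (fun t ht => (hd t ht).differentiableAt.differentiableWithinAt)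
    (fun t ht => (hd t ht).fderiv) h1 h2
  simp only [hy, Prod.mk.eta, e.left_inv hz] at h3
  exact h3

/-- The leaf coordinate frame of a foliated chart. -/
noncomputable def leafVec (e : OpenPartialHomeomorph M (FoliatedModel p q)) (i : Fin p) (x : M) :
    TangentSpace (𝓡 n) x := chartInvDeriv e x (EuclideanSpace.single i (1 : ℝ), 0)

theorem leafVec_mem (he : e ∈ F.atlas) (hx : x ∈ e.source) (i : Fin p) :
    leafVec e i x ∈ F.tangent x := by
  rw [mem_tangent_iff he hx, leafVec, mvfderiv_chart_chartInvDeriv he hx]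

theorem sum_smul_leafVec (e : OpenPartialHomeomorph M (FoliatedModel p q)) (x : M)
    (w : EuclideanSpace ℝ (Fin p)) :
    ∑ i, w i • (leafVec e i x : TangentSpace (𝓡 n) x) = chartInvDeriv e x (w, 0) := by
  have h : ((w, 0) : FoliatedModel p q) =
      ∑ i, w i • ((EuclideanSpace.single i (1 : ℝ), 0) : FoliatedModel p q) := by
    refine Prod.ext ?_ ?_
    · ext j
      simp [Prod.fst_sum, Finset.sum_apply, Pi.single_apply]
    · simp [Prod.snd_sum]
  rw [h, map_sum]
  exact Finset.sum_congr rfl fun i _ => by rw [map_smul]; rfl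

theorem eq_sum_leafVec (he : e ∈ F.atlas) (hx : x ∈ e.source) {v : TangentSpace (𝓡 n) x}
    (hv : v ∈ F.tangent x) : v = ∑ i, (mvfderiv (𝓡 n) e x v).1 i • leafVec e i x := by
  rw [sum_smul_leafVec]
  have h : mvfderiv (𝓡 n) e x v = ((mvfderiv (𝓡 n) e x v).1, 0) :=
    Prod.ext rfl ((mem_tangent_iff he hx v).1 hv)
  rw [← h, chartInvDeriv_mvfderiv_chart he hx]

theorem mdifferentiableAt_of_comp_chart_symm (he : e ∈ F.atlas)
    (hx : x ∈ e.source) {V : Type*} [NormedAddCommGroup V] [NormedSpace ℝ V] {h : M → V}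
    (hh : DifferentiableAt ℝ (h ∘ e.symm) (e x)) : MDifferentiableAt (𝓡 n) 𝓘(ℝ, V) h x := by
  refine (hh.mdifferentiableAt.comp x (mdifferentiableAt_chart he hx)).congr_of_eventuallyEq ?_
  filter_upwards [e.open_source.mem_nhds hx] with z hz
  simp [e.left_inv hz]

variable [IsManifold (𝓡 n) ∞ M]

/-- Coordinate vector fields are the tangent map of the smooth inverse chart applied to a constant
field. -/
theorem contMDiffAt_chartInvDeriv (he : e ∈ F.atlas) {y : FoliatedModel p q} (hy : y ∈ e.target)
    (w : FoliatedModel p q) :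
    ContMDiffAt 𝓘(ℝ, FoliatedModel p q) (𝓡 n).tangent ∞
      (fun z => (TotalSpace.mk (e.symm z) (chartInvDeriv e (e.symm z) w) :
        TotalSpace (EuclideanSpace ℝ (Fin n)) (fun x : M => TangentSpace (𝓡 n) x))) y := by
  have h1 : ContMDiffAt 𝓘(ℝ, FoliatedModel p q) (𝓘(ℝ, FoliatedModel p q)).tangent ∞
      (fun z : FoliatedModel p q => (⟨z, w⟩ : TangentBundle 𝓘(ℝ, FoliatedModel p q)
        (FoliatedModel p q))) y :=
    contMDiffAt_vectorSpace_iff_contDiffAt.2 contDiffAt_const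
  have h2 := (F.smooth_symm e he).contMDiffOn_tangentMapWithin (m := ∞) (by simp)
    e.open_target.uniqueMDiffOn
  have h3 := (h2 ⟨y, w⟩ hy).contMDiffAt
    (((e.open_target.preimage (FiberBundle.continuous_proj _ _)).mem_nhds hy))
  refine (ContMDiffAt.comp y h3 h1).congr_of_eventuallyEq ?_
  filter_upwards [e.open_target.mem_nhds hy] with z hz
  have h4 : mfderivWithin 𝓘(ℝ, FoliatedModel p q) (𝓡 n) e.symm e.target z =
      chartInvDeriv (n := n) e (e.symm z) := by
    rw [mfderivWithin_of_mem_nhds (e.open_target.mem_nhds hz)]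
    exact (hasMFDerivAt_chart_symm he hz).mfderiv
  simp only [Function.comp_apply, tangentMapWithin, h4]
  rfl

end Charts

end Foliation

/-! ### The transversal metric in a foliated chart -/

namespace Foliation

open Elliptic

theorem contDiffAt_matrix_det {V m : Type*} [NormedAddCommGroup V] [NormedSpace ℝ V] [Fintype m]
    [DecidableEq m] {A : V → Matrix m m ℝ} {y : V}
    (hA : ∀ i j, ContDiffAt ℝ ∞ (fun z => A z i j) y) : ContDiffAt ℝ ∞ (fun z => (A z).det) y := by
  simp only [Matrix.det_apply]
  exact ContDiffAt.sum fun σ _ => (contDiffAt_prod fun i _ => hA (σ i) i).const_smul _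

theorem contDiffAt_matrix_inv {V m : Type*} [NormedAddCommGroup V] [NormedSpace ℝ V] [Fintype m]
    [DecidableEq m] {A : V → Matrix m m ℝ} {y : V}
    (hA : ∀ i j, ContDiffAt ℝ ∞ (fun z => A z i j) y) (hdet : (A y).det ≠ 0) (i j : m) :
    ContDiffAt ℝ ∞ (fun z => (A z)⁻¹ i j) y := by
  simp only [Matrix.inv_def, Ring.inverse_eq_inv', Matrix.smul_apply, smul_eq_mul,
    Matrix.adjugate_apply]
  refine ((contDiffAt_matrix_det hA).inv hdet).mul (contDiffAt_matrix_det fun k l => ?_)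
  by_cases hk : k = j
  · subst hk; simp only [Matrix.updateRow_self]; exact contDiffAt_const
  · simp only [Matrix.updateRow_ne hk]; exact hA k l

theorem sum_inner_stdOrthonormalBasis {V : Type*} [NormedAddCommGroup V] [InnerProductSpace ℝ V]
    (S : Submodule ℝ V) [FiniteDimensional ℝ S] {v : V} (hv : v ∈ S) :
    ∑ i, inner ℝ (stdOrthonormalBasis ℝ S i : V) v • (stdOrthonormalBasis ℝ S i : V) = v := by
  have := congrArg (fun v : S => (v : V)) ((stdOrthonormalBasis ℝ S).sum_repr' ⟨v, hv⟩)
  simpa using this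

section Metric

variable {p q n : ℕ} {M : Type*} [TopologicalSpace M]
  [ChartedSpace (EuclideanSpace ℝ (Fin n)) M]
  [RiemannianBundle (fun x : M => TangentSpace (𝓡 n) x)] {F : Foliation p q n M}
  {e : OpenPartialHomeomorph M (FoliatedModel p q)} {x : M}

theorem normalProj_mem (F : Foliation p q n M) (x : M) (v : TangentSpace (𝓡 n) x) :
    F.normalProj x v ∈ (F.tangent x)ᗮ := Submodule.starProjection_apply_mem _ v

theorem normalProj_of_mem {v : TangentSpace (𝓡 n) x} (hv : v ∈ (F.tangent x)ᗮ) :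
    F.normalProj x v = v := Submodule.starProjection_eq_self_iff.2 hv

theorem sub_normalProj_mem (F : Foliation p q n M) (x : M) (v : TangentSpace (𝓡 n) x) :
    v - F.normalProj x v ∈ F.tangent x := by
  have h := Submodule.sub_starProjection_mem_orthogonal (K := (F.tangent x)ᗮ) v
  rwa [Submodule.orthogonal_orthogonal] at h

theorem normalProj_eq_of_sub_mem {v w : TangentSpace (𝓡 n) x} (hw : w ∈ (F.tangent x)ᗮ)
    (hvw : v - w ∈ F.tangent x) : F.normalProj x v = w := by
  refine Submodule.eq_starProjection_of_mem_orthogonal hw ?_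
  rwa [Submodule.orthogonal_orthogonal]

theorem dy_normalProj (he : e ∈ F.atlas) (hx : x ∈ e.source) (a : Fin q)
    (v : TangentSpace (𝓡 n) x) : dy e a x (F.normalProj x v) = dy e a x v := by
  have h := dy_eq_zero_of_mem_tangent he hx a (sub_normalProj_mem F x v)
  have h2 : dy e a x (v - F.normalProj x v) = dy e a x v - dy e a x (F.normalProj x v) :=
    map_sub (mvfderiv (𝓡 n) (fun z : M => (e z).2 a) x) _ _
  rw [h2] at h
  linarith

theorem dy_frame (he : e ∈ F.atlas) (hx : x ∈ e.source) (a b : Fin q) :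
    dy e b x (F.frame e a x) = if a = b then 1 else 0 := by
  rw [frame, dy_normalProj he hx, dy_coordVec he hx]

theorem frame_mem (F : Foliation p q n M) (e : OpenPartialHomeomorph M (FoliatedModel p q))
    (a : Fin q) (x : M) : F.frame e a x ∈ (F.tangent x)ᗮ := normalProj_mem F x _

/-- The frame is dual to the dy^a and lies in the orthogonal complement; the difference from v is
killed by all dy^a, so it is tangent to the leaf. -/
theorem normalProj_eq_sum (he : e ∈ F.atlas) (hx : x ∈ e.source) (v : TangentSpace (𝓡 n) x) :
    F.normalProj x v = ∑ a, dy e a x v • F.frame e a x := by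
  refine normalProj_eq_of_sub_mem (Submodule.sum_mem _ fun a _ =>
    Submodule.smul_mem _ _ (frame_mem F e a x)) (mem_tangent_of_dy_eq_zero he hx fun b => ?_)
  have h2 : dy e b x (v - ∑ a, dy e a x v • F.frame e a x) =
      dy e b x v - dy e b x (∑ a, dy e a x v • F.frame e a x) :=
    map_sub (mvfderiv (𝓡 n) (fun z : M => (e z).2 b) x) _ _
  rw [h2, dy_sum_smul]
  simp [dy_frame he hx]

theorem eq_sum_frame (he : e ∈ F.atlas) (hx : x ∈ e.source) {v : TangentSpace (𝓡 n) x}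
    (hv : v ∈ (F.tangent x)ᗮ) : v = ∑ a, dy e a x v • F.frame e a x := by
  rw [← normalProj_eq_sum he hx, normalProj_of_mem hv]

theorem metricMatrix_apply (F : Foliation p q n M)
    (e : OpenPartialHomeomorph M (FoliatedModel p q)) (x : M) (a b : Fin q) :
    F.metricMatrix e x a b = inner ℝ (F.frame e a x) (F.frame e b x) := by
  rw [metricMatrix, Matrix.of_apply, gQ, normalProj_of_mem (frame_mem F e a x),
    normalProj_of_mem (frame_mem F e b x)]

theorem metricMatrix_symm (F : Foliation p q n M)
    (e : OpenPartialHomeomorph M (FoliatedModel p q)) (x : M) (a b : Fin q) :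
    F.metricMatrix e x a b = F.metricMatrix e x b a := by
  rw [metricMatrix_apply, metricMatrix_apply, real_inner_comm]

theorem gQ_eq_sum (he : e ∈ F.atlas) (hx : x ∈ e.source) (v w : TangentSpace (𝓡 n) x) :
    F.gQ x v w = ∑ a, ∑ b, dy e a x v * dy e b x w * F.metricMatrix e x a b := by
  rw [gQ, normalProj_eq_sum he hx v, normalProj_eq_sum he hx w, sum_inner]
  refine Finset.sum_congr rfl fun a _ => ?_
  rw [inner_sum]
  refine Finset.sum_congr rfl fun b _ => ?_
  rw [real_inner_smul_left, real_inner_smul_right, metricMatrix_apply]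
  ring

/-- The double sum is the squared length of ∑ ξ_a frame_a, and the dual forms dy^b show that the
frame is independent. -/
theorem dotProduct_metricMatrix_pos (he : e ∈ F.atlas) (hx : x ∈ e.source) {ξ : Fin q → ℝ}
    (hξ : ξ ≠ 0) : 0 < ∑ a, ∑ b, ξ a * ξ b * F.metricMatrix e x a b := by
  have h1 : ∑ a, ∑ b, ξ a * ξ b * F.metricMatrix e x a b =
      inner ℝ (∑ a, ξ a • F.frame e a x) (∑ a, ξ a • F.frame e a x) := by
    rw [sum_inner]
    refine Finset.sum_congr rfl fun a _ => ?_
    rw [inner_sum]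
    refine Finset.sum_congr rfl fun b _ => ?_
    rw [real_inner_smul_left, real_inner_smul_right, metricMatrix_apply]
    ring
  rw [h1]
  refine lt_of_le_of_ne real_inner_self_nonneg fun h0 => hξ ?_
  have hv : ∑ a, ξ a • F.frame e a x = 0 := inner_self_eq_zero.1 h0.symm
  funext b
  have h := congrArg (dy e b x) hv
  have h0 : dy e b x (0 : TangentSpace (𝓡 n) x) = 0 :=
    map_zero (mvfderiv (𝓡 n) (fun z : M => (e z).2 b) x)
  rw [dy_sum_smul, h0] at h
  simpa [dy_frame he hx] using h

theorem posDef_metricMatrix (he : e ∈ F.atlas) (hx : x ∈ e.source) :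
    (F.metricMatrix e x).PosDef := by
  refine Matrix.PosDef.of_dotProduct_mulVec_pos ?_ fun ξ hξ => ?_
  · ext a b
    exact metricMatrix_symm F e x b a
  · refine (dotProduct_metricMatrix_pos he hx hξ).trans_eq ?_
    simp only [dotProduct, Matrix.mulVec, Finset.mul_sum, star_trivial]
    exact Finset.sum_congr rfl fun a _ => Finset.sum_congr rfl fun b _ => by ring

theorem inner_frame (he : e ∈ F.atlas) (hx : x ∈ e.source) {v : TangentSpace (𝓡 n) x}
    (hv : v ∈ (F.tangent x)ᗮ) (b : Fin q) :
    inner ℝ v (F.frame e b x) = ∑ c, F.metricMatrix e x b c * dy e c x v := by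
  have h : inner ℝ v (F.frame e b x) =
      inner ℝ (∑ a, dy e a x v • F.frame e a x) (F.frame e b x) := by
    rw [← eq_sum_frame he hx hv]
  rw [h, sum_inner]
  refine Finset.sum_congr rfl fun c _ => ?_
  rw [real_inner_smul_left, metricMatrix_apply, real_inner_comm, mul_comm]

/-- For a Parseval family E_i of Q, the inverse metric is ∑_i dy(E_i) ⊗ dy(E_i): expand the frame
vectors in the E_i and apply dy. This converts traces over orthonormal bases into contractions with
the inverse matrix. -/
theorem metricMatrix_mul_sum_dy (he : e ∈ F.atlas) (hx : x ∈ e.source) {ι : Type*} [Fintype ι]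
    {E : ι → TangentSpace (𝓡 n) x} (hE : ∀ i, E i ∈ (F.tangent x)ᗮ)
    (hsum : ∀ v ∈ (F.tangent x)ᗮ, ∑ i, (inner ℝ (E i) v : ℝ) • E i = v) :
    F.metricMatrix e x * Matrix.of (fun c a => ∑ i, dy e c x (E i) * dy e a x (E i)) = 1 := by
  ext b a
  have e2 := congrArg (dy e a x) (hsum _ (frame_mem F e b x))
  rw [dy_frame he hx, dy_sum_smul] at e2
  rw [Matrix.one_apply, ← e2, Matrix.mul_apply]
  simp only [Matrix.of_apply, Finset.mul_sum]
  rw [Finset.sum_comm]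
  refine Finset.sum_congr rfl fun i _ => ?_
  rw [inner_frame he hx (hE i), Finset.sum_mul]
  exact Finset.sum_congr rfl fun c _ => by ring

/-- The trace over `Q` in terms of the coordinate frame. -/
theorem trQ_eq_sum (he : e ∈ F.atlas) (hx : x ∈ e.source) {W : Type*} [AddCommGroup W]
    [Module ℝ W] {B : TangentSpace (𝓡 n) x → TangentSpace (𝓡 n) x → W} {b : Fin q → Fin q → W}
    (hB : ∀ v ∈ (F.tangent x)ᗮ, ∀ w ∈ (F.tangent x)ᗮ,
      B v w = ∑ c, ∑ a, (dy e c x v * dy e a x w) • b c a) :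
    F.trQ x B = ∑ c, ∑ a, (F.metricMatrix e x)⁻¹ c a • b c a := by
  have h1 := metricMatrix_mul_sum_dy he hx
    (E := fun i => (stdOrthonormalBasis ℝ (F.tangent x)ᗮ i : TangentSpace (𝓡 n) x))
    (fun i => (stdOrthonormalBasis ℝ (F.tangent x)ᗮ i).2)
    (fun v hv => sum_inner_stdOrthonormalBasis _ hv)
  have h2 : F.trQ x B = ∑ i, ∑ c, ∑ a,
      (dy e c x (stdOrthonormalBasis ℝ (F.tangent x)ᗮ i : TangentSpace (𝓡 n) x) *
        dy e a x (stdOrthonormalBasis ℝ (F.tangent x)ᗮ i : TangentSpace (𝓡 n) x)) • b c a :=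
    Finset.sum_congr rfl fun i _ => hB _ (stdOrthonormalBasis ℝ (F.tangent x)ᗮ i).2 _
      (stdOrthonormalBasis ℝ (F.tangent x)ᗮ i).2
  rw [Matrix.inv_eq_right_inv h1, h2, Finset.sum_comm]
  refine Finset.sum_congr rfl fun c _ => ?_
  rw [Finset.sum_comm]
  refine Finset.sum_congr rfl fun a _ => ?_
  rw [Matrix.of_apply, Finset.sum_smul]

/-! The orthogonal projection in terms of the leaf coordinate frame. -/

/-- The Gram matrix of the leaf coordinate frame. -/
noncomputable def leafGram (e : OpenPartialHomeomorph M (FoliatedModel p q)) (x : M) :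
    Matrix (Fin p) (Fin p) ℝ :=
  Matrix.of fun i j => inner ℝ (leafVec e i x : TangentSpace (𝓡 n) x) (leafVec e j x)

theorem leafGram_det_ne_zero (he : e ∈ F.atlas) (hx : x ∈ e.source) :
    (leafGram (n := n) e x).det ≠ 0 := by
  refine (Matrix.PosDef.of_dotProduct_mulVec_pos (M := leafGram (n := n) e x) ?_
    fun ξ hξ => ?_).det_pos.ne'
  · ext i j
    exact real_inner_comm (leafVec (n := n) e i x) (leafVec (n := n) e j x)
  have h1 : star ξ ⬝ᵥ (leafGram (n := n) e x).mulVec ξ =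
      inner ℝ (∑ i, ξ i • (leafVec e i x : TangentSpace (𝓡 n) x))
        (∑ i, ξ i • (leafVec e i x : TangentSpace (𝓡 n) x)) := by
    rw [sum_inner]
    simp only [dotProduct, Matrix.mulVec, star_trivial]
    refine Finset.sum_congr rfl fun a _ => ?_
    rw [inner_sum, Finset.mul_sum]
    refine Finset.sum_congr rfl fun b _ => ?_
    rw [real_inner_smul_left, real_inner_smul_right, leafGram, Matrix.of_apply]
    ring
  rw [h1]
  refine lt_of_le_of_ne real_inner_self_nonneg fun h0 => hξ ?_
  have hv : ∑ i, ξ i • (leafVec e i x : TangentSpace (𝓡 n) x) = 0 := inner_self_eq_zero.1 h0.symm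
  have h2 := sum_smul_leafVec (n := n) e x (WithLp.toLp 2 ξ)
  have h3 : chartInvDeriv (n := n) e x (WithLp.toLp 2 ξ, 0) = 0 := h2.symm.trans hv
  have h4 := mvfderiv_chart_chartInvDeriv he hx (WithLp.toLp 2 ξ, 0)
  rw [h3, map_zero] at h4
  have h5 := congrArg Prod.fst h4
  funext i
  have := congrArg (fun w : EuclideanSpace ℝ (Fin p) => w i) h5
  simpa using this.symm

/-- The leafwise projection is written with the inverse Gram matrix, so that smooth dependence on
the point becomes visible. -/
theorem normalProj_eq_sub (he : e ∈ F.atlas) (hx : x ∈ e.source) (v : TangentSpace (𝓡 n) x) :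
    F.normalProj x v = v - ∑ j, (∑ i, inner ℝ v (leafVec e i x) *
      (leafGram (n := n) e x)⁻¹ i j) • leafVec e j x := by
  have hinv : (leafGram (n := n) e x)⁻¹ * leafGram (n := n) e x = 1 :=
    Matrix.nonsing_inv_mul _ (leafGram_det_ne_zero he hx).isUnit
  refine normalProj_eq_of_sub_mem ?_ ?_
  · have key : ∀ k, inner ℝ (leafVec e k x) (v - ∑ j, (∑ i, inner ℝ v (leafVec e i x) *
        (leafGram (n := n) e x)⁻¹ i j) • leafVec e j x) = 0 := by
      intro k
      rw [real_inner_comm, inner_sub_left, sum_inner, sub_eq_zero]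
      simp only [real_inner_smul_left, Finset.sum_mul]
      rw [Finset.sum_comm]
      have h1 : ∀ i, ∑ j, inner ℝ v (leafVec e i x) * (leafGram (n := n) e x)⁻¹ i j *
          inner ℝ (leafVec e j x : TangentSpace (𝓡 n) x) (leafVec e k x) =
          inner ℝ v (leafVec e i x) * if i = k then 1 else 0 := by
        intro i
        have h2 := congrFun (congrFun hinv i) k
        rw [Matrix.mul_apply, Matrix.one_apply] at h2
        rw [← h2, Finset.mul_sum]
        exact Finset.sum_congr rfl fun j _ => by rw [leafGram, Matrix.of_apply, mul_assoc]
      rw [Finset.sum_congr rfl fun i _ => h1 i]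
      simp
    refine (Submodule.mem_orthogonal _ _).2 fun u hu => ?_
    rw [eq_sum_leafVec he hx hu, sum_inner]
    exact Finset.sum_eq_zero fun k _ => by rw [real_inner_smul_left, key, mul_zero]
  · rw [sub_sub_cancel]
    exact Submodule.sum_mem _ fun j _ => Submodule.smul_mem _ _ (leafVec_mem he hx j)

theorem metricMatrix_eq_sub (he : e ∈ F.atlas) (hx : x ∈ e.source) (a b : Fin q) :
    F.metricMatrix e x a b = inner ℝ (coordVec e a x : TangentSpace (𝓡 n) x) (coordVec e b x) -
      ∑ j, (∑ i, inner ℝ (coordVec e a x : TangentSpace (𝓡 n) x) (leafVec e i x) *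
        (leafGram (n := n) e x)⁻¹ i j) *
        inner ℝ (leafVec e j x : TangentSpace (𝓡 n) x) (coordVec e b x) := by
  have h1 : inner ℝ (F.frame e a x) (coordVec e b x) =
      inner ℝ (F.frame e a x) (F.frame e b x) := by
    have h2 := sub_normalProj_mem F x (coordVec e b x)
    have h3 := Submodule.inner_left_of_mem_orthogonal h2 (frame_mem F e a x)
    rw [inner_sub_right, sub_eq_zero] at h3
    exact h3
  rw [metricMatrix_apply, ← h1, frame, normalProj_eq_sub he hx, inner_sub_left, sum_inner]
  simp only [real_inner_smul_left]

end Metric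

section Smooth

variable {p q n : ℕ} {M : Type*} [TopologicalSpace M]
  [ChartedSpace (EuclideanSpace ℝ (Fin n)) M] [IsManifold (𝓡 n) ∞ M]
  [RiemannianBundle (fun x : M => TangentSpace (𝓡 n) x)]
  [IsContMDiffRiemannianBundle (𝓡 n) ∞ (EuclideanSpace ℝ (Fin n))
    (fun x : M => TangentSpace (𝓡 n) x)]
  {F : Foliation p q n M} {e : OpenPartialHomeomorph M (FoliatedModel p q)} {x : M}

theorem contDiffAt_inner_chartInvDeriv (he : e ∈ F.atlas) {y : FoliatedModel p q}
    (hy : y ∈ e.target) (w w' : FoliatedModel p q) :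
    ContDiffAt ℝ ∞ (fun z => (inner ℝ (chartInvDeriv (n := n) e (e.symm z) w)
      (chartInvDeriv (n := n) e (e.symm z) w') : ℝ)) y :=
  (ContMDiffAt.inner_bundle (contMDiffAt_chartInvDeriv he hy w)
    (contMDiffAt_chartInvDeriv he hy w')).contDiffAt

/-- By `metricMatrix_eq_sub` the entries are rational expressions in inner products of coordinate
fields, whose only denominator is the nonzero Gram determinant. -/
theorem contDiffAt_metricMatrix (he : e ∈ F.atlas) {y : FoliatedModel p q} (hy : y ∈ e.target)
    (a b : Fin q) : ContDiffAt ℝ ∞ (fun z => F.metricMatrix e (e.symm z) a b) y := by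
  have hK : ∀ i j, ContDiffAt ℝ ∞ (fun z => (leafGram (n := n) e (e.symm z))⁻¹ i j) y :=
    contDiffAt_matrix_inv (A := fun z => leafGram (n := n) e (e.symm z))
      (fun i j => contDiffAt_inner_chartInvDeriv he hy _ _)
      (leafGram_det_ne_zero he (e.map_target hy))
  have h1 : ContDiffAt ℝ ∞ (fun z =>
      (inner ℝ (chartInvDeriv (n := n) e (e.symm z) (0, EuclideanSpace.single a (1 : ℝ)))
        (chartInvDeriv (n := n) e (e.symm z) (0, EuclideanSpace.single b (1 : ℝ))) : ℝ) -
      ∑ j, (∑ i, (inner ℝ (chartInvDeriv (n := n) e (e.symm z)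
          (0, EuclideanSpace.single a (1 : ℝ)))
          (chartInvDeriv (n := n) e (e.symm z) (EuclideanSpace.single i (1 : ℝ), 0)) : ℝ) *
        (leafGram (n := n) e (e.symm z))⁻¹ i j) *
        (inner ℝ (chartInvDeriv (n := n) e (e.symm z) (EuclideanSpace.single j (1 : ℝ), 0))
          (chartInvDeriv (n := n) e (e.symm z) (0, EuclideanSpace.single b (1 : ℝ))) : ℝ)) y :=
    (contDiffAt_inner_chartInvDeriv he hy _ _).sub (ContDiffAt.sum fun j _ =>
      (ContDiffAt.sum fun i _ => (contDiffAt_inner_chartInvDeriv he hy _ _).mul (hK i j)).mul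
        (contDiffAt_inner_chartInvDeriv he hy _ _))
  refine h1.congr_of_eventuallyEq ?_
  filter_upwards [e.open_target.mem_nhds hy] with z hz
  exact metricMatrix_eq_sub he (e.map_target hz) a b

end Smooth

end Foliation

/-! ### Objects of a foliated manifold as functions of the transversal coordinates -/

namespace Foliation

open Elliptic

section Box

variable {p q n : ℕ} {M : Type*} [TopologicalSpace M]
  [ChartedSpace (EuclideanSpace ℝ (Fin n)) M] {F : Foliation p q n M}
  {e : OpenPartialHomeomorph M (FoliatedModel p q)} {c : FoliatedModel p q} {r : ℝ} {x : M}

/-- The box of `M` given by a ball of a foliated chart. -/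
def box (e : OpenPartialHomeomorph M (FoliatedModel p q)) (c : FoliatedModel p q) (r : ℝ) : Set M :=
  e.source ∩ e ⁻¹' Metric.ball c r

theorem isOpen_box (e : OpenPartialHomeomorph M (FoliatedModel p q)) (c : FoliatedModel p q)
    (r : ℝ) : IsOpen (box e c r) := e.isOpen_inter_preimage Metric.isOpen_ball

theorem snd_mem_ball (hx : x ∈ box e c r) : (e x).2 ∈ Metric.ball c.2 r := by
  have h := hx.2
  rw [Set.mem_preimage, ← ball_prod_same] at h
  exact h.2

theorem mk_mem_ball {y : EuclideanSpace ℝ (Fin q)} (hy : y ∈ Metric.ball c.2 r) :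
    ((c.1, y) : FoliatedModel p q) ∈ Metric.ball c r := by
  rw [← ball_prod_same]
  exact ⟨Metric.mem_ball_self (dist_nonneg.trans_lt hy), hy⟩

/-- The transversal of the box through its centre. -/
def slice (e : OpenPartialHomeomorph M (FoliatedModel p q)) (c : FoliatedModel p q)
    (y : EuclideanSpace ℝ (Fin q)) : M := e.symm (c.1, y)

theorem slice_mem_box (hr : Metric.ball c r ⊆ e.target) {y : EuclideanSpace ℝ (Fin q)}
    (hy : y ∈ Metric.ball c.2 r) : slice e c y ∈ box e c r := by
  have h := mk_mem_ball hy
  refine ⟨e.map_target (hr h), ?_⟩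
  rw [Set.mem_preimage, slice, e.right_inv (hr h)]
  exact h

theorem snd_chart_slice (hr : Metric.ball c r ⊆ e.target) {y : EuclideanSpace ℝ (Fin q)}
    (hy : y ∈ Metric.ball c.2 r) : (e (slice e c y)).2 = y := by
  rw [slice, e.right_inv (hr (mk_mem_ball hy))]

theorem contDiffAt_comp_slice {V : Type*} [NormedAddCommGroup V] [NormedSpace ℝ V]
    {h : M → V} {y : EuclideanSpace ℝ (Fin q)} (hh : ContDiffAt ℝ ∞ (h ∘ e.symm) (c.1, y)) :
    ContDiffAt ℝ ∞ (fun y => h (slice e c y)) y :=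
  ContDiffAt.comp (g := h ∘ e.symm) (f := fun y => (c.1, y)) y hh
    (contDiffAt_const.prodMk contDiffAt_id)

theorem contDiffAt_comp_chart_symm (he : e ∈ F.atlas) {V : Type*} [NormedAddCommGroup V]
    [NormedSpace ℝ V] {h : M → V} {y : FoliatedModel p q} (hy : y ∈ e.target)
    (hh : ContMDiffAt (𝓡 n) 𝓘(ℝ, V) ∞ h (e.symm y)) : ContDiffAt ℝ ∞ (h ∘ e.symm) y :=
  (ContMDiffAt.comp y hh ((F.smooth_symm e he).contMDiffAt (e.open_target.mem_nhds hy))).contDiffAt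

/-- A function with vanishing derivatives along the leaves depends on the transversal coordinates
only. -/
theorem eq_slice (he : e ∈ F.atlas) (hr : Metric.ball c r ⊆ e.target) {h : M → ℝ}
    (hh : ∀ z ∈ box e c r, MDifferentiableAt (𝓡 n) 𝓘(ℝ, ℝ) h z)
    (h0 : ∀ z ∈ box e c r, ∀ v ∈ F.tangent z, mvfderiv (𝓡 n) h z v = 0) {z : M}
    (hz : z ∈ box e c r) : h z = h (slice e c (e z).2) :=
  eq_comp_snd_of_tangent he hr (fun z h1 h2 => hh z ⟨h1, h2⟩) (fun z h1 h2 => h0 z ⟨h1, h2⟩)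
    hz.1 hz.2

end Box

section Metric

variable {p q n : ℕ} {M : Type*} [TopologicalSpace M]
  [ChartedSpace (EuclideanSpace ℝ (Fin n)) M]
  [RiemannianBundle (fun x : M => TangentSpace (𝓡 n) x)]
  {F : Foliation p q n M} {e : OpenPartialHomeomorph M (FoliatedModel p q)}
  {c : FoliatedModel p q} {r : ℝ} {x : M}

/-- The frame vector differs from ∂/∂y^a by a leaf vector, which does not see functions of the
transversal coordinates. -/
theorem mvfderiv_frame (he : e ∈ F.atlas) (hx : x ∈ box e c r) {h : M → ℝ}
    {H : EuclideanSpace ℝ (Fin q) → ℝ} (hH : DifferentiableAt ℝ H (e x).2)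
    (hh : ∀ z ∈ box e c r, h z = H (e z).2) (a : Fin q) :
    mvfderiv (𝓡 n) h x (F.frame e a x) = pd a H (e x).2 := by
  rw [mvfderiv_of_eventuallyEq he hx.1 hH
    (Filter.eventually_of_mem ((isOpen_box e c r).mem_nhds hx) hh)]
  simp [dy_frame he hx.1]

/-- The transversal metric as a function of the transversal coordinates. -/
noncomputable def tmet (F : Foliation p q n M) (e : OpenPartialHomeomorph M (FoliatedModel p q))
    (c : FoliatedModel p q) (a b : Fin q) (y : EuclideanSpace ℝ (Fin q)) : ℝ :=
  F.metricMatrix e (slice e c y) a b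

/-- The inverse of the transversal metric as a function of the transversal coordinates. -/
noncomputable def tinv (F : Foliation p q n M) (e : OpenPartialHomeomorph M (FoliatedModel p q))
    (c : FoliatedModel p q) (a b : Fin q) (y : EuclideanSpace ℝ (Fin q)) : ℝ :=
  (F.metricMatrix e (slice e c y))⁻¹ a b

theorem tmet_symm (a b : Fin q) (y : EuclideanSpace ℝ (Fin q)) :
    tmet F e c a b y = tmet F e c b a y := metricMatrix_symm F e _ a b

theorem tinv_symm (a b : Fin q) (y : EuclideanSpace ℝ (Fin q)) :
    tinv F e c a b y = tinv F e c b a y := by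
  have h : (F.metricMatrix e (slice e c y)).transpose = F.metricMatrix e (slice e c y) := by
    ext i j; exact metricMatrix_symm F e _ j i
  rw [tinv, tinv, ← Matrix.transpose_apply (F.metricMatrix e (slice e c y))⁻¹,
    Matrix.transpose_nonsing_inv, h]

theorem tmet_mul_tinv (he : e ∈ F.atlas) (hr : Metric.ball c r ⊆ e.target)
    {y : EuclideanSpace ℝ (Fin q)} (hy : y ∈ Metric.ball c.2 r) (a b : Fin q) :
    ∑ k, tmet F e c a k y * tinv F e c k b y = if a = b then 1 else 0 := by
  have h := Matrix.mul_nonsing_inv (F.metricMatrix e (slice e c y))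
    (posDef_metricMatrix he (slice_mem_box hr hy).1).det_pos.ne'.isUnit
  have h2 := congrFun (congrFun h a) b
  rwa [Matrix.mul_apply, Matrix.one_apply] at h2

theorem tinv_mul_tmet (he : e ∈ F.atlas) (hr : Metric.ball c r ⊆ e.target)
    {y : EuclideanSpace ℝ (Fin q)} (hy : y ∈ Metric.ball c.2 r) (a b : Fin q) :
    ∑ k, tinv F e c k a y * tmet F e c k b y = if a = b then 1 else 0 := by
  have h := Matrix.nonsing_inv_mul (F.metricMatrix e (slice e c y))
    (posDef_metricMatrix he (slice_mem_box hr hy).1).det_pos.ne'.isUnit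
  have h2 := congrFun (congrFun h a) b
  rw [Matrix.mul_apply, Matrix.one_apply] at h2
  rw [← h2]
  exact Finset.sum_congr rfl fun k _ => by rw [tinv_symm]; rfl

theorem tinv_pos (he : e ∈ F.atlas) (hr : Metric.ball c r ⊆ e.target)
    {y : EuclideanSpace ℝ (Fin q)} (hy : y ∈ Metric.ball c.2 r) {ξ : Fin q → ℝ} (hξ : ξ ≠ 0) :
    0 < ∑ a, ∑ b, tinv F e c a b y * (ξ a * ξ b) := by
  have h := (posDef_metricMatrix he (slice_mem_box hr hy).1).inv.dotProduct_mulVec_pos hξ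
  refine h.trans_eq ?_
  simp only [dotProduct, Matrix.mulVec, Finset.mul_sum, star_trivial, tinv]
  exact Finset.sum_congr rfl fun a _ => Finset.sum_congr rfl fun b _ => by ring

variable [IsManifold (𝓡 n) ∞ M] [IsContMDiffRiemannianBundle (𝓡 n) ∞ (EuclideanSpace ℝ (Fin n))
    (fun x : M => TangentSpace (𝓡 n) x)]

theorem contDiffAt_tmet (he : e ∈ F.atlas) (hr : Metric.ball c r ⊆ e.target)
    {y : EuclideanSpace ℝ (Fin q)} (hy : y ∈ Metric.ball c.2 r) (a b : Fin q) :
    ContDiffAt ℝ ∞ (tmet F e c a b) y :=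
  contDiffAt_comp_slice (h := fun z => F.metricMatrix e z a b)
    (contDiffAt_metricMatrix he (hr (mk_mem_ball hy)) a b)

theorem contDiffAt_tinv (he : e ∈ F.atlas) (hr : Metric.ball c r ⊆ e.target)
    {y : EuclideanSpace ℝ (Fin q)} (hy : y ∈ Metric.ball c.2 r) (a b : Fin q) :
    ContDiffAt ℝ ∞ (tinv F e c a b) y :=
  contDiffAt_matrix_inv (fun i j => contDiffAt_tmet he hr hy i j)
    (posDef_metricMatrix he (slice_mem_box hr hy).1).det_pos.ne' a b

/-- This is where the bundle-like condition enters: the matrix entries are constant along plaques,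
so they can be read off on the transversal through the centre. -/
theorem metricMatrix_eq_tmet (hF : F.IsBundleLike) (he : e ∈ F.atlas)
    (hr : Metric.ball c r ⊆ e.target) (hx : x ∈ box e c r) (a b : Fin q) :
    F.metricMatrix e x a b = tmet F e c a b (e x).2 := by
  refine eq_slice (h := fun z => F.metricMatrix e z a b) he hr (fun z hz => ?_)
    (fun z hz v hv => hF e he z hz.1 v hv a b) hx
  exact mdifferentiableAt_of_comp_chart_symm he hz.1
    ((contDiffAt_metricMatrix he (e.map_source hz.1) a b).differentiableAt (by simp))

theorem metricMatrix_inv_eq_tinv (hF : F.IsBundleLike) (he : e ∈ F.atlas)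
    (hr : Metric.ball c r ⊆ e.target) (hx : x ∈ box e c r) (a b : Fin q) :
    (F.metricMatrix e x)⁻¹ a b = tinv F e c a b (e x).2 := by
  have h : F.metricMatrix e x = F.metricMatrix e (slice e c (e x).2) := by
    ext a b; exact metricMatrix_eq_tmet hF he hr hx a b
  rw [h, tinv]

theorem mvfderiv_metricMatrix_frame (hF : F.IsBundleLike) (he : e ∈ F.atlas)
    (hr : Metric.ball c r ⊆ e.target) (hx : x ∈ box e c r) (a b d : Fin q) :
    mvfderiv (𝓡 n) (fun z => F.metricMatrix e z a b) x (F.frame e d x) =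
      pd d (tmet F e c a b) (e x).2 :=
  mvfderiv_frame he hx
    ((contDiffAt_tmet he hr (snd_mem_ball hx) a b).differentiableAt (by simp))
    (fun z hz => metricMatrix_eq_tmet hF he hr hz a b) d

theorem christoffel_eq_chr (hF : F.IsBundleLike) (he : e ∈ F.atlas)
    (hr : Metric.ball c r ⊆ e.target) (hx : x ∈ box e c r) (a b d : Fin q) :
    F.christoffel e x a b d = chr (tmet F e c) (tinv F e c) a b d (e x).2 := by
  simp only [christoffel, chr, mvfderiv_metricMatrix_frame hF he hr hx,
    metricMatrix_inv_eq_tinv hF he hr hx]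

end Metric

end Foliation

/-! ### Foliated maps in transversal coordinates -/

namespace Foliation

open Elliptic

theorem sum_mul_sum_mul {ι κ : Type*} [Fintype ι] [Fintype κ] (v w : ι → ℝ) (P : ι → κ → ℝ)
    (g : κ → κ → ℝ) :
    ∑ α, ∑ β, (∑ a, v a * P a α) * (∑ b, w b * P b β) * g α β =
      ∑ a, ∑ b, v a * w b * ∑ α, ∑ β, P a α * P b β * g α β := by
  simp only [Finset.sum_mul_sum]
  simp only [Finset.sum_mul, Finset.mul_sum]
  rw [Finset.sum_congr rfl fun α _ => Finset.sum_comm, Finset.sum_comm]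
  refine Finset.sum_congr rfl fun a _ => ?_
  rw [Finset.sum_congr rfl fun α _ => Finset.sum_comm, Finset.sum_comm]
  exact Finset.sum_congr rfl fun b _ => Finset.sum_congr rfl fun α _ =>
    Finset.sum_congr rfl fun β _ => by ring

section Maps

variable {p q n p' q' n' : ℕ}
  {M : Type*} [TopologicalSpace M] [ChartedSpace (EuclideanSpace ℝ (Fin n)) M]
  {M' : Type*} [TopologicalSpace M'] [ChartedSpace (EuclideanSpace ℝ (Fin n')) M']
  {F : Foliation p q n M} {F' : Foliation p' q' n' M'}
  {e : OpenPartialHomeomorph M (FoliatedModel p q)} {c : FoliatedModel p q} {r : ℝ}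
  {e' : OpenPartialHomeomorph M' (FoliatedModel p' q')} {c' : FoliatedModel p' q'} {r' : ℝ}
  {φ : M → M'} {x : M}

/-- A map in transversal coordinates. -/
def tmap (e : OpenPartialHomeomorph M (FoliatedModel p q)) (c : FoliatedModel p q)
    (e' : OpenPartialHomeomorph M' (FoliatedModel p' q')) (φ : M → M')
    (y : EuclideanSpace ℝ (Fin q)) : EuclideanSpace ℝ (Fin q') :=
  (e' (φ (slice e c y))).2

theorem contMDiffAt_snd_chart_comp (he' : e' ∈ F'.atlas) (hφ : F.IsFoliatedMap F' φ)
    (hx : φ x ∈ e'.source) :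
    ContMDiffAt (𝓡 n) 𝓘(ℝ, EuclideanSpace ℝ (Fin q')) ∞ (fun z => (e' (φ z)).2) x := by
  have h1 : ContMDiffAt (𝓡 n') 𝓘(ℝ, EuclideanSpace ℝ (Fin q')) ∞ (fun z => (e' z).2) (φ x) :=
    ((ContinuousLinearMap.snd ℝ (EuclideanSpace ℝ (Fin p'))
      (EuclideanSpace ℝ (Fin q'))).contMDiff.contMDiffAt).comp (φ x)
      ((F'.smooth e' he').contMDiffAt (e'.open_source.mem_nhds hx))
  exact h1.comp x hφ.1.contMDiffAt

theorem dy_mfderiv (he' : e' ∈ F'.atlas) (hφ : F.IsFoliatedMap F' φ)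
    (hx : φ x ∈ e'.source) (β : Fin q') (v : TangentSpace (𝓡 n) x) :
    dy e' β (φ x) (mfderiv (𝓡 n) (𝓡 n') φ x v) =
      mvfderiv (𝓡 n) (fun z => (e' (φ z)).2 β) x v := by
  have h0 : MDifferentiableAt (𝓡 n') 𝓘(ℝ, ℝ) (fun z => (e' z).2 β) (φ x) :=
    (EuclideanSpace.proj (𝕜 := ℝ) β).mdifferentiableAt.comp (φ x)
      (mdifferentiableAt_snd_chart he' hx)
  have h1 := (HasMFDerivAt.comp x h0.hasMFDerivAt
    (hφ.1.mdifferentiableAt (x := x) (by simp)).hasMFDerivAt).mfderiv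
  exact (congrArg (fun A : EuclideanSpace ℝ (Fin n) →L[ℝ] ℝ => A v) h1).symm

theorem contDiffAt_tmap (he : e ∈ F.atlas) (hr : Metric.ball c r ⊆ e.target)
    (he' : e' ∈ F'.atlas) (hφ : F.IsFoliatedMap F' φ)
    (hmap : Set.MapsTo φ (box e c r) (box e' c' r')) {y : EuclideanSpace ℝ (Fin q)}
    (hy : y ∈ Metric.ball c.2 r) : ContDiffAt ℝ ∞ (tmap e c e' φ) y :=
  contDiffAt_comp_slice (contDiffAt_comp_chart_symm he (hr (mk_mem_ball hy))
    (contMDiffAt_snd_chart_comp he' hφ (hmap (slice_mem_box hr hy)).1))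

/-- As dφ sends leaf vectors to leaf vectors, the transversal components of φ have zero leafwise
derivative and descend to the local leaf space. -/
theorem snd_chart_apply_eq_tmap (he : e ∈ F.atlas) (hr : Metric.ball c r ⊆ e.target)
    (he' : e' ∈ F'.atlas) (hφ : F.IsFoliatedMap F' φ)
    (hmap : Set.MapsTo φ (box e c r) (box e' c' r')) (hx : x ∈ box e c r) (α : Fin q') :
    (e' (φ x)).2 α = tmap e c e' φ (e x).2 α := by
  refine eq_slice (h := fun z => (e' (φ z)).2 α) he hr (fun z hz => ?_) (fun z hz v hv => ?_) hx
  · exact (EuclideanSpace.proj (𝕜 := ℝ) α).mdifferentiableAt.comp z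
      ((contMDiffAt_snd_chart_comp he' hφ (hmap hz).1).mdifferentiableAt (by simp))
  · rw [← dy_mfderiv he' hφ (hmap hz).1]
    exact dy_eq_zero_of_mem_tangent he' (hmap hz).1 α (hφ.2 z v hv)

theorem dy_mfderiv_eq_sum (he : e ∈ F.atlas) (hr : Metric.ball c r ⊆ e.target)
    (he' : e' ∈ F'.atlas) (hφ : F.IsFoliatedMap F' φ)
    (hmap : Set.MapsTo φ (box e c r) (box e' c' r')) (hx : x ∈ box e c r) (α : Fin q')
    (v : TangentSpace (𝓡 n) x) :
    dy e' α (φ x) (mfderiv (𝓡 n) (𝓡 n') φ x v) =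
      ∑ a, dy e a x v * pd a (fun y => tmap e c e' φ y α) (e x).2 := by
  rw [dy_mfderiv he' hφ (hmap hx).1]
  refine mvfderiv_of_eventuallyEq he hx.1 ?_ ?_ v
  · exact (contDiffAt_component
      (contDiffAt_tmap he hr he' hφ hmap (snd_mem_ball hx)) α).differentiableAt (by simp)
  · exact Filter.eventually_of_mem ((isOpen_box e c r).mem_nhds hx)
      fun z hz => snd_chart_apply_eq_tmap he hr he' hφ hmap hz α

theorem basic_eq_slice {f : M → ℝ} (hf : F.IsBasic f) (he : e ∈ F.atlas)
    (hr : Metric.ball c r ⊆ e.target) (hx : x ∈ box e c r) : f x = f (slice e c (e x).2) :=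
  eq_slice he hr (fun z _ => hf.1.mdifferentiableAt (by simp)) (fun z _ v hv => hf.2 z v hv) hx

theorem contDiffAt_basic_slice {f : M → ℝ} (hf : F.IsBasic f) (he : e ∈ F.atlas)
    (hr : Metric.ball c r ⊆ e.target) {y : EuclideanSpace ℝ (Fin q)}
    (hy : y ∈ Metric.ball c.2 r) : ContDiffAt ℝ ∞ (fun y => f (slice e c y)) y :=
  contDiffAt_comp_slice (contDiffAt_comp_chart_symm he (hr (mk_mem_ball hy)) hf.1.contMDiffAt)

variable [RiemannianBundle (fun x : M => TangentSpace (𝓡 n) x)]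
  [RiemannianBundle (fun x : M' => TangentSpace (𝓡 n') x)]

theorem dT_apply (φ : M → M') (x : M) (v : TangentSpace (𝓡 n) x) :
    F.dT F' φ x v = F'.normalProj (φ x) (mfderiv (𝓡 n) (𝓡 n') φ x (F.normalProj x v)) := rfl

theorem dT_mem (φ : M → M') (x : M) (v : TangentSpace (𝓡 n) x) :
    F.dT F' φ x v ∈ (F'.tangent (φ x))ᗮ := normalProj_mem F' _ _

/-- Neither projection in d_Tφ affects the result: the forms dy vanish on leaf vectors, on both
sides. -/
theorem dy_dT (he : e ∈ F.atlas) (hr : Metric.ball c r ⊆ e.target)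
    (he' : e' ∈ F'.atlas) (hφ : F.IsFoliatedMap F' φ)
    (hmap : Set.MapsTo φ (box e c r) (box e' c' r')) (hx : x ∈ box e c r) (α : Fin q')
    (v : TangentSpace (𝓡 n) x) :
    dy e' α (φ x) (F.dT F' φ x v) =
      ∑ a, dy e a x v * pd a (fun y => tmap e c e' φ y α) (e x).2 := by
  rw [dT_apply, dy_normalProj he' (hmap hx).1, dy_mfderiv_eq_sum he hr he' hφ hmap hx]
  simp only [dy_normalProj he hx.1]

theorem dy_dT_frame (he : e ∈ F.atlas) (hr : Metric.ball c r ⊆ e.target)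
    (he' : e' ∈ F'.atlas) (hφ : F.IsFoliatedMap F' φ)
    (hmap : Set.MapsTo φ (box e c r) (box e' c' r')) (hx : x ∈ box e c r) (α : Fin q')
    (a : Fin q) :
    dy e' α (φ x) (F.dT F' φ x (F.frame e a x)) = pd a (fun y => tmap e c e' φ y α) (e x).2 := by
  rw [dy_dT he hr he' hφ hmap hx]
  simp [dy_frame he hx.1]

/-- The criterion involves only the transversal coordinate of x. Thus vanishing at one point of a
plaque gives vanishing along the plaque, and the question moves to ℝ^q. -/
theorem dT_eq_zero_iff (he : e ∈ F.atlas) (hr : Metric.ball c r ⊆ e.target)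
    (he' : e' ∈ F'.atlas) (hφ : F.IsFoliatedMap F' φ)
    (hmap : Set.MapsTo φ (box e c r) (box e' c' r')) (hx : x ∈ box e c r) :
    F.dT F' φ x = 0 ↔ ∀ α a, pd a (fun y => tmap e c e' φ y α) (e x).2 = 0 := by
  constructor
  · intro h α a
    rw [← dy_dT_frame he hr he' hφ hmap hx, h]
    exact map_zero (mvfderiv (𝓡 n') (fun z : M' => (e' z).2 α) (φ x))
  · intro h
    ext v
    rw [eq_sum_frame he' (hmap hx).1 (dT_mem (F := F) φ x v)]
    simp [dy_dT he hr he' hφ hmap hx, h]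

variable [IsManifold (𝓡 n') ∞ M'] [IsContMDiffRiemannianBundle (𝓡 n') ∞ (EuclideanSpace ℝ (Fin n'))
    (fun x : M' => TangentSpace (𝓡 n') x)]

theorem gQ_dT (he : e ∈ F.atlas) (hr : Metric.ball c r ⊆ e.target) (hF' : F'.IsBundleLike)
    (he' : e' ∈ F'.atlas) (hr' : Metric.ball c' r' ⊆ e'.target) (hφ : F.IsFoliatedMap F' φ)
    (hmap : Set.MapsTo φ (box e c r) (box e' c' r')) (hx : x ∈ box e c r)
    (v w : TangentSpace (𝓡 n) x) :
    F'.gQ (φ x) (F.dT F' φ x v) (F.dT F' φ x w) = ∑ a, ∑ b, dy e a x v * dy e b x w *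
      pullbackForm (tmap e c e' φ) (tmet F' e' c') a b (e x).2 := by
  have hs : (e' (φ x)).2 = tmap e c e' φ (e x).2 := by
    ext α; exact snd_chart_apply_eq_tmap he hr he' hφ hmap hx α
  rw [gQ_eq_sum he' (hmap hx).1]
  simp only [dy_dT he hr he' hφ hmap hx, metricMatrix_eq_tmet hF' he' hr' (hmap hx), hs,
    pullbackForm]
  exact sum_mul_sum_mul _ _ (fun a α => pd a (fun y => tmap e c e' φ y α) (e x).2) _

theorem gQ_dT_frame (he : e ∈ F.atlas) (hr : Metric.ball c r ⊆ e.target) (hF' : F'.IsBundleLike)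
    (he' : e' ∈ F'.atlas) (hr' : Metric.ball c' r' ⊆ e'.target) (hφ : F.IsFoliatedMap F' φ)
    (hmap : Set.MapsTo φ (box e c r) (box e' c' r')) (hx : x ∈ box e c r) (a b : Fin q) :
    F'.gQ (φ x) (F.dT F' φ x (F.frame e a x)) (F.dT F' φ x (F.frame e b x)) =
      pullbackForm (tmap e c e' φ) (tmet F' e' c') a b (e x).2 := by
  rw [gQ_dT he hr hF' he' hr' hφ hmap hx]
  simp [dy_frame he hx.1]

variable [IsManifold (𝓡 n) ∞ M] [IsContMDiffRiemannianBundle (𝓡 n) ∞ (EuclideanSpace ℝ (Fin n))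
    (fun x : M => TangentSpace (𝓡 n) x)]

theorem normSqDT_eq_energy (hF : F.IsBundleLike) (he : e ∈ F.atlas)
    (hr : Metric.ball c r ⊆ e.target) (hF' : F'.IsBundleLike)
    (he' : e' ∈ F'.atlas) (hr' : Metric.ball c' r' ⊆ e'.target) (hφ : F.IsFoliatedMap F' φ)
    (hmap : Set.MapsTo φ (box e c r) (box e' c' r')) (hx : x ∈ box e c r) :
    F.normSqDT F' φ x = energy (tinv F e c) (tmap e c e' φ) (tmet F' e' c') (e x).2 := by
  rw [normSqDT, trQ_eq_sum he hx.1
    (b := fun a b => pullbackForm (tmap e c e' φ) (tmet F' e' c') a b (e x).2)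
    (fun v _ w _ => gQ_dT he hr hF' he' hr' hφ hmap hx v w), energy]
  simp only [metricMatrix_inv_eq_tinv hF he hr hx, smul_eq_mul]

theorem stressEnergy_frame (hF : F.IsBundleLike) (he : e ∈ F.atlas)
    (hr : Metric.ball c r ⊆ e.target) (hF' : F'.IsBundleLike)
    (he' : e' ∈ F'.atlas) (hr' : Metric.ball c' r' ⊆ e'.target) (hφ : F.IsFoliatedMap F' φ)
    (hmap : Set.MapsTo φ (box e c r) (box e' c' r')) (hx : x ∈ box e c r) (a b : Fin q) :
    F.stressEnergy F' φ x (F.frame e a x) (F.frame e b x) =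
      1 / 2 * energy (tinv F e c) (tmap e c e' φ) (tmet F' e' c') (e x).2 *
        tmet F e c a b (e x).2 -
      pullbackForm (tmap e c e' φ) (tmet F' e' c') a b (e x).2 := by
  rw [stressEnergy, gQ_dT_frame he hr hF' he' hr' hφ hmap hx,
    normSqDT_eq_energy hF he hr hF' he' hr' hφ hmap hx]
  have : F.gQ x (F.frame e a x) (F.frame e b x) = tmet F e c a b (e x).2 :=
    metricMatrix_eq_tmet hF he hr hx a b
  rw [this]

/-- The vanishing of the `f`-tension field in transversal coordinates. -/
theorem tension_coord {f : M → ℝ} (hf : F.IsBasic f) (hF : F.IsBundleLike) (he : e ∈ F.atlas)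
    (hr : Metric.ball c r ⊆ e.target) (hF' : F'.IsBundleLike)
    (he' : e' ∈ F'.atlas) (hr' : Metric.ball c' r' ⊆ e'.target)
    (hφ : F.IsTransversallyHarmonic F' f φ)
    (hmap : Set.MapsTo φ (box e c r) (box e' c' r')) {y : EuclideanSpace ℝ (Fin q)}
    (hy : y ∈ Metric.ball c.2 r) (α : Fin q') :
    ∑ c₁, ∑ a, tinv F e c c₁ a y *
      (pd c₁ (fun z => Real.exp (-f (slice e c z)) * pd a (fun x => tmap e c e' φ x α) z) y
      - ∑ k, chr (tmet F e c) (tinv F e c) c₁ a k y *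
        (Real.exp (-f (slice e c y)) * pd k (fun x => tmap e c e' φ x α) y)
      + ∑ β, ∑ γ, pd c₁ (fun x => tmap e c e' φ x β) y *
          chr (tmet F' e' c') (tinv F' e' c') β γ α (tmap e c e' φ y) *
          (Real.exp (-f (slice e c y)) * pd a (fun x => tmap e c e' φ x γ) y)) = 0 := by
  obtain ⟨x, hx, rfl⟩ : ∃ x ∈ box e c r, (e x).2 = y :=
    ⟨_, slice_mem_box hr hy, snd_chart_slice hr hy⟩
  have hs : (e' (φ x)).2 = tmap e c e' φ (e x).2 := by
    ext α; exact snd_chart_apply_eq_tmap he hr he' hφ.1 hmap hx α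
  have hA : ∀ z ∈ box e c r, ∀ a γ, dy e' γ (φ z)
      ((Real.exp (-f z) • F.dT F' φ z) (F.frame e a z)) =
      Real.exp (-f (slice e c (e z).2)) * pd a (fun x => tmap e c e' φ x γ) (e z).2 := by
    intro z hz a γ
    rw [← basic_eq_slice hf he hr hz, ← dy_dT_frame he hr he' hφ.1 hmap hz]
    exact map_smul (mvfderiv (𝓡 n') (fun z : M' => (e' z).2 γ) (φ z)) _ _
  have hd : ∀ a γ, DifferentiableAt ℝ (fun z => Real.exp (-f (slice e c z)) *
      pd a (fun x => tmap e c e' φ x γ) z) (e x).2 := fun a γ =>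
    ((contDiffAt_basic_slice hf he hr hy).neg.exp.mul (contDiffAt_pd (contDiffAt_component
      (contDiffAt_tmap he hr he' hφ.1 hmap hy) γ) a)).differentiableAt (by simp)
  have hdz : ∀ a γ (Z : TangentSpace (𝓡 n) x), mvfderiv (𝓡 n) (fun z : M => dy e' γ (φ z)
      ((Real.exp (-f z) • F.dT F' φ z) (F.frame e a z))) x Z = ∑ c₁, dy e c₁ x Z *
      pd c₁ (fun z => Real.exp (-f (slice e c z)) * pd a (fun x => tmap e c e' φ x γ) z)
        (e x).2 := fun a γ Z =>
    mvfderiv_of_eventuallyEq he hx.1 (hd a γ) (Filter.eventually_of_mem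
      ((isOpen_box e c r).mem_nhds hx) fun z hz => hA z hz a γ) Z
  set T : Fin q → Fin q → Fin q' → ℝ := fun c₁ a α =>
    pd c₁ (fun z => Real.exp (-f (slice e c z)) * pd a (fun x => tmap e c e' φ x α) z) (e x).2
      - ∑ k, chr (tmet F e c) (tinv F e c) c₁ a k (e x).2 *
        (Real.exp (-f (slice e c (e x).2)) * pd k (fun x => tmap e c e' φ x α) (e x).2)
      + ∑ β, ∑ γ, pd c₁ (fun x => tmap e c e' φ x β) (e x).2 *
          chr (tmet F' e' c') (tinv F' e' c') β γ α (tmap e c e' φ (e x).2) *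
          (Real.exp (-f (slice e c (e x).2)) * pd a (fun x => tmap e c e' φ x γ) (e x).2) with hT
  have h1 := hφ.2 e he e' he' x hx.1 (hmap hx).1
  -- Writing the covariant derivative as a bilinear form in dy(v), dy(w) is what `trQ_eq_sum` needs
  -- to turn the orthonormal trace into a contraction.
  have hB : ∀ v w : TangentSpace (𝓡 n) x,
      F.covDerivHom F' e e' φ (fun z => Real.exp (-f z) • F.dT F' φ z) x v w =
      ∑ c₁, ∑ a, (dy e c₁ x v * dy e a x w) • ∑ α, T c₁ a α • F'.frame e' α (φ x) := by
    intro v w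
    have h2 : ∀ α a, (mvfderiv (𝓡 n) (fun z : M => dy e' α (φ z)
          ((Real.exp (-f z) • F.dT F' φ z) (F.frame e a z))) x v
        - ∑ b, ∑ d, dy e b x v * F.christoffel e x b a d * dy e' α (φ x)
          ((Real.exp (-f x) • F.dT F' φ x) (F.frame e d x))
        + ∑ β, ∑ γ, dy e' β (φ x) (mfderiv (𝓡 n) (𝓡 n') φ x v) *
          F'.christoffel e' (φ x) β γ α * dy e' γ (φ x)
            ((Real.exp (-f x) • F.dT F' φ x) (F.frame e a x))) =
        ∑ c₁, dy e c₁ x v * T c₁ a α := by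
      intro α a
      simp only [hdz, hA x hx, christoffel_eq_chr hF he hr hx,
        christoffel_eq_chr hF' he' hr' (hmap hx), dy_mfderiv_eq_sum he hr he' hφ.1 hmap hx, hs, hT,
        mul_add, mul_sub, Finset.sum_add_distrib, Finset.sum_sub_distrib, Finset.mul_sum,
        Finset.sum_mul]
      congr 1
      · congr 1
        exact Finset.sum_congr rfl fun b _ => Finset.sum_congr rfl fun d _ => by ring
      · rw [Finset.sum_congr rfl fun β _ => Finset.sum_comm, Finset.sum_comm]
        exact Finset.sum_congr rfl fun b _ => Finset.sum_congr rfl fun d _ =>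
          Finset.sum_congr rfl fun d _ => by ring
    rw [covDerivHom]
    simp only [h2, Finset.mul_sum, Finset.sum_smul, Finset.smul_sum, smul_smul]
    rw [Finset.sum_comm, Finset.sum_congr rfl fun a _ => Finset.sum_comm, Finset.sum_comm]
    exact Finset.sum_congr rfl fun b _ => Finset.sum_congr rfl fun d _ =>
          Finset.sum_congr rfl fun d _ => by congr 1; ring
  rw [tensionField, trQ_eq_sum he hx.1 (fun v _ w _ => hB v w)] at h1
  -- The forms dy are dual to the frame of Q', so this extracts the α-component of the vanishing
  -- vector.
  have h2 := congrArg (dy e' α (φ x)) h1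
  have h0 : dy e' α (φ x) (0 : TangentSpace (𝓡 n') (φ x)) = 0 :=
    map_zero (mvfderiv (𝓡 n') (fun z : M' => (e' z).2 α) (φ x))
  rw [h0] at h2
  change mvfderiv (𝓡 n') (fun z : M' => (e' z).2 α) (φ x) _ = 0 at h2
  have h3 : ∀ γ, mvfderiv (𝓡 n') (fun z : M' => (e' z).2 α) (φ x) (F'.frame e' γ (φ x)) =
      if γ = α then 1 else 0 := fun γ => dy_frame he' (hmap hx).1 γ α
  simpa only [map_sum, map_smul, h3, smul_eq_mul, mul_ite, mul_one, mul_zero, Finset.sum_ite_eq',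
    Finset.mem_univ, if_true, metricMatrix_inv_eq_tinv hF he hr hx] using h2

/-- The conservation law in transversal coordinates. -/
theorem conservation_coord {f : M → ℝ} (hf : F.IsBasic f) (hF : F.IsBundleLike) (he : e ∈ F.atlas)
    (hr : Metric.ball c r ⊆ e.target) (hF' : F'.IsBundleLike)
    (he' : e' ∈ F'.atlas) (hr' : Metric.ball c' r' ⊆ e'.target)
    (hφ : F.IsFoliatedMap F' φ) (hcons : F.SatisfiesConservationLaw F' f φ)
    (hmap : Set.MapsTo φ (box e c r) (box e' c' r')) {y : EuclideanSpace ℝ (Fin q)}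
    (hy : y ∈ Metric.ball c.2 r) (d : Fin q) {S : Fin q → Fin q → EuclideanSpace ℝ (Fin q) → ℝ}
    (hS : S = fun a d z => Real.exp (-f (slice e c z)) *
      (1 / 2 * energy (tinv F e c) (tmap e c e' φ) (tmet F' e' c') z * tmet F e c a d z -
        pullbackForm (tmap e c e' φ) (tmet F' e' c') a d z)) :
    ∑ c₁, ∑ a, tinv F e c c₁ a y * (pd c₁ (S a d) y
      - ∑ k, chr (tmet F e c) (tinv F e c) c₁ a k y * S k d y
      - ∑ k, chr (tmet F e c) (tinv F e c) c₁ d k y * S a k y) = 0 := by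
  obtain ⟨x, hx, rfl⟩ : ∃ x ∈ box e c r, (e x).2 = y :=
    ⟨_, slice_mem_box hr hy, snd_chart_slice hr hy⟩
  have hA : ∀ z ∈ box e c r, ∀ a b, Real.exp (-f z) *
      F.stressEnergy F' φ z (F.frame e a z) (F.frame e b z) = S a b (e z).2 := by
    intro z hz a b
    rw [stressEnergy_frame hF he hr hF' he' hr' hφ hmap hz, basic_eq_slice hf he hr hz, hS]
  have hd : ∀ a b, DifferentiableAt ℝ (S a b) (e x).2 := by
    intro a b
    have hG' : ∀ α β, DifferentiableAt ℝ (tmet F' e' c' α β) (tmap e c e' φ (e x).2) := by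
      intro α β
      refine (contDiffAt_tmet he' hr' ?_ α β).differentiableAt (by simp)
      exact snd_mem_ball (hmap (slice_mem_box hr hy))
    have hpf := differentiableAt_pullbackForm (contDiffAt_tmap he hr he' hφ hmap hy) hG'
    have hEn : DifferentiableAt ℝ (energy (tinv F e c) (tmap e c e' φ) (tmet F' e' c'))
        (e x).2 :=
      DifferentiableAt.fun_sum fun a _ => DifferentiableAt.fun_sum fun b _ =>
        ((contDiffAt_tinv he hr hy a b).differentiableAt (by simp)).fun_mul (hpf a b)
    rw [hS]
    exact ((contDiffAt_basic_slice hf he hr hy).neg.exp.differentiableAt (by simp)).fun_mul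
      (((hEn.const_mul _).fun_mul
        ((contDiffAt_tmet he hr hy a b).differentiableAt (by simp))).fun_sub (hpf a b))
  have hdz : ∀ a b (Z : TangentSpace (𝓡 n) x), mvfderiv (𝓡 n) (fun z : M => Real.exp (-f z) *
      F.stressEnergy F' φ z (F.frame e a z) (F.frame e b z)) x Z =
      ∑ c₁, dy e c₁ x Z * pd c₁ (S a b) (e x).2 := fun a b Z =>
    mvfderiv_of_eventuallyEq he hx.1 (hd a b) (Filter.eventually_of_mem
      ((isOpen_box e c r).mem_nhds hx) fun z hz => hA z hz a b) Z
  -- Testing on the frame vector d reduces the last slot of the divergence to one index.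
  have h1 := hcons e he x hx.1 _ (frame_mem F e d x)
  have hB : ∀ v w : TangentSpace (𝓡 n) x,
      F.covDerivForm e (fun z V W => Real.exp (-f z) * F.stressEnergy F' φ z V W) x v w
        (F.frame e d x) = ∑ c₁, ∑ a, (dy e c₁ x v * dy e a x w) • (pd c₁ (S a d) (e x).2
      - ∑ k, chr (tmet F e c) (tinv F e c) c₁ a k (e x).2 * S k d (e x).2
      - ∑ k, chr (tmet F e c) (tinv F e c) c₁ d k (e x).2 * S a k (e x).2) := by
    intro v w
    simp only [covDerivForm, hdz, hA x hx, christoffel_eq_chr hF he hr hx, dy_frame he hx.1,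
      mul_ite, mul_one, mul_zero, ite_mul, zero_mul, Finset.sum_ite_eq, Finset.mem_univ, if_true]
    simp only [mul_sub, Finset.mul_sum, smul_eq_mul, Finset.sum_sub_distrib]
    congr 1
    · congr 1
      · rw [Finset.sum_comm]
        exact Finset.sum_congr rfl fun b _ => Finset.sum_congr rfl fun d _ => by ring
      · rw [Finset.sum_comm]
        exact Finset.sum_congr rfl fun b _ => Finset.sum_congr rfl fun d _ =>
          Finset.sum_congr rfl fun d _ => by ring
    · rw [Finset.sum_comm]
      exact Finset.sum_congr rfl fun b _ => Finset.sum_congr rfl fun d _ =>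
          Finset.sum_congr rfl fun d _ => by ring
  rw [divForm, trQ_eq_sum he hx.1 (fun v _ w _ => hB v w)] at h1
  simpa only [metricMatrix_inv_eq_tinv hF he hr hx, smul_eq_mul] using h1

end Maps

end Foliation

/-! ### The harmonicity equation as a differential inequality -/

namespace Elliptic

/-- `R` is bounded by a multiple of `D` on `K`. -/
def Dominated {X : Type*} (K : Set X) (D R : X → ℝ) : Prop := ∃ B, ∀ x ∈ K, |R x| ≤ B * D x

section Dominated

variable {X : Type*} {K : Set X} {D R S : X → ℝ}

theorem Dominated.add (hR : Dominated K D R) (hS : Dominated K D S) :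
    Dominated K D fun x => R x + S x := by
  obtain ⟨B, hB⟩ := hR
  obtain ⟨C, hC⟩ := hS
  refine ⟨B + C, fun x hx => (abs_add_le _ _).trans ?_⟩
  rw [add_mul]
  exact add_le_add (hB x hx) (hC x hx)

theorem Dominated.neg (hR : Dominated K D R) : Dominated K D fun x => -R x := by
  obtain ⟨B, hB⟩ := hR
  exact ⟨B, fun x hx => by rw [abs_neg]; exact hB x hx⟩

theorem Dominated.sum {ι : Type*} {s : Finset ι} {R : ι → X → ℝ}
    (hR : ∀ i ∈ s, Dominated K D (R i)) : Dominated K D fun x => ∑ i ∈ s, R i x := by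
  classical
  induction s using Finset.induction_on with
  | empty => exact ⟨0, by simp⟩
  | insert i s hi ih =>
    simp only [Finset.sum_insert hi]
    exact (hR i (Finset.mem_insert_self i s)).add
      (ih fun j hj => hR j (Finset.mem_insert_of_mem hj))

theorem Dominated.mul [TopologicalSpace X] (hK : IsCompact K) {g : X → ℝ} (hg : ContinuousOn g K)
    (hR : Dominated K D R) : Dominated K D fun x => g x * R x := by
  obtain ⟨B, hB⟩ := hR
  obtain ⟨C, hC⟩ := hK.exists_bound_of_continuousOn hg
  refine ⟨C * B, fun x hx => ?_⟩
  rw [abs_mul, mul_assoc]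
  exact mul_le_mul (hC x hx) (hB x hx) (abs_nonneg _) ((norm_nonneg _).trans (hC x hx))

theorem Dominated.exists_bound {ι : Type*} [Fintype ι] {R : ι → X → ℝ}
    (hD : ∀ x ∈ K, 0 ≤ D x) (hR : ∀ i, Dominated K D (R i)) :
    ∃ B, ∀ x ∈ K, ∀ i, |R i x| ≤ B * D x := by
  choose B hB using hR
  refine ⟨∑ i, |B i|, fun x hx i => (hB i x hx).trans ?_⟩
  refine mul_le_mul_of_nonneg_right ((le_abs_self _).trans ?_) (hD x hx)
  exact Finset.single_le_sum (f := fun i => |B i|) (fun i _ => abs_nonneg _) (Finset.mem_univ i)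

end Dominated

variable {q q' : ℕ} {G Gi : Fin q → Fin q → EuclideanSpace ℝ (Fin q) → ℝ}
  {G' Gi' : Fin q' → Fin q' → EuclideanSpace ℝ (Fin q') → ℝ}
  {Φ : EuclideanSpace ℝ (Fin q) → EuclideanSpace ℝ (Fin q')}

theorem contDiffAt_chr {y : EuclideanSpace ℝ (Fin q)} (hG : ∀ a b, ContDiffAt ℝ ∞ (G a b) y)
    (hGi : ∀ a b, ContDiffAt ℝ ∞ (Gi a b) y) (a b c : Fin q) :
    ContDiffAt ℝ ∞ (chr G Gi a b c) y := by
  refine contDiffAt_const.mul (ContDiffAt.sum fun d _ => (hGi c d).mul ?_)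
  exact ((contDiffAt_pd (hG b d) a).add (contDiffAt_pd (hG a d) b)).sub (contDiffAt_pd (hG a b) d)

/-- The weighted harmonicity equation bounds the principal part by the differential. -/
theorem exists_bound_principal {K : Set (EuclideanSpace ℝ (Fin q))} (hK : IsCompact K)
    {U : EuclideanSpace ℝ (Fin q) → ℝ}
    (hΦ : ∀ y ∈ K, ContDiffAt ℝ ∞ Φ y) (hU : ∀ y ∈ K, ContDiffAt ℝ ∞ U y)
    (hU0 : ∀ y ∈ K, U y ≠ 0)
    (hG : ∀ a b, ∀ y ∈ K, ContDiffAt ℝ ∞ (G a b) y)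
    (hGi : ∀ a b, ∀ y ∈ K, ContDiffAt ℝ ∞ (Gi a b) y)
    (hG' : ∀ α β, ∀ y ∈ K, ContDiffAt ℝ ∞ (G' α β) (Φ y))
    (hGi' : ∀ α β, ∀ y ∈ K, ContDiffAt ℝ ∞ (Gi' α β) (Φ y))
    (htens : ∀ y ∈ K, ∀ α, ∑ c, ∑ a, Gi c a y * (pd c (fun z => U z * pd a (fun x => Φ x α) z) y
      - ∑ k, chr G Gi c a k y * (U y * pd k (fun x => Φ x α) y)
      + ∑ β, ∑ γ, pd c (fun x => Φ x β) y * chr G' Gi' β γ α (Φ y)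
          * (U y * pd a (fun x => Φ x γ) y)) = 0) :
    ∃ B, ∀ y ∈ K, ∀ α, |∑ c, ∑ a, Gi c a y * pd c (pd a (fun x => Φ x α)) y| ≤
      B * ∑ β, ∑ i, |pd i (fun x => Φ x β) y| := by
  have hpd : ∀ β i, Dominated K (fun y => ∑ β, ∑ i, |pd i (fun x => Φ x β) y|)
      (pd i (fun x => Φ x β)) := by
    refine fun β i => ⟨1, fun y _ => ?_⟩
    rw [one_mul]
    refine le_trans ?_ (Finset.single_le_sum (f := fun β => ∑ i, |pd i (fun x => Φ x β) y|)
      (fun β _ => Finset.sum_nonneg fun i _ => abs_nonneg _) (Finset.mem_univ β))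
    exact Finset.single_le_sum (f := fun i => |pd i (fun x => Φ x β) y|)
      (fun i _ => abs_nonneg _) (Finset.mem_univ i)
  have hc : ∀ {h : EuclideanSpace ℝ (Fin q) → ℝ}, (∀ y ∈ K, ContDiffAt ℝ ∞ h y) →
      ContinuousOn h K := fun hh y hy => (hh y hy).continuousAt.continuousWithinAt
  have hUi : ContinuousOn (fun y => (U y)⁻¹) K := (hc hU).inv₀ hU0
  refine Dominated.exists_bound (R := fun α y => ∑ c, ∑ a, Gi c a y *
    pd c (pd a (fun x => Φ x α)) y) (fun y _ => Finset.sum_nonneg fun β _ =>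
      Finset.sum_nonneg fun i _ => abs_nonneg _) fun α => ?_
  -- The dominated expression is the harmonicity equation solved for its principal part. The
  -- quadratic term counts as one derivative of Φ times a coefficient containing the other, which is
  -- bounded on the compact set.
  have hdom := Dominated.mul hK hUi (Dominated.neg (Dominated.sum (s := Finset.univ) fun c _ =>
    Dominated.sum (s := Finset.univ) fun a _ => Dominated.mul hK (hc (hGi c a))
      (((hpd α a).mul hK (hc fun y hy => contDiffAt_pd (hU y hy) c)).add
        ((Dominated.sum (s := Finset.univ) fun k _ => ((hpd α k).mul hK (hc hU)).mul hK
          (hc fun y hy => contDiffAt_chr (fun a b => hG a b y hy)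
            (fun a b => hGi a b y hy) c a k)).neg.add
        (Dominated.sum (s := Finset.univ) fun β _ => Dominated.sum (s := Finset.univ) fun γ _ =>
          ((hpd γ a).mul hK (hc hU)).mul hK (hc fun y hy =>
            (contDiffAt_pd (contDiffAt_component (hΦ y hy) β) c).mul
              ((contDiffAt_chr (fun a b => hG' a b y hy)
                (fun a b => hGi' a b y hy) β γ α).comp y (hΦ y hy))))))))
  obtain ⟨B, hB⟩ := hdom
  refine ⟨B, fun y hy => le_of_eq_of_le ?_ (hB y hy)⟩
  have h1 := htens y hy α
  have h2 : ∀ c a, pd c (fun z => U z * pd a (fun x => Φ x α) z) y =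
      U y * pd c (pd a (fun x => Φ x α)) y + pd c U y * pd a (fun x => Φ x α) y := by
    intro c a
    rw [pd_mul ((hU y hy).differentiableAt (by simp))
      ((contDiffAt_pd (contDiffAt_component (hΦ y hy) α) a).differentiableAt (by simp))]
    ring
  congr 1
  -- After clearing U⁻¹ the identity is `htens` with the product rule applied to U ∂_aΦ.
  rw [eq_inv_mul_iff_mul_eq₀ (hU0 y hy), eq_neg_iff_add_eq_zero, ← h1, Finset.mul_sum,
    ← Finset.sum_add_distrib]
  refine Finset.sum_congr rfl fun c _ => ?_
  rw [Finset.mul_sum, ← Finset.sum_add_distrib]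
  refine Finset.sum_congr rfl fun a _ => ?_
  rw [h2]
  simp only [Function.comp_apply]
  ring

end Elliptic

/-! ### The zero set of the transversal differential is open and closed up to interior -/

namespace Foliation

open Elliptic

section Maps

variable {p q n p' q' n' : ℕ}
  {M : Type*} [TopologicalSpace M] [ChartedSpace (EuclideanSpace ℝ (Fin n)) M]
  {M' : Type*} [TopologicalSpace M'] [ChartedSpace (EuclideanSpace ℝ (Fin n')) M']
  {F : Foliation p q n M} {F' : Foliation p' q' n' M'}
  {e : OpenPartialHomeomorph M (FoliatedModel p q)} {c : FoliatedModel p q} {r : ℝ}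
  {e' : OpenPartialHomeomorph M' (FoliatedModel p' q')} {c' : FoliatedModel p' q'} {r' : ℝ}
  {φ : M → M'} {x : M} {f : M → ℝ}

theorem box_subset_box {r₁ r₂ : ℝ} (h : r₁ ≤ r₂) : box e c r₁ ⊆ box e c r₂ :=
  Set.inter_subset_inter_right _ (Set.preimage_mono (Metric.ball_subset_ball h))

/-- By continuity the preimage of a target box is open, and its image in the source chart contains a
ball around e x; injectivity of e returns the inclusion to M. -/
theorem exists_box (F : Foliation p q n M) (F' : Foliation p' q' n' M') (hφ : Continuous φ)
    (x : M) : ∃ e ∈ F.atlas, x ∈ e.source ∧ ∃ e' ∈ F'.atlas, ∃ c' r' r, 0 < r ∧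
      Metric.ball (e x) r ⊆ e.target ∧ Metric.ball c' r' ⊆ e'.target ∧
      Set.MapsTo φ (box e (e x) r) (box e' c' r') := by
  obtain ⟨e, he, hx⟩ := F.cover x
  obtain ⟨e', he', hx'⟩ := F'.cover (φ x)
  obtain ⟨r', hr'0, hr'⟩ := Metric.isOpen_iff.1 e'.open_target _ (e'.map_source hx')
  have hopen : IsOpen (e.source ∩ φ ⁻¹' box e' (e' (φ x)) r') :=
    e.open_source.inter ((isOpen_box e' _ r').preimage hφ)
  have h2 := e.isOpen_image_of_subset_source hopen Set.inter_subset_left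
  obtain ⟨r, hr0, hr⟩ := Metric.isOpen_iff.1 h2 (e x)
    ⟨x, ⟨hx, hx', Metric.mem_ball_self hr'0⟩, rfl⟩
  refine ⟨e, he, hx, e', he', _, r', r, hr0, fun y hy => ?_, hr', fun z hz => ?_⟩
  · obtain ⟨z, hz, rfl⟩ := hr hy
    exact e.map_source hz.1
  · obtain ⟨w, hw, hwz⟩ := hr hz.2
    rw [← e.injOn hw.1 hz.1 hwz]
    exact hw.2

variable [RiemannianBundle (fun x : M => TangentSpace (𝓡 n) x)]
  [RiemannianBundle (fun x : M' => TangentSpace (𝓡 n') x)]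

/-- A sum of squared lengths over an orthonormal basis of the normal space vanishes, and d_Tφ
factors through the projection to that space. -/
theorem dT_eq_zero_of_normSqDT_eq_zero (h : F.normSqDT F' φ x = 0) : F.dT F' φ x = 0 := by
  have hn : ∀ v, 0 ≤ F'.gQ (φ x) (F.dT F' φ x v) (F.dT F' φ x v) := fun v =>
    real_inner_self_nonneg
  rw [normSqDT, trQ] at h
  have h1 := (Finset.sum_eq_zero_iff_of_nonneg fun i _ => hn _).1 h
  have h2 : ∀ i, F.dT F' φ x
      (stdOrthonormalBasis ℝ (F.tangent x)ᗮ i : TangentSpace (𝓡 n) x) = 0 := by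
    intro i
    have h3 : F'.normalProj (φ x) (F.dT F' φ x
        (stdOrthonormalBasis ℝ (F.tangent x)ᗮ i : TangentSpace (𝓡 n) x)) = 0 :=
      inner_self_eq_zero.1 (h1 i (Finset.mem_univ i))
    rwa [normalProj_of_mem (dT_mem (F := F) φ x _)] at h3
  ext v
  have h3 : F.dT F' φ x v = F.dT F' φ x (F.normalProj x v) := by
    rw [dT_apply, dT_apply, normalProj_of_mem (normalProj_mem F x v)]
  rw [h3, ← sum_inner_stdOrthonormalBasis _ (normalProj_mem F x v), map_sum]
  simp only [map_smul, h2, smul_zero, Finset.sum_const_zero]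
  rfl

variable [IsManifold (𝓡 n) ∞ M] [IsContMDiffRiemannianBundle (𝓡 n) ∞ (EuclideanSpace ℝ (Fin n))
    (fun x : M => TangentSpace (𝓡 n) x)]
  [IsManifold (𝓡 n') ∞ M'] [IsContMDiffRiemannianBundle (𝓡 n') ∞ (EuclideanSpace ℝ (Fin n'))
    (fun x : M' => TangentSpace (𝓡 n') x)]

theorem energy_mul_pd_coord (hf : F.IsBasic f) (hF : F.IsBundleLike) (he : e ∈ F.atlas)
    (hr : Metric.ball c r ⊆ e.target) (hF' : F'.IsBundleLike)
    (he' : e' ∈ F'.atlas) (hr' : Metric.ball c' r' ⊆ e'.target)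
    (hφ : F.IsTransversallyHarmonic F' f φ) (hcons : F.SatisfiesConservationLaw F' f φ)
    (hmap : Set.MapsTo φ (box e c r) (box e' c' r')) {y : EuclideanSpace ℝ (Fin q)}
    (hy : y ∈ Metric.ball c.2 r) (d : Fin q) :
    energy (tinv F e c) (tmap e c e' φ) (tmet F' e' c') y *
      pd d (fun y => Real.exp (-f (slice e c y))) y = 0 := by
  have hy' : tmap e c e' φ y ∈ Metric.ball c'.2 r' := snd_mem_ball (hmap (slice_mem_box hr hy))
  have ht := tension_coord hf hF he hr hF' he' hr' hφ hmap hy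
  have hc := fun d => conservation_coord hf hF he hr hF' he' hr' hφ.1 hcons hmap hy d rfl
  exact energy_mul_pd_eq_zero (G := tmet F e c) (Gi := tinv F e c) (G' := tmet F' e' c')
    (Gi' := tinv F' e' c') (Φ := tmap e c e' φ) (U := fun y => Real.exp (-f (slice e c y)))
    (contDiffAt_tmap he hr he' hφ.1 hmap hy)
    ((contDiffAt_basic_slice hf he hr hy).neg.exp.differentiableAt (by simp))
    (fun a b => (contDiffAt_tmet he hr hy a b).differentiableAt (by simp))
    (fun a b => (contDiffAt_tinv he hr hy a b).differentiableAt (by simp))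
    (fun a b => Filter.Eventually.of_forall fun z => tmet_symm a b z)
    (fun a b => tinv_symm a b y)
    (fun a b => Filter.eventually_of_mem (Metric.isOpen_ball.mem_nhds hy)
      fun z hz => tmet_mul_tinv he hr hz a b)
    (fun a b => (contDiffAt_tmet he' hr' hy' a b).differentiableAt (by simp))
    (fun a b => Filter.Eventually.of_forall fun z => tmet_symm a b z)
    (tinv_mul_tmet he' hr' hy')
    ht hc d

/-- Where d(e^{-f}) ≠ 0, an open condition, the identity |d_Tφ|² d(e^{-f}) = 0 forces d_Tφ = 0. If
the interior were empty, e^{-f} would have zero derivative in every box, so f would be locally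
constant, hence constant on the connected M. -/
theorem nonempty_interior_dT_eq_zero [ConnectedSpace M] (hf : F.IsBasic f)
    (hfc : ∃ x y : M, f x ≠ f y) (hF : F.IsBundleLike) (hF' : F'.IsBundleLike)
    (hφ : F.IsTransversallyHarmonic F' f φ) (hcons : F.SatisfiesConservationLaw F' f φ) :
    (interior {x | F.dT F' φ x = 0}).Nonempty := by
  by_contra hne
  rw [Set.not_nonempty_iff_eq_empty] at hne
  obtain ⟨x₁, x₂, h12⟩ := hfc
  refine h12 (IsLocallyConstant.apply_eq_of_preconnectedSpace ?_ x₁ x₂)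
  rw [IsLocallyConstant.iff_eventually_eq]
  intro x
  obtain ⟨e, he, hx, e', he', c', r', r, hr0, hr, hr', hmap⟩ := exists_box F F' hφ.1.1.continuous x
  have hU : ∀ y ∈ Metric.ball (e x).2 r, ContDiffAt ℝ ∞
      (fun y => Real.exp (-f (slice e (e x) y))) y := fun y hy =>
    (contDiffAt_basic_slice hf he hr hy).neg.exp
  have hxb : x ∈ box e (e x) r := ⟨hx, Metric.mem_ball_self hr0⟩
  have hpd : ∀ y ∈ Metric.ball (e x).2 r, ∀ d,
      pd d (fun y => Real.exp (-f (slice e (e x) y))) y = 0 := by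
    intro y hy d
    by_contra hd
    have h1 : ∀ᶠ w in 𝓝 y, w ∈ Metric.ball (e x).2 r ∧
        pd d (fun y => Real.exp (-f (slice e (e x) y))) w ≠ 0 :=
      (Metric.isOpen_ball.eventually_mem hy).and
        ((contDiffAt_pd (hU y hy) d).continuousAt.eventually_ne hd)
    have hz := slice_mem_box hr hy
    have hcont : ContinuousAt (fun z => (e z).2) (slice e (e x) y) :=
      continuousAt_snd.comp (e.continuousAt hz.1)
    rw [← snd_chart_slice hr hy] at h1
    have h2 := hcont.eventually h1
    -- The open set of transversal coordinates where the derivative is nonzero is pulled back by z ↦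
    -- (e z).2, giving a neighbourhood in M and not merely in the transversal.
    have h3 : slice e (e x) y ∈ interior {x | F.dT F' φ x = 0} := by
      rw [mem_interior_iff_mem_nhds]
      filter_upwards [h2, (isOpen_box e (e x) r).mem_nhds hz] with z hz1 hz2
      refine dT_eq_zero_of_normSqDT_eq_zero ?_
      rw [normSqDT_eq_energy hF he hr hF' he' hr' hφ.1 hmap hz2]
      exact (mul_eq_zero.1 (energy_mul_pd_coord hf hF he hr hF' he' hr' hφ hcons hmap
        hz1.1 d)).resolve_right hz1.2
    rw [hne] at h3
    exact h3
  filter_upwards [(isOpen_box e (e x) r).mem_nhds hxb] with z hz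
  have h1 := eq_of_pd_eq_zero Metric.isOpen_ball (convex_ball (e x).2 r).isPreconnected
    (fun y hy => ((hU y hy).differentiableAt (by simp)).differentiableWithinAt) hpd
    (snd_mem_ball hz) (snd_mem_ball hxb)
  rw [basic_eq_slice hf he hr hz, basic_eq_slice hf he hr hxb]
  exact neg_injective (Real.exp_injective h1)

/-- Near a limit point x, take a point x₁ of the interior and continue the vanishing of dΦ from a
small ball about the transversal coordinate of x₁ to a ball covering that of x. The conservation law
plays no role here: harmonicity suffices. -/
theorem isClosed_interior_dT_eq_zero (hf : F.IsBasic f) (hF : F.IsBundleLike)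
    (hF' : F'.IsBundleLike) (hφ : F.IsTransversallyHarmonic F' f φ) :
    IsClosed (interior {x | F.dT F' φ x = 0}) := by
  refine closure_subset_iff_isClosed.1 fun x hx => ?_
  obtain ⟨e, he, hxe, e', he', c', r', r, hr0, hr, hr', hmap⟩ := exists_box F F' hφ.1.1.continuous x
  have hxb : x ∈ box e (e x) (r / 4) := ⟨hxe, Metric.mem_ball_self (by positivity)⟩
  obtain ⟨x₁, hx₁b, hx₁⟩ := mem_closure_iff_nhds.1 hx _ ((isOpen_box e (e x) (r / 4)).mem_nhds hxb)
  have hd₁ : dist (e x₁).2 (e x).2 < r / 4 := snd_mem_ball hx₁b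
  -- Radii: x₁ is within r/4 of x, so the r/2-ball about x₁ stays in K and contains the r/4-ball
  -- about x; K is a compact part of the r-ball, where the coefficients are bounded.
  set K := Metric.closedBall (e x).2 (3 * r / 4) with hK
  have hKr : ∀ y ∈ K, y ∈ Metric.ball (e x).2 r := fun y hy =>
    Metric.closedBall_subset_ball (by linarith) hy
  have hball : Metric.ball (e x₁).2 (r / 2) ⊆ K := fun y hy => by
    rw [hK, Metric.mem_closedBall]
    linarith [dist_triangle y (e x₁).2 (e x).2, Metric.mem_ball.1 hy]
  have hy' : ∀ y ∈ K, tmap e (e x) e' φ y ∈ Metric.ball c'.2 r' := fun y hy =>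
    snd_mem_ball (hmap (slice_mem_box hr (hKr y hy)))
  obtain ⟨B, hB⟩ := exists_bound_principal (G := tmet F e (e x)) (Gi := tinv F e (e x))
    (G' := tmet F' e' c') (Gi' := tinv F' e' c') (isCompact_closedBall _ _)
    (U := fun y => Real.exp (-f (slice e (e x) y)))
    (fun y hy => contDiffAt_tmap he hr he' hφ.1 hmap (hKr y hy))
    (fun y hy => (contDiffAt_basic_slice hf he hr (hKr y hy)).neg.exp)
    (fun y _ => (Real.exp_pos _).ne')
    (fun a b y hy => contDiffAt_tmet he hr (hKr y hy) a b)
    (fun a b y hy => contDiffAt_tinv he hr (hKr y hy) a b)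
    (fun a b y hy => contDiffAt_tmet he' hr' (hy' y hy) a b)
    (fun a b y hy => contDiffAt_tinv he' hr' (hy' y hy) a b)
    (fun y hy => tension_coord hf hF he hr hF' he' hr' hφ hmap (hKr y hy))
  have hx₁s : x₁ ∈ e.source := hx₁b.1
  -- The transversal through x₁ itself is used: only near x₁ is d_Tφ known to vanish, not where the
  -- central slice meets the same plaque.
  have hcont : ContinuousAt (fun y => e.symm ((e x₁).1, y)) (e x₁).2 :=
    ContinuousAt.comp (g := e.symm) (f := fun y => ((e x₁).1, y))
      (e.symm.continuousAt (e.map_source hx₁s)) (by fun_prop)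
  have hnhds : interior {x | F.dT F' φ x = 0} ∩ box e (e x) r ∈
      𝓝 (e.symm ((e x₁).1, (e x₁).2)) := by
    rw [Prod.mk.eta, e.left_inv hx₁s]
    exact (isOpen_interior.inter (isOpen_box e (e x) r)).mem_nhds
      ⟨hx₁, box_subset_box (by linarith) hx₁b⟩
  have hcont2 : ∀ᶠ y in 𝓝 (e x₁).2, ((e x₁).1, y) ∈ e.target :=
    (Continuous.prodMk_right (e x₁).1).continuousAt.eventually
      (e.open_target.eventually_mem (e.map_source hx₁s))
  obtain ⟨ρ, hρ0, hρ⟩ := Metric.eventually_nhds_iff_ball.1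
    ((hcont.eventually (Filter.eventually_mem_set.2 hnhds)).and hcont2)
  have huc := unique_continuation (ι := Fin q') (p := (e x₁).2) (r := ρ) (R := r / 2) (B := B)
    (a := tinv F e (e x)) (w := fun α y => tmap e (e x) e' φ y α) hρ0
    (fun i j y _ => tinv_symm i j y)
    (fun i j y hy => (contDiffAt_tinv he hr (hKr y (hball hy)) i j).contDiffWithinAt)
    (fun y hy ξ hξ => tinv_pos he hr (hKr y (hball hy)) hξ)
    (fun α y hy => (contDiffAt_component
      (contDiffAt_tmap he hr he' hφ.1 hmap (hKr y (hball hy))) α).contDiffWithinAt)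
    (fun y hy α => hB y (hball hy) α)
    (fun y hy α i => by
      obtain ⟨⟨h1, h2⟩, h3⟩ := hρ y hy
      have h5 : e.symm ((e x₁).1, y) ∈ {x | F.dT F' φ x = 0} := interior_subset h1
      have h4 := (dT_eq_zero_iff he hr he' hφ.1 hmap h2).1 h5 α i
      rwa [e.right_inv h3] at h4)
  rw [mem_interior_iff_mem_nhds]
  filter_upwards [(isOpen_box e (e x) (r / 4)).mem_nhds hxb] with z hz
  refine (dT_eq_zero_iff he hr he' hφ.1 hmap (box_subset_box (by linarith) hz)).2 fun α a =>
    huc _ ?_ α a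
  rw [Metric.mem_ball]
  have hd₂ : dist (e z).2 (e x).2 < r / 4 := snd_mem_ball hz
  linarith [dist_triangle_right (e z).2 (e x₁).2 (e x).2]

end Maps

end Foliation

theorem proposition5p8 {p q n p' q' n' : ℕ}
    {M : Type*} [TopologicalSpace M] [T2Space M] [SecondCountableTopology M] [ConnectedSpace M]
    [ChartedSpace (EuclideanSpace ℝ (Fin n)) M] [IsManifold (𝓡 n) ∞ M]
    [RiemannianBundle (fun x : M => TangentSpace (𝓡 n) x)]
    [IsContMDiffRiemannianBundle (𝓡 n) ∞ (EuclideanSpace ℝ (Fin n))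
      (fun x : M => TangentSpace (𝓡 n) x)]
    {M' : Type*} [TopologicalSpace M'] [T2Space M'] [SecondCountableTopology M']
    [ChartedSpace (EuclideanSpace ℝ (Fin n')) M'] [IsManifold (𝓡 n') ∞ M']
    [RiemannianBundle (fun x : M' => TangentSpace (𝓡 n') x)]
    [IsContMDiffRiemannianBundle (𝓡 n') ∞ (EuclideanSpace ℝ (Fin n'))
      (fun x : M' => TangentSpace (𝓡 n') x)]
    (F : Foliation p q n M) (hF : F.IsBundleLike)
    (F' : Foliation p' q' n' M') (hF' : F'.IsBundleLike)
    (f : M → ℝ) (hf : F.IsBasic f) (hf_nonconst : ∃ x y : M, f x ≠ f y)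
    (φ : M → M') (hφ : F.IsTransversallyHarmonic F' f φ)
    (hcons : F.SatisfiesConservationLaw F' f φ) :
    F.IsTransversallyConstant F' φ := by
  -- The interior is used instead of the zero set itself, since unique continuation starts from
  -- vanishing on an open set.
  have hclopen : IsClopen (interior {x | F.dT F' φ x = 0}) :=
    ⟨Foliation.isClosed_interior_dT_eq_zero hf hF hF' hφ, isOpen_interior⟩
  have huniv := hclopen.eq_univ
    (Foliation.nonempty_interior_dT_eq_zero hf hf_nonconst hF hF' hφ hcons)
  intro x
  have hx : x ∈ interior {x | F.dT F' φ x = 0} := huniv ▸ Set.mem_univ x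
  have hx' : x ∈ {x | F.dT F' φ x = 0} := interior_subset hx
  exact hx'
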